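/- Let $V=\bigoplus_{i\in\mathbb N}V_i$ be a vertex operator algebra of CFT type over $\mathbb C$ (so $\dim V_i<\infty$, $\dim V_0=1$), with vacuum $\mathbf 1$, conformal vector $\omega$ and modes $a_{(m)}$. *Enveloping algebra.* Let $\mathfrak L(V)=V\otimes\mathbb C[t,t^{-1}]/\operatorname{Im}(L_{-1}\otimes\mathrm{id}+\mathrm{id}\otimes\frac{d}{dt})$, write $a_{[i]}$ for the class of $a\otimes t^i$ (of degree $\deg a-i-1$), with the Lie bracket $[a_{[i]},b_{[j]}]=\sum_{k\ge 0}\binom ik(a_{(k)}b)_{[i+j-k]}$, and let $U$ be its universal enveloping algebra, graded by $U=\bigoplus_d U_d$. Put $N_L^nU_p=\sum_{j\le -n}U_{p-j}U_j$ and $N_R^nU_p=\sum_{i\ge n}U_iU_{p-i}=N_L^{n-p}U_p$, and let $\widehat U=\bigoplus_d\widehat U_d$ with $\widehat U_d=\varprojlim_n U_d/N_L^nU_d$. Let $\mathscr U=\widehat U/\overline J$, where $\overline J$ is the degreewise closure of the two-sided ideal $J$ generated by the vacuum relation $\mathbf 1_{[-1]}=1$ and the Jacobi relations $$\sum_{i\ge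 0}(-1)^i\binom{\ell}{i}\bigl(a_{[m+\ell-i]}b_{[n+i]}-(-1)^{\ell}b_{[n+\ell-i]}a_{[m+i]}\bigr)=\sum_{i\ge 0}\binom mi(a_{(\ell+i)}b)_{[m+n-i]}\qquad(a,b\in V,\ \ell,m,n\in\mathbb Z).$$ Let $\mathscr U_p$, $N_L^n\mathscr U_p$, $N_R^n\mathscr U_p$ be the images in $\mathscr U$ of $\widehat U_p$ and of the closures of $N_L^nU_p$, $N_R^nU_p$. *Mode transition algebra.* Let $\mathsf A=\mathscr U_0/N_L^1\mathscr U_0$ be the Zhu algebra of $V$. For a left $\mathsf A$-module $M$ put $\Phi^{\mathsf L}(M)_d=(\mathscr U_d/N_L^1\mathscr U_d)\otimes_{\mathscr U_0}M$, and let $$\mathfrak A_{p,q}=(\mathscr U_p/N_L^1\mathscr U_p)\otimes_{\mathscr U_0}\mathsf A\otimes_{\mathscr U_0}(\mathscr U_q/N_R^1\mathscr U_q)\qquad(p,q\in\mathbb Z),$$ with the left and right multiplications by homogeneous elements of $\mathscr U$, hence by homogeneous elements of $\mathfrak L(V)$. For $\alpha\in\mathscr U_{-m}$ and $\beta\in\mathscr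 U_m$ let $\alpha\circledast\beta=[\alpha\beta]\in\mathsf A$. The operations $$\star\colon\mathfrak A_{n,-m}\times\Phi^{\mathsf L}(M)_m\to\Phi^{\mathsf L}(M)_n,\quad (u\otimes a\otimes u')\star(\beta\otimes w)=u\otimes a(u'\circledast\beta)w,$$ $$\star\colon\mathfrak A_{n,-m}\times\mathfrak A_{m,q}\to\mathfrak A_{n,q},\quad (u\otimes a\otimes u')\star(\beta\otimes b\otimes\beta')=u\otimes a(u'\circledast\beta)b\otimes\beta'$$ make $\mathfrak A_d:=\mathfrak A_{d,-d}$ a ring (the $d$-th mode transition algebra), which acts on $\Phi^{\mathsf L}(M)_d$. *Statement.* Assume that for every $d\in\mathbb N$ the ring $\mathfrak A_d$ is unital, with unity $\mathscr I_d\in\mathfrak A_d$. Then the following are equivalent: 1. for all $d,n,m\in\mathbb N$, all $u\in\mathfrak L(V)_d$ and all $\mathfrak a\in\mathfrak A_{n,-m}$ one has $(u\cdot\mathscr I_n)\star\mathfrak a=u\cdot\mathfrak a$ and $\mathfrak a\star(\mathscr I_m\cdot u)=\mathfrak a\cdot u$; 2. for all $n,m\in\mathbb N$ and all $\mathfrak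 a\in\mathfrak A_{n,-m}$ one has $\mathscr I_n\star\mathfrak a=\mathfrak a=\mathfrak a\star\mathscr I_m$; 3. for every $d\in\mathbb N$ the homomorphism $\mathfrak A_d\to\operatorname{End}(\Phi^{\mathsf L}(\mathsf A)_d)$ is unital, i.e. sends $\mathscr I_d$ to the identity; 4. for every $d\in\mathbb N$ the homomorphism $\mathfrak A_d\to\operatorname{End}(\Phi^{\mathsf L}(\mathsf A)_d)$ is unital and injective; 5. for every $d\in\mathbb N$ and every left $\mathsf A$-module $M$ the homomorphism $\mathfrak A_d\to\operatorname{End}(\Phi^{\mathsf L}(M)_d)$ is unital. -/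

import Mathlib

open scoped TensorProduct

universe u

noncomputable section

/-! ## Vertex operator algebras of CFT type -/

/-- A vertex operator algebra of CFT type over `ℂ`.  The axiom that vertex operators are fields
(`a_(m) b = 0` for `m ≫ 0`) is built into `VertexOperator`, and `VertexOperator.ncoeff (Y a) m`
is the mode `a_(m)`, so that `Y(a, z) = ∑ a_(m) z^(-m-1)`. -/
class VertexOperatorAlgebra (V : Type u) [AddCommGroup V] [Module ℂ V] where
  /-- the homogeneous pieces `V_i` -/
  piece : ℕ → Submodule ℂ V
  isInternal : DirectSum.IsInternal piece
  finiteDimensional : ∀ i, FiniteDimensional ℂ (piece i)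
  finrank_piece_zero : Module.finrank ℂ (piece 0) = 1
  /-- the vacuum vector -/
  vac : V
  vac_mem : vac ∈ piece 0
  /-- the conformal vector -/
  omega : V
  omega_mem : omega ∈ piece 2
  /-- the state-field correspondence -/
  Y : V →ₗ[ℂ] VertexOperator ℂ V
  vac_mode : ∀ m : ℤ, VertexOperator.ncoeff (Y vac) m = if m = -1 then LinearMap.id else 0
  mode_neg_one_vac : ∀ a : V, VertexOperator.ncoeff (Y a) (-1) vac = a
  mode_nonneg_vac : ∀ (a : V) (m : ℤ), 0 ≤ m → VertexOperator.ncoeff (Y a) m vac = 0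
  /-- `(z₁ - z₂)^N [Y(a, z₁), Y(b, z₂)] = 0`, coefficient by coefficient -/
  weak_commutativity : ∀ a b : V, ∃ N : ℕ, ∀ m n : ℤ,
    ∑ j ∈ Finset.range (N + 1), ((-1 : ℂ) ^ j * (N.choose j : ℂ)) •
      ⁅VertexOperator.ncoeff (Y a) (m + N - j), VertexOperator.ncoeff (Y b) (n + j)⁆ = 0
  /-- the central charge -/
  centralCharge : ℂ
  virasoro : ∀ p q : ℤ,
    ⁅VertexOperator.ncoeff (Y omega) (p + 1), VertexOperator.ncoeff (Y omega) (q + 1)⁆ =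
      ((p : ℂ) - q) • VertexOperator.ncoeff (Y omega) (p + q + 1) +
        (if p + q = 0 then centralCharge / 12 * ((p : ℂ) ^ 3 - p) else 0) • LinearMap.id
  L_zero : ∀ (i : ℕ) (v : V), v ∈ piece i → VertexOperator.ncoeff (Y omega) 1 v = (i : ℂ) • v
  /-- `Y(L_{-1} a, z) = d/dz Y(a, z)`, coefficient by coefficient -/
  translation : ∀ (a : V) (m : ℤ),
    VertexOperator.ncoeff (Y (VertexOperator.ncoeff (Y omega) 0 a)) m =
      (-(m : ℂ)) • VertexOperator.ncoeff (Y a) (m - 1)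

namespace VertexOperatorAlgebra

section Enveloping

variable (V : Type u) [AddCommGroup V] [Module ℂ V] [VertexOperatorAlgebra V]

variable {V} in
/-- The mode `a_(m)`. -/
def mode (a : V) (m : ℤ) : Module.End ℂ V := VertexOperator.ncoeff (Y a) m

variable {V} in
/-- `L_{-1} = ω_(0)`. -/
def Lneg : V →ₗ[ℂ] V := mode (omega : V) 0

/-! ## The finite ancillary Lie algebra and its enveloping algebra -/

/-- The operator `∇ = L_{-1} ⊗ id + id ⊗ d/dt` on `V ⊗ ℂ[t, t⁻¹]`, the latter being realized as
the space `ℤ →₀ V` of Laurent polynomials with coefficients in `V`. -/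
def nabla : (ℤ →₀ V) →ₗ[ℂ] (ℤ →₀ V) :=
  Finsupp.lsum ℂ fun i : ℤ =>
    Finsupp.lsingle i ∘ₗ Lneg + (i : ℂ) • Finsupp.lsingle (i - 1)

/-- The space underlying the finite ancillary Lie algebra `𝔏(V)^f = V ⊗ ℂ[t, t⁻¹] / im ∇`. -/
abbrev FinLie : Type u := (ℤ →₀ V) ⧸ LinearMap.range (nabla V)

variable {V} in
/-- `a_[i]`, the class of `a ⊗ t^i`. -/
def lieMode (a : V) (i : ℤ) : FinLie V := Submodule.Quotient.mk (Finsupp.single i a)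

/-- The piece of degree `d`: it is spanned by the `a_[i]` with `a` homogeneous and
`deg a - i - 1 = d`. -/
def finLiePiece (d : ℤ) : Submodule ℂ (FinLie V) :=
  Submodule.span ℂ {x | ∃ (k : ℕ) (a : V) (i : ℤ), a ∈ piece k ∧ (k : ℤ) - i - 1 = d ∧
    x = lieMode a i}

/-- The relations `x ⊗ y - y ⊗ x = [x, y]` of the universal enveloping algebra, for the Lie bracket
`[a_[i], b_[j]] = ∑_{k ≥ 0} (i choose k) (a_(k) b)_[i + j - k]`; the sum is finite. -/
inductive EnvRel : TensorAlgebra ℂ (FinLie V) → TensorAlgebra ℂ (FinLie V) → Prop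
  | bracket (a b : V) (i j : ℤ) :
      EnvRel
        (TensorAlgebra.ι ℂ (lieMode a i) * TensorAlgebra.ι ℂ (lieMode b j) -
          TensorAlgebra.ι ℂ (lieMode b j) * TensorAlgebra.ι ℂ (lieMode a i))
        (TensorAlgebra.ι ℂ
          (∑ᶠ k : ℕ, (Ring.choose i k : ℂ) • lieMode (mode a k b) (i + j - k)))

/-- `U`, the universal enveloping algebra of `𝔏(V)^f`. -/
def Env : Type u := RingQuot (EnvRel V)

instance : Ring (Env V) := inferInstanceAs (Ring (RingQuot (EnvRel V)))
instance : Algebra ℂ (Env V) := inferInstanceAs (Algebra ℂ (RingQuot (EnvRel V)))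

/-- The canonical map `𝔏(V)^f → U`. -/
def envι : FinLie V →ₗ[ℂ] Env V :=
  (RingQuot.mkAlgHom ℂ (EnvRel V)).toLinearMap ∘ₗ TensorAlgebra.ι ℂ

/-- `IsMonomial d x`: `x` is a product of homogeneous elements `a_[i]` (possibly the empty product)
whose degrees add up to `d`. -/
inductive IsMonomial : ℤ → Env V → Prop
  | one : IsMonomial 0 1
  | mul (k : ℕ) (a : V) (i d : ℤ) (x : Env V) : a ∈ piece k → IsMonomial d x →
      IsMonomial ((k : ℤ) - i - 1 + d) (envι V (lieMode a i) * x)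

/-- `U_d`. -/
def envPiece (d : ℤ) : Submodule ℂ (Env V) := Submodule.span ℂ {x | IsMonomial V d x}

/-- The left ideal `N_L^n U = U U_{≤ -n}`. -/
def envNL (n : ℤ) : Submodule ℂ (Env V) := ⊤ * ⨆ (j : ℤ) (_ : j ≤ -n), envPiece V j

/-- `N_L^n U_p = ∑_{j ≤ -n} U_{p-j} U_j`. -/
def envNLPiece (n p : ℤ) : Submodule ℂ (Env V) :=
  ⨆ (j : ℤ) (_ : j ≤ -n), envPiece V (p - j) * envPiece V j

/-- `N_R^n U_p = ∑_{i ≥ n} U_i U_{p-i}`. -/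
def envNRPiece (n p : ℤ) : Submodule ℂ (Env V) :=
  ⨆ (i : ℤ) (_ : n ≤ i), envPiece V i * envPiece V (p - i)

/-- The left and right neighborhoods agree up to a shift. -/
theorem envNRPiece_eq (n p : ℤ) : envNRPiece V n p = envNLPiece V (n - p) p := by
  apply le_antisymm
  · refine iSup₂_le fun i hi => ?_
    refine le_trans ?_ (le_iSup₂ (p - i) (by lia))
    rw [show p - (p - i) = i by ring]
  · refine iSup₂_le fun j hj => ?_
    refine le_trans ?_ (le_iSup₂ (p - j) (by lia))
    rw [show p - (p - j) = j by ring]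

variable {V}

theorem IsMonomial.mul_mono {d e : ℤ} {x y : Env V} (hx : IsMonomial V d x)
    (hy : IsMonomial V e y) : IsMonomial V (d + e) (x * y) := by
  induction hx with
  | one => simpa using hy
  | mul k a i d x ha _ ih =>
    rw [mul_assoc, add_assoc]
    exact IsMonomial.mul k a i _ _ ha ih

theorem envPiece_mul_le (d e : ℤ) : envPiece V d * envPiece V e ≤ envPiece V (d + e) := by
  rw [envPiece, envPiece, Submodule.span_mul_span]
  refine Submodule.span_mono ?_
  rintro _ ⟨x, hx, y, hy, rfl⟩
  exact hx.mul_mono hy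

theorem mul_mem_envPiece {d e : ℤ} {x y : Env V} (hx : x ∈ envPiece V d)
    (hy : y ∈ envPiece V e) : x * y ∈ envPiece V (d + e) :=
  envPiece_mul_le d e (Submodule.mul_mem_mul hx hy)

theorem one_mem_envPiece : (1 : Env V) ∈ envPiece V 0 := Submodule.subset_span IsMonomial.one

theorem envι_lieMode_mem {k : ℕ} {a : V} (ha : a ∈ piece k) (i : ℤ) :
    envι V (lieMode a i) ∈ envPiece V ((k : ℤ) - i - 1) := by
  have := IsMonomial.mul k a i 0 1 ha IsMonomial.one
  exact Submodule.subset_span (by simpa using this)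

theorem envι_mem {d : ℤ} {x : FinLie V} (hx : x ∈ finLiePiece V d) :
    envι V x ∈ envPiece V d := by
  induction hx using Submodule.span_induction with
  | mem x hx => obtain ⟨k, a, i, ha, rfl, rfl⟩ := hx; exact envι_lieMode_mem ha i
  | zero => simp
  | add x y _ _ hx hy => rw [map_add]; exact add_mem hx hy
  | smul c x _ hx => rw [map_smul]; exact Submodule.smul_mem _ _ hx

variable (V) in
theorem iSup_envPiece : (⨆ d : ℤ, envPiece V d) = ⊤ := by
  set S : Submodule ℂ (Env V) := ⨆ d : ℤ, envPiece V d with hS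
  have hle : ∀ d, envPiece V d ≤ S := fun d => le_iSup (envPiece V) d
  have hmul : ∀ x ∈ S, ∀ y ∈ S, x * y ∈ S := by
    intro x hx y hy
    have h : S * S ≤ S := by
      rw [hS, Submodule.iSup_mul]
      refine iSup_le fun d => ?_
      rw [Submodule.mul_iSup]
      exact iSup_le fun e => (envPiece_mul_le d e).trans (hle _)
    exact h (Submodule.mul_mem_mul hx hy)
  have hι : ∀ l : FinLie V, envι V l ∈ S := by
    intro l
    obtain ⟨f, rfl⟩ := Submodule.Quotient.mk_surjective _ l
    induction f using Finsupp.induction_linear with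
    | zero => simp
    | add f g hf hg => rw [Submodule.Quotient.mk_add, map_add]; exact add_mem hf hg
    | single i a =>
      have ha : a ∈ ⨆ k, piece (V := V) k := by
        rw [(isInternal (V := V)).submodule_iSup_eq_top]; trivial
      induction ha using Submodule.iSup_induction' with
      | mem k a ha => exact hle _ (envι_lieMode_mem ha i)
      | zero => simp
      | add a b _ _ ha hb =>
        rw [Finsupp.single_add, Submodule.Quotient.mk_add, map_add]; exact add_mem ha hb
  rw [eq_top_iff]
  rintro x -
  obtain ⟨t, rfl⟩ := RingQuot.mkAlgHom_surjective ℂ (EnvRel V) x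
  induction t using TensorAlgebra.induction with
  | algebraMap r =>
    have : (RingQuot.mkAlgHom ℂ (EnvRel V)) (algebraMap ℂ _ r) = r • (1 : Env V) := by
      rw [AlgHom.commutes, Algebra.algebraMap_eq_smul_one]; rfl
    rw [this]
    exact S.smul_mem _ (hle 0 one_mem_envPiece)
  | ι l => exact hι l
  | mul a b ha hb => rw [map_mul]; exact hmul _ ha _ hb
  | add a b ha hb => rw [map_add]; exact add_mem ha hb

theorem mul_mem_envNL (n : ℤ) (x : Env V) {y : Env V} (hy : y ∈ envNL V n) :
    x * y ∈ envNL V n := by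
  have h : (⊤ : Submodule ℂ (Env V)) * envNL V n ≤ envNL V n := by
    rw [envNL, ← mul_assoc]
    exact mul_le_mul' le_top le_rfl
  exact h (Submodule.mul_mem_mul trivial hy)

theorem envNL_anti {m n : ℤ} (h : m ≤ n) : envNL V n ≤ envNL V m :=
  mul_le_mul' le_rfl (iSup₂_le fun j hj => le_iSup₂_of_le j (by lia) le_rfl)

theorem envNL_mul_mem {n q : ℤ} {x y : Env V} (hx : x ∈ envNL V n) (hy : y ∈ envPiece V q) :
    x * y ∈ envNL V (n - q) := by
  have h : envNL V n * envPiece V q ≤ envNL V (n - q) := by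
    rw [envNL, envNL, mul_assoc]
    refine mul_le_mul' le_rfl ?_
    simp only [Submodule.iSup_mul]
    refine iSup₂_le fun j hj => ?_
    exact (envPiece_mul_le j q).trans (le_iSup₂_of_le (j + q) (by lia) le_rfl)
  exact h (Submodule.mul_mem_mul hx hy)

variable (V) in
theorem envNL_basis : RingSubgroupsBasis fun n : ℤ => (envNL V n).toAddSubgroup where
  inter i j := ⟨max i j, le_inf (envNL_anti (le_max_left i j)) (envNL_anti (le_max_right i j))⟩
  mul i := ⟨i, by rintro _ ⟨x, -, y, hy, rfl⟩; exact mul_mem_envNL i x hy⟩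
  leftMul x i := ⟨i, fun y hy => mul_mem_envNL i x hy⟩
  rightMul x i := by
    have hx : x ∈ ⨆ d : ℤ, envPiece V d := by rw [iSup_envPiece]; trivial
    induction hx using Submodule.iSup_induction' with
    | mem q x hx =>
      refine ⟨i + q, fun y hy => ?_⟩
      have := envNL_mul_mem (n := i + q) hy hx
      rw [add_sub_cancel_right] at this
      exact this
    | zero =>
      refine ⟨i, fun y _ => ?_⟩
      show y * 0 ∈ envNL V i
      rw [mul_zero]; exact zero_mem _
    | add x y _ _ hx hy =>
      obtain ⟨j, hj⟩ := hx
      obtain ⟨k, hk⟩ := hy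
      refine ⟨max j k, fun z hz => ?_⟩
      show z * (x + y) ∈ envNL V i
      rw [mul_add]
      exact add_mem (hj (envNL_anti (le_max_left j k) hz)) (hk (envNL_anti (le_max_right j k) hz))

variable (V)

/-! ## Completion -/

/-- The topology on `U` in which the `N_L^n U` form a basis of neighborhoods of `0`. -/
instance : TopologicalSpace (Env V) := (envNL_basis V).topology
instance : NonarchimedeanRing (Env V) := (envNL_basis V).nonarchimedean
instance : UniformSpace (Env V) := IsTopologicalAddGroup.rightUniformSpace (Env V)
instance : IsUniformAddGroup (Env V) := isUniformAddGroup_of_addCommGroup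

/-- The separated completion of `U`. It serves as the ambient ring of the graded completion. -/
abbrev EnvCompl : Type u := UniformSpace.Completion (Env V)

/-- The closure in `EnvCompl V` of the image of a subspace of `U`. -/
def closureImage (M : Submodule ℂ (Env V)) : AddSubgroup (EnvCompl V) :=
  (M.toAddSubgroup.map
    (UniformSpace.Completion.coeRingHom : Env V →+* EnvCompl V).toAddMonoidHom).topologicalClosure

/-- `Û_d = lim_n U_d / N_L^n U_d`, the completion of `U_d`. -/
def hatPiece (d : ℤ) : AddSubgroup (EnvCompl V) := closureImage V (envPiece V d)

/-- `N_L^n Û_p`, the closure of `N_L^n U_p`. -/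
def hatNL (n p : ℤ) : AddSubgroup (EnvCompl V) := closureImage V (envNLPiece V n p)

variable {V}

theorem mul_mem_closure_of {s t w : Set (EnvCompl V)} (h : ∀ x ∈ s, ∀ y ∈ t, x * y ∈ closure w)
    {x y : EnvCompl V} (hx : x ∈ closure s) (hy : y ∈ closure t) : x * y ∈ closure w := by
  have := map_mem_closure₂ (s := s) (t := t) (u := closure w)
    (f := fun a b : EnvCompl V => a * b) continuous_mul hx hy h
  rwa [closure_closure] at this

theorem mul_mem_closureImage {M N P : Submodule ℂ (Env V)} (h : M * N ≤ P) {x y : EnvCompl V}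
    (hx : x ∈ closureImage V M) (hy : y ∈ closureImage V N) : x * y ∈ closureImage V P := by
  refine mul_mem_closure_of (V := V) ?_ hx hy
  rintro _ ⟨a, ha, rfl⟩ _ ⟨b, hb, rfl⟩
  exact subset_closure ⟨a * b, h (Submodule.mul_mem_mul ha hb), UniformSpace.Completion.coe_mul a b⟩

theorem coe_mem_closureImage {M : Submodule ℂ (Env V)} {x : Env V} (hx : x ∈ M) :
    (x : EnvCompl V) ∈ closureImage V M :=
  subset_closure ⟨x, hx, rfl⟩

theorem closureImage_mono {M N : Submodule ℂ (Env V)} (h : M ≤ N) :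
    closureImage V M ≤ closureImage V N :=
  AddSubgroup.topologicalClosure_mono (AddSubgroup.map_mono h)

theorem hatPiece_mul {p q : ℤ} {x y : EnvCompl V} (hx : x ∈ hatPiece V p)
    (hy : y ∈ hatPiece V q) : x * y ∈ hatPiece V (p + q) :=
  mul_mem_closureImage (envPiece_mul_le p q) hx hy

theorem one_mem_hatPiece : (1 : EnvCompl V) ∈ hatPiece V 0 :=
  coe_mem_closureImage one_mem_envPiece

theorem hatNL_le (n p : ℤ) : hatNL V n p ≤ hatPiece V p := by
  refine closureImage_mono (iSup₂_le fun j _ => ?_)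
  have := envPiece_mul_le (V := V) (p - j) j
  rwa [sub_add_cancel] at this

theorem hatNL_mul {n p q : ℤ} {x y : EnvCompl V} (hx : x ∈ hatNL V n p)
    (hy : y ∈ hatPiece V q) : x * y ∈ hatNL V (n - q) (p + q) := by
  refine mul_mem_closureImage ?_ hx hy
  simp only [envNLPiece, Submodule.iSup_mul]
  refine iSup₂_le fun j hj => ?_
  refine le_trans ?_ (le_iSup₂ (j + q) (by lia))
  rw [show p + q - (j + q) = p - j by ring, mul_assoc]
  exact mul_le_mul' le_rfl (envPiece_mul_le j q)

theorem mul_hatNL {n p q : ℤ} {x y : EnvCompl V} (hx : x ∈ hatPiece V p)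
    (hy : y ∈ hatNL V n q) : x * y ∈ hatNL V n (p + q) := by
  refine mul_mem_closureImage ?_ hx hy
  simp only [envNLPiece, Submodule.mul_iSup]
  refine iSup₂_le fun j hj => ?_
  refine le_trans ?_ (le_iSup₂ j hj)
  rw [show p + q - j = p + (q - j) by ring, ← mul_assoc]
  exact mul_le_mul' (envPiece_mul_le p (q - j)) le_rfl

theorem iSup_mul_mem {ι : Type} {P Q S : ι → AddSubgroup (EnvCompl V)}
    (h : ∀ i j, ∀ x ∈ P i, ∀ y ∈ Q j, x * y ∈ ⨆ k, S k)
    {x y : EnvCompl V} (hx : x ∈ ⨆ i, P i) (hy : y ∈ ⨆ i, Q i) : x * y ∈ ⨆ k, S k := by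
  refine AddSubgroup.iSup_induction P (C := fun x => x * y ∈ ⨆ k, S k) hx
    (fun i x hx => ?_) ?_ ?_
  · refine AddSubgroup.iSup_induction Q (C := fun y => x * y ∈ ⨆ k, S k) hy
      (fun j y hy => h i j x hx y hy) ?_ ?_
    · rw [mul_zero]; exact zero_mem _
    · intro y z hy hz; rw [mul_add]; exact add_mem hy hz
  · rw [zero_mul]; exact zero_mem _
  · intro x z hx hz; rw [add_mul]; exact add_mem hx hz

variable (V)

/-- The graded completion `Û = ⨁_d Û_d` of `U`. -/
def Hat : Subring (EnvCompl V) where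
  __ := ⨆ d : ℤ, hatPiece V d
  mul_mem' hx hy := iSup_mul_mem (fun i j _ hx _ hy =>
    AddSubgroup.mem_iSup_of_mem (i + j) (hatPiece_mul hx hy)) hx hy
  one_mem' := AddSubgroup.mem_iSup_of_mem 0 one_mem_hatPiece

variable {V}

/-! ## The universal enveloping algebra of `V` -/

/-- The Jacobi relation
`∑_{i ≥ 0} (-1)^i (l choose i) (a_[m+l-i] b_[n+i] - (-1)^l b_[n+l-i] a_[m+i])
  - ∑_{i ≥ 0} (m choose i) (a_(l+i) b)_[m+n-i]`. -/
def jacobiTerm (a b : V) (l m n : ℤ) (i : ℕ) : Env V :=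
  ((-1 : ℂ) ^ i * (Ring.choose l i : ℂ)) •
      (envι V (lieMode a (m + l - i)) * envι V (lieMode b (n + i)) -
        ((-1 : ℂ) ^ l) • (envι V (lieMode b (n + l - i)) * envι V (lieMode a (m + i)))) -
    (Ring.choose m i : ℂ) • envι V (lieMode (mode a (l + i) b) (m + n - i))

/-- The (convergent) sum of the terms of the Jacobi relation. -/
def jacobi (a b : V) (l m n : ℤ) : EnvCompl V :=
  ∑' i : ℕ, (jacobiTerm a b l m n i : EnvCompl V)

theorem mode_eventually_zero (a b : V) (l : ℤ) :
    ∃ K : ℕ, ∀ i : ℕ, K ≤ i → mode a (l + i) b = 0 := by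
  set o := HahnSeries.order ((HahnModule.of ℂ).symm (Y a b)) with ho
  refine ⟨(1 - o - l).toNat, fun i hi => ?_⟩
  exact VertexOperator.ncoeff_eq_zero_of_lt_order (Y a) (l + i) b (by lia)

/-- The sum defining a Jacobi relation converges. -/
theorem summable_jacobiTerm {i j : ℕ} {a b : V} (ha : a ∈ piece i) (hb : b ∈ piece j)
    (l m n : ℤ) : Summable fun k : ℕ => (jacobiTerm a b l m n k : EnvCompl V) := by
  refine NonarchimedeanAddGroup.summable_of_tendsto_cofinite_zero ?_
  have h : Filter.Tendsto (jacobiTerm a b l m n) Filter.cofinite (nhds 0) := by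
    rw [Nat.cofinite_eq_atTop, ((envNL_basis V).hasBasis_nhds_zero).tendsto_right_iff]
    rintro N -
    obtain ⟨K, hK⟩ := mode_eventually_zero a b l
    filter_upwards [Filter.eventually_ge_atTop
      (max K ((max (j - n - 1) (i - m - 1) : ℤ) + N).toNat)] with k hk
    have hK' : mode a (l + k) b = 0 := hK k (le_trans (le_max_left _ _) hk)
    have hmem : ∀ (x : Env V) {y : Env V} {e : ℤ}, y ∈ envPiece V e → e ≤ -N →
        x * y ∈ envNL V N := fun x y e hy he =>
      Submodule.mul_mem_mul trivial (Submodule.mem_iSup_of_mem e (Submodule.mem_iSup_of_mem he hy))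
    have h1 : envι V (lieMode (mode a (l + k) b) (m + n - k)) = 0 := by
      rw [hK', lieMode, Finsupp.single_zero, Submodule.Quotient.mk_zero, map_zero]
    show jacobiTerm a b l m n k ∈ envNL V N
    rw [jacobiTerm, h1, smul_zero, sub_zero]
    refine Submodule.smul_mem _ _ (sub_mem (hmem _ (envι_lieMode_mem hb _) ?_)
      (Submodule.smul_mem _ _ (hmem _ (envι_lieMode_mem ha _) ?_)))
    · lia
    · lia
  have := (UniformSpace.Completion.continuous_coe (Env V)).tendsto 0 |>.comp h
  rwa [UniformSpace.Completion.coe_zero] at this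

variable (V)

/-- The homogeneous defining relations of degree `q`: the Jacobi relations for homogeneous `a`
and `b` (of degree `deg a + deg b - l - m - n - 2`), and the vacuum relation `1_[-1] = 1`
(of degree `0`), which makes the image of `1_[-1]` the identity. -/
inductive IsRelation : ℤ → EnvCompl V → Prop
  | jacobi (i j : ℕ) (a b : V) (l m n : ℤ) : a ∈ piece i → b ∈ piece j →
      IsRelation ((i : ℤ) + j - l - m - n - 2) (jacobi a b l m n)
  | vacuum : IsRelation 0 ((envι V (lieMode vac (-1)) - 1 : Env V) : EnvCompl V)

/-- The piece of degree `p` of the two-sided ideal `J` of `Û` generated by the relations. -/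
def relPiece (p : ℤ) : AddSubgroup (EnvCompl V) :=
  AddSubgroup.closure {z | ∃ (s q t : ℤ) (x r y : EnvCompl V), s + q + t = p ∧
    x ∈ hatPiece V s ∧ IsRelation V q r ∧ y ∈ hatPiece V t ∧ z = x * r * y}

/-- The piece of degree `p` of the closure of `J`. -/
def relClosurePiece (p : ℤ) : AddSubgroup (EnvCompl V) := (relPiece V p).topologicalClosure

variable {V}

theorem mul_relClosurePiece {p q : ℤ} {x y : EnvCompl V} (hx : x ∈ hatPiece V p)
    (hy : y ∈ relClosurePiece V q) : x * y ∈ relClosurePiece V (p + q) := by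
  have key : ∀ y ∈ relPiece V q, x * y ∈ relPiece V (p + q) := by
    intro y hy
    induction hy using AddSubgroup.closure_induction with
    | mem y hy =>
      obtain ⟨s, q, t, x', r, y', rfl, hx', hr, hy', rfl⟩ := hy
      exact AddSubgroup.subset_closure ⟨p + s, q, t, x * x', r, y', by ring,
        hatPiece_mul hx hx', hr, hy', by simp only [mul_assoc]⟩
    | zero => rw [mul_zero]; exact zero_mem _
    | add y z _ _ hy hz => rw [mul_add]; exact add_mem hy hz
    | neg y _ hy => rw [mul_neg]; exact neg_mem hy
  refine mul_mem_closure_of (V := V) (s := {x}) ?_ (subset_closure rfl) hy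
  rintro _ rfl y hy
  exact subset_closure (key y hy)

theorem relClosurePiece_mul {p q : ℤ} {x y : EnvCompl V} (hx : x ∈ relClosurePiece V p)
    (hy : y ∈ hatPiece V q) : x * y ∈ relClosurePiece V (p + q) := by
  have key : ∀ x ∈ relPiece V p, x * y ∈ relPiece V (p + q) := by
    intro x hx
    induction hx using AddSubgroup.closure_induction with
    | mem x hx =>
      obtain ⟨s, p, t, x', r, y', rfl, hx', hr, hy', rfl⟩ := hx
      exact AddSubgroup.subset_closure ⟨s, p, t + q, x', r, y' * y, by ring,
        hx', hr, hatPiece_mul hy' hy, by simp only [mul_assoc]⟩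
    | zero => rw [zero_mul]; exact zero_mem _
    | add x z _ _ hx hz => rw [add_mul]; exact add_mem hx hz
    | neg x _ hx => rw [neg_mul]; exact neg_mem hx
  refine mul_mem_closure_of (V := V) (t := {y}) ?_ hx (subset_closure rfl)
  rintro x hx _ rfl
  exact subset_closure (key x hx)

variable (V)

/-- The closure `J̄ = ⨁_p J̄_p` of `J`, a two-sided ideal of `Û`. -/
def relIdeal : Ideal (Hat V) where
  carrier := {x | (x : EnvCompl V) ∈ ⨆ p : ℤ, relClosurePiece V p}
  add_mem' hx hy := (⨆ p : ℤ, relClosurePiece V p).add_mem hx hy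
  zero_mem' := zero_mem (⨆ p : ℤ, relClosurePiece V p)
  smul_mem' c _ hx := iSup_mul_mem (fun i j _ hx _ hy =>
    AddSubgroup.mem_iSup_of_mem (i + j) (mul_relClosurePiece hx hy)) c.2 hx

instance : (relIdeal V).IsTwoSided where
  mul_mem_of_left {x} c hx := by
    have : (x : EnvCompl V) * c ∈ ⨆ p : ℤ, relClosurePiece V p := iSup_mul_mem
      (fun i j _ hx _ hy => AddSubgroup.mem_iSup_of_mem (i + j) (relClosurePiece_mul hx hy)) hx c.2
    exact this

/-- `𝒰 = Û / J̄`, the (finite) universal enveloping algebra of `V`. -/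
abbrev UnivEnv : Type u := Hat V ⧸ relIdeal V

/-- The image in `𝒰` of a subgroup of `Û`. -/
def imageInUnivEnv (K : AddSubgroup (EnvCompl V)) : AddSubgroup (UnivEnv V) :=
  (K.comap (Hat V).subtype.toAddMonoidHom).map (Ideal.Quotient.mk (relIdeal V)).toAddMonoidHom

variable {V} in
theorem mul_mem_imageInUnivEnv {K L M : AddSubgroup (EnvCompl V)}
    (h : ∀ x ∈ K, ∀ y ∈ L, x * y ∈ M) {x y : UnivEnv V} (hx : x ∈ imageInUnivEnv V K)
    (hy : y ∈ imageInUnivEnv V L) : x * y ∈ imageInUnivEnv V M := by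
  obtain ⟨x, hx, rfl⟩ := hx
  obtain ⟨y, hy, rfl⟩ := hy
  exact ⟨x * y, h _ hx _ hy, map_mul (Ideal.Quotient.mk (relIdeal V)) x y⟩

end Enveloping

end VertexOperatorAlgebra

/-! ## Graded seminormed rings, Zhu algebra, induced modules, mode transition algebra -/

/-- A family of homogeneous pieces `R_p` of a ring `R` together with a family of left neighborhoods
`N_L^n R_p` of `0` in these, which are compatible with the multiplication. -/
structure SeminormedGrading (R : Type u) [Ring R] where
  /-- `R_p` -/
  piece : ℤ → AddSubgroup R
  /-- `N_L^n R_p` -/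
  NL : ℤ → ℤ → AddSubgroup R
  NL_le : ∀ n p, NL n p ≤ piece p
  one_mem : (1 : R) ∈ piece 0
  mul_mem : ∀ {p q : ℤ} {x y : R}, x ∈ piece p → y ∈ piece q → x * y ∈ piece (p + q)
  NL_mul : ∀ {n p q : ℤ} {x y : R}, x ∈ NL n p → y ∈ piece q → x * y ∈ NL (n - q) (p + q)
  mul_NL : ∀ {n p q : ℤ} {x y : R}, x ∈ piece p → y ∈ NL n q → x * y ∈ NL n (p + q)

/-- The tensor product over `S` of `X` (on which `s : S` acts on the right through `ρ s`)
and `M` (on which `s : S` acts on the left through `lam s`): the quotient of `X ⊗_ℤ M` by the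
subgroup generated by the elements `x s ⊗ m - x ⊗ s m`. -/
def BalTensor {S X M : Type u} [AddCommGroup X] [AddCommGroup M]
    (ρ : S → X →+ X) (lam : S → M →+ M) : Type u :=
  (X ⊗[ℤ] M) ⧸ AddSubgroup.closure {t : X ⊗[ℤ] M | ∃ (s : S) (x : X) (m : M),
    t = ρ s x ⊗ₜ[ℤ] m - x ⊗ₜ[ℤ] lam s m}

namespace BalTensor

variable {S X M P : Type u} [AddCommGroup X] [AddCommGroup M] [AddCommGroup P]
  {ρ : S → X →+ X} {lam : S → M →+ M}

instance : AddCommGroup (BalTensor ρ lam) :=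
  inferInstanceAs (AddCommGroup ((X ⊗[ℤ] M) ⧸ AddSubgroup.closure _))

variable (ρ lam) in
/-- The class of `x ⊗ m`. -/
def tmul : X →+ M →+ BalTensor ρ lam :=
  AddMonoidHom.mk' (fun x => AddMonoidHom.mk'
      (fun m => (QuotientAddGroup.mk (x ⊗ₜ[ℤ] m) : (X ⊗[ℤ] M) ⧸ AddSubgroup.closure _))
      fun m m' => by rw [TensorProduct.tmul_add]; rfl)
    fun x x' => by ext m; exact congrArg _ (TensorProduct.add_tmul x x' m)

theorem tmul_balanced (s : S) (x : X) (m : M) :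
    tmul ρ lam (ρ s x) m = tmul ρ lam x (lam s m) := by
  refine (QuotientAddGroup.eq_iff_sub_mem).2 (AddSubgroup.subset_closure ⟨s, x, m, rfl⟩)

/-- The map on the tensor product induced by a balanced biadditive map. -/
def lift (f : X →+ M →+ P) (hf : ∀ s x m, f (ρ s x) m = f x (lam s m)) : BalTensor ρ lam →+ P :=
  QuotientAddGroup.lift _
    (TensorProduct.liftAddHom (R := ℤ) f fun r x m => by simp) (by
      rw [AddSubgroup.closure_le]
      rintro _ ⟨s, x, m, rfl⟩
      simp [hf])

@[simp]
theorem lift_tmul (f : X →+ M →+ P) (hf : ∀ s x m, f (ρ s x) m = f x (lam s m)) (x : X) (m : M) :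
    lift f hf (tmul ρ lam x m) = f x m := rfl

@[ext]
theorem hom_ext {f g : BalTensor ρ lam →+ P}
    (h : ∀ x m, f (tmul ρ lam x m) = g (tmul ρ lam x m)) : f = g := by
  refine QuotientAddGroup.addMonoidHom_ext _ ?_
  ext t
  induction t using TensorProduct.induction_on with
  | zero => simp
  | tmul x m => exact h x m
  | add t t' ht ht' => rw [map_add, map_add, ht, ht']

end BalTensor

namespace SeminormedGrading

variable {R : Type u} [Ring R] (G : SeminormedGrading R)

/-- `N_R^n R_p`, which agrees with `N_L^{n-p} R_p`. -/
def NR (n p : ℤ) : AddSubgroup R := G.NL (n - p) p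

/-- The subring `R_0`. -/
def zeroRing : Subring R where
  __ := G.piece 0
  mul_mem' hx hy := by simpa using G.mul_mem hx hy
  one_mem' := G.one_mem

/-- The two-sided ideal `N^1 R_0` of `R_0`. -/
def zhuIdeal : Ideal G.zeroRing where
  carrier := {x | (x : R) ∈ G.NL 1 0}
  add_mem' hx hy := add_mem (S := AddSubgroup R) hx hy
  zero_mem' := zero_mem (G.NL 1 0)
  smul_mem' c x hx := by simpa using G.mul_NL c.2 hx

instance : G.zhuIdeal.IsTwoSided where
  mul_mem_of_left {x} c hx := by
    have := G.NL_mul (q := 0) (y := (c : R)) hx c.2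
    rw [sub_zero, add_zero] at this
    exact this

/-- The Zhu algebra `A = R_0 / N^1 R_0`. -/
abbrev Zhu : Type u := G.zeroRing ⧸ G.zhuIdeal

/-- `R_0 → A`. -/
def toZhu : G.zeroRing →+* G.Zhu := Ideal.Quotient.mk G.zhuIdeal

/-- `(R / N_L^1 R)_p = R_p / N_L^1 R_p`. -/
abbrev LQ (p : ℤ) : Type u := G.piece p ⧸ (G.NL 1 p).addSubgroupOf (G.piece p)

/-- `(R / N_R^1 R)_p = R_p / N_R^1 R_p`. -/
abbrev RQ (p : ℤ) : Type u := G.piece p ⧸ (G.NR 1 p).addSubgroupOf (G.piece p)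

/-- Multiplication `R_p × R_q → R_k` for `k = p + q`. -/
def mulHom {p q k : ℤ} (h : p + q = k) : G.piece p →+ G.piece q →+ G.piece k :=
  AddMonoidHom.mk' (fun x => AddMonoidHom.mk'
      (fun y => ⟨x * y, h ▸ G.mul_mem x.2 y.2⟩)
      fun y y' => Subtype.ext (mul_add (x : R) y y'))
    fun x x' => by ext y; exact add_mul (x : R) x' y

/-- Left multiplication by `u ∈ R_p` on `R / N_L^1 R`. -/
def lmulLQ {p : ℤ} (u : G.piece p) (q : ℤ) : G.LQ q →+ G.LQ (p + q) :=
  QuotientAddGroup.map _ _ (G.mulHom rfl u) fun _ hx => G.mul_NL u.2 hx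

/-- Right multiplication by `r ∈ R_0` on `(R / N_L^1 R)_q`. -/
def rmulLQ (q : ℤ) (r : G.zeroRing) : G.LQ q →+ G.LQ q :=
  QuotientAddGroup.map _ _ ((G.mulHom (add_zero q)).flip r) fun x hx => by
    have := G.NL_mul (q := 0) (y := (r : R)) hx r.2
    rw [sub_zero, add_zero] at this
    exact this

/-- Right multiplication by `u ∈ R_p` on `R / N_R^1 R`. -/
def rmulRQ {p : ℤ} (u : G.piece p) (q : ℤ) : G.RQ q →+ G.RQ (q + p) :=
  QuotientAddGroup.map _ _ ((G.mulHom rfl).flip u) fun x hx => by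
    have := G.NL_mul (q := p) (y := (u : R)) hx u.2
    rw [sub_sub] at this
    exact this

/-- Left multiplication by `r ∈ R_0` on `(R / N_R^1 R)_q`. -/
def lmulRQ (q : ℤ) (r : G.zeroRing) : G.RQ q →+ G.RQ q :=
  QuotientAddGroup.map _ _ (G.mulHom (zero_add q) r) fun x hx => by
    have := G.mul_NL (p := 0) (x := (r : R)) r.2 hx
    rw [zero_add] at this
    exact this

/-- The pairing `(R / N_R^1 R)_{-p} × (R / N_L^1 R)_p → A`, `(α, β) ↦ α ⊛ β = [α β]`. -/
def pairing (p : ℤ) : G.RQ (-p) →+ G.LQ p →+ G.Zhu :=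
  QuotientAddGroup.lift _
    (AddMonoidHom.mk' (fun α => QuotientAddGroup.lift _
        (G.toZhu.toAddMonoidHom.comp (G.mulHom (neg_add_cancel p) α) : G.piece p →+ G.Zhu)
        (by
          intro β hβ
          refine Ideal.Quotient.eq_zero_iff_mem.2 ?_
          have := G.mul_NL (p := -p) α.2 hβ
          rw [neg_add_cancel] at this
          exact this))
      fun α α' => by
        ext β
        exact congrArg G.toZhu (Subtype.ext (add_mul (α : R) α' β)))
    (by
      intro α hα
      ext β
      refine Ideal.Quotient.eq_zero_iff_mem.2 ?_
      have := G.NL_mul (q := p) hα β.2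
      rw [neg_add_cancel, sub_neg_eq_add, add_sub_cancel_right] at this
      exact this)

/-- The degree `q` piece `Φ^L(W)_q = (R / N_L^1 R)_q ⊗_{R_0} W` of the left generalized Verma module
of a left `A`-module `W`. -/
abbrev VermaL (W : Type u) [AddCommGroup W] [Module G.Zhu W] (q : ℤ) : Type u :=
  BalTensor (G.rmulLQ q) fun r => DistribSMul.toAddMonoidHom W (G.toZhu r)

/-- The degree `q` piece `Φ^R(A)_q = A ⊗_{R_0} (R / N_R^1 R)_q` of the right generalized Verma
module of `A`. -/
abbrev VermaR (q : ℤ) : Type u :=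
  BalTensor (fun r : G.zeroRing => AddMonoidHom.mulRight (G.toZhu r)) (G.lmulRQ q)

/-- Left multiplication by `a ∈ A` on `Φ^R(A)`. -/
def zhuMul (q : ℤ) (a : G.Zhu) : G.VermaR q →+ G.VermaR q :=
  BalTensor.lift ((BalTensor.tmul _ _).comp (AddMonoidHom.mulLeft a)) fun s x m => by
    show BalTensor.tmul _ _ (a * (x * G.toZhu s)) m = BalTensor.tmul _ _ (a * x) (G.lmulRQ q s m)
    rw [← mul_assoc]
    exact BalTensor.tmul_balanced s (a * x) m

/-- The left `A`-module structure of `Φ^R(A)_q`. -/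
instance (q : ℤ) : Module G.Zhu (G.VermaR q) where
  smul a t := G.zhuMul q a t
  one_smul t := by
    have : G.zhuMul q 1 = AddMonoidHom.id _ := by ext x m; simp [zhuMul]
    exact congrArg (fun f => f t) this
  mul_smul a b t := by
    have : G.zhuMul q (a * b) = (G.zhuMul q a).comp (G.zhuMul q b) := by
      ext x m; simp [zhuMul, mul_assoc]
    exact congrArg (fun f => f t) this
  smul_zero a := map_zero _
  smul_add a := map_add _
  add_smul a b t := by
    have : G.zhuMul q (a + b) = G.zhuMul q a + G.zhuMul q b := by
      ext x m; simp [zhuMul, add_mul]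
    exact congrArg (fun f => f t) this
  zero_smul t := by
    have : G.zhuMul q 0 = 0 := by ext x m; simp [zhuMul]
    exact congrArg (fun f => f t) this

theorem smul_tmul (q : ℤ) (a b : G.Zhu) (y : G.RQ q) :
    a • (BalTensor.tmul _ _ b y : G.VermaR q) = BalTensor.tmul _ _ (a * b) y := rfl

/-- The piece `𝔄_{p,q} = (R / N_L^1 R)_p ⊗_{R_0} A ⊗_{R_0} (R / N_R^1 R)_q = Φ^L(Φ^R(A)_q)_p`
of bidegree `(p, q)` of the mode transition algebra. -/
abbrev MTA (p q : ℤ) : Type u := G.VermaL (G.VermaR q) p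

section Actions

variable {W : Type u} [AddCommGroup W] [Module G.Zhu W]

/-- The left action of `u ∈ R_p` on `Φ^L(W)`, `u · (β ⊗ w) = u β ⊗ w`. In particular, this is the
left action of `R` on `𝔄 = Φ^L(Φ^R(A))`. -/
def lact {p : ℤ} (u : G.piece p) (q : ℤ) : G.VermaL W q →+ G.VermaL W (p + q) :=
  BalTensor.lift ((BalTensor.tmul _ _).comp (G.lmulLQ u q)) fun s x m => by
    have h : G.lmulLQ u q (G.rmulLQ q s x) = G.rmulLQ (p + q) s (G.lmulLQ u q x) := by
      induction x using QuotientAddGroup.induction_on with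
      | H x =>
        refine congrArg QuotientAddGroup.mk (Subtype.ext ?_)
        exact (mul_assoc (u : R) x s).symm
    rw [AddMonoidHom.comp_apply, AddMonoidHom.comp_apply, h]
    exact BalTensor.tmul_balanced s _ m

/-- The right action of `u ∈ R_p` on `Φ^R(A)`, `(a ⊗ β) · u = a ⊗ β u`. -/
def ractVermaR {p : ℤ} (u : G.piece p) (q : ℤ) : G.VermaR q →+ G.VermaR (q + p) :=
  BalTensor.lift ((BalTensor.tmul _ _).compl₂ (G.rmulRQ u q))
    fun s x m => by
      have h : G.rmulRQ u q (G.lmulRQ q s m) = G.lmulRQ (q + p) s (G.rmulRQ u q m) := by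
        induction m using QuotientAddGroup.induction_on with
        | H x =>
          refine congrArg QuotientAddGroup.mk (Subtype.ext ?_)
          exact mul_assoc (s : R) x u
      simp only [AddMonoidHom.compl₂_apply]
      rw [h]
      exact BalTensor.tmul_balanced s x _

theorem ractVermaR_smul {p : ℤ} (u : G.piece p) (q : ℤ) (a : G.Zhu) (t : G.VermaR q) :
    G.ractVermaR u q (a • t) = a • G.ractVermaR u q t := by
  have : (G.ractVermaR u q).comp (G.zhuMul q a) = (G.zhuMul (q + p) a).comp (G.ractVermaR u q) := by
    ext x m; rfl
  exact congrArg (fun f => f t) this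

/-- The right action of `u ∈ R_p` on `𝔄`, `(x ⊗ a ⊗ β) · u = x ⊗ a ⊗ β u`. -/
def ract {p : ℤ} (u : G.piece p) (n q : ℤ) : G.MTA n q →+ G.MTA n (q + p) :=
  BalTensor.lift ((BalTensor.tmul _ _).compl₂ (G.ractVermaR u q)) fun s x t => by
    simp only [AddMonoidHom.compl₂_apply, DistribSMul.toAddMonoidHom_apply, ractVermaR_smul]
    exact BalTensor.tmul_balanced s x _

/-- The map `β ⊗ w ↦ a (y ⊛ β) w`, for fixed `a` and `y`. -/
def contractAux (m : ℤ) (a : G.Zhu) (y : G.RQ (-m)) : G.VermaL W m →+ W :=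
  BalTensor.lift
    (AddMonoidHom.mk' (fun β => DistribSMul.toAddMonoidHom W (a * G.pairing m y β))
      fun β β' => by ext w; simp [mul_add, add_smul])
    fun s β w => by
      have h : G.pairing m y (G.rmulLQ m s β) = G.pairing m y β * G.toZhu s := by
        induction β using QuotientAddGroup.induction_on with
        | H β =>
          induction y using QuotientAddGroup.induction_on with
          | H y => exact congrArg G.toZhu (Subtype.ext (mul_assoc (y : R) β s).symm)
      simp [h, mul_smul]

/-- The pairing `Φ^R(A)_{-m} × Φ^L(W)_m → W`, `(a ⊗ α', β ⊗ w) ↦ a (α' ⊛ β) w`. -/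
def contract (m : ℤ) : G.VermaR (-m) →+ G.VermaL W m →+ W :=
  BalTensor.lift
    (AddMonoidHom.mk' (fun a => AddMonoidHom.mk' (fun y => G.contractAux m a y)
        fun y y' => by ext β w; simp [contractAux, mul_add, add_smul])
      fun a a' => by ext y β w; simp [contractAux, add_mul, add_smul])
    fun s a y => by
      ext β w
      have h : G.pairing m (G.lmulRQ (-m) s y) β = G.toZhu s * G.pairing m y β := by
        induction β using QuotientAddGroup.induction_on with
        | H β =>
          induction y using QuotientAddGroup.induction_on with
          | H y => exact congrArg G.toZhu (Subtype.ext (mul_assoc (s : R) y β))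
      simp [contractAux, h, mul_assoc]

theorem contract_smul (m : ℤ) (a : G.Zhu) (t : G.VermaR (-m)) (z : G.VermaL W m) :
    G.contract m (a • t) z = a • G.contract m t z := by
  have : (G.contract (W := W) m).comp (G.zhuMul (-m) a) =
      (G.contract m).compr₂ (DistribSMul.toAddMonoidHom W a) := by
    ext b y β w
    simp [contract, contractAux, zhuMul, mul_assoc, mul_smul]
  exact congrArg (fun f => f t z) this

/-- The operation `⋆ : 𝔄_{n,-m} × Φ^L(W)_m → Φ^L(W)_n`,
`(x ⊗ a ⊗ α') ⋆ (β ⊗ w) = x ⊗ a (α' ⊛ β) w`. For `W = Φ^R(A)_q` this is the multiplication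
`⋆ : 𝔄_{n,-m} × 𝔄_{m,q} → 𝔄_{n,q}` of the mode transition algebra. -/
def star {n m : ℤ} : G.MTA n (-m) →+ G.VermaL W m →+ G.VermaL W n :=
  BalTensor.lift
    (AddMonoidHom.mk' (fun x => AddMonoidHom.mk'
        (fun t => (BalTensor.tmul _ _ x).comp (G.contract m t))
        fun t t' => by ext β w; simp)
      fun x x' => by ext t; simp)
    fun s x t => by
      ext z
      simp only [AddMonoidHom.mk'_apply, AddMonoidHom.comp_apply,
        DistribSMul.toAddMonoidHom_apply, contract_smul]
      exact BalTensor.tmul_balanced s x _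

end Actions

end SeminormedGrading

namespace VertexOperatorAlgebra

variable (V : Type u) [AddCommGroup V] [Module ℂ V] [VertexOperatorAlgebra V]

/-- The grading `𝒰_p` of `𝒰`, with the neighborhoods `N_L^n 𝒰_p`, the images of `N_L^n Û_p`. -/
def univGrading : SeminormedGrading (UnivEnv V) where
  piece p := imageInUnivEnv V (hatPiece V p)
  NL n p := imageInUnivEnv V (hatNL V n p)
  NL_le n p := AddSubgroup.map_mono (AddSubgroup.comap_mono (hatNL_le n p))
  one_mem := ⟨1, one_mem_hatPiece, map_one (Ideal.Quotient.mk (relIdeal V))⟩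
  mul_mem := mul_mem_imageInUnivEnv fun _ hx _ hy => hatPiece_mul hx hy
  NL_mul := mul_mem_imageInUnivEnv fun _ hx _ hy => hatNL_mul hx hy
  mul_NL := mul_mem_imageInUnivEnv fun _ hx _ hy => mul_hatNL hx hy

theorem coe_mem_Hat (x : Env V) : (x : EnvCompl V) ∈ Hat V := by
  have hx : x ∈ ⨆ d : ℤ, envPiece V d := by rw [iSup_envPiece]; trivial
  induction hx using Submodule.iSup_induction' with
  | mem d x hx => exact AddSubgroup.mem_iSup_of_mem d (coe_mem_closureImage hx)
  | zero => exact zero_mem (Hat V)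
  | add x y _ _ hx hy => rw [UniformSpace.Completion.coe_add]; exact add_mem hx hy

/-- The canonical map `U → 𝒰`. -/
def envToUnivEnv : Env V →+* UnivEnv V :=
  (Ideal.Quotient.mk (relIdeal V)).comp
    ((UniformSpace.Completion.coeRingHom : Env V →+* EnvCompl V).codRestrict (Hat V)
      (coe_mem_Hat V))

variable {V} in
/-- The image in `𝒰_d` of an element of `𝔏(V)_d`. -/
def ofLie {d : ℤ} (x : finLiePiece V d) : (univGrading V).piece d :=
  ⟨envToUnivEnv V (envι V x), ⟨⟨(envι V x : Env V), coe_mem_Hat V (envι V x)⟩,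
    coe_mem_closureImage (envι_mem x.2), rfl⟩⟩

/-- The Zhu algebra `A = A(V)`. -/
abbrev ZhuAlgebra : Type u := (univGrading V).Zhu

/-- The piece `𝔄_{p,q}` of the mode transition algebra of `V`; it vanishes unless `p ≥ 0 ≥ q`.
The `d`-th mode transition algebra `𝔄_d` is `𝔄_{d,-d}`. -/
abbrev ModeTransition (p q : ℤ) : Type u := (univGrading V).MTA p q

/-- `Φ^L(M)_q`. -/
abbrev Verma (M : Type u) [AddCommGroup M] [Module (ZhuAlgebra V) M] (q : ℤ) : Type u :=
  (univGrading V).VermaL M q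

variable {V}

/-- The multiplication `⋆ : 𝔄_{n,-m} × 𝔄_{m,q} → 𝔄_{n,q}`. -/
def star {n m q : ℤ} (a : ModeTransition V n (-m)) (b : ModeTransition V m q) :
    ModeTransition V n q :=
  (univGrading V).star (W := (univGrading V).VermaR q) a b

/-- The homomorphism `𝔄_d → End(Φ^L(M)_d)`. -/
def starEnd (M : Type u) [AddCommGroup M] [Module (ZhuAlgebra V) M] (d : ℤ) :
    ModeTransition V d (-d) →+ AddMonoid.End (Verma V M d) :=
  (univGrading V).star

/-- `u · 𝔞` for `u ∈ 𝔏(V)_d` and `𝔞 ∈ 𝔄_{n,q}`. -/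
def lieSmul {d n q : ℤ} (x : finLiePiece V d) (a : ModeTransition V n q) :
    ModeTransition V (d + n) q :=
  (univGrading V).lact (W := (univGrading V).VermaR q) (ofLie x) n a

/-- `𝔞 · u` for `u ∈ 𝔏(V)_d` and `𝔞 ∈ 𝔄_{n,q}`. -/
def smulLie {d n q : ℤ} (a : ModeTransition V n q) (x : finLiePiece V d) :
    ModeTransition V n (q + d) :=
  (univGrading V).ract (ofLie x) n q a

/-- `e` is a (two-sided) unity of the ring `𝔄_d = 𝔄_{d,-d}`. -/
def IsUnity {d : ℤ} (e : ModeTransition V d (-d)) : Prop :=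
  ∀ a : ModeTransition V d (-d), star e a = a ∧ star a e = a

end VertexOperatorAlgebra

end

/-!
Everything except the right half of (2) is formal: `⋆` is functorial in the module `M` and commutes
with the outer actions of `𝒰`, (1) specializes to (2) at `u = 𝟏_[-1] = 1`, and `Φ^L(M)` is built
from copies of `Φ^L(A)`.

Suppose that each `ℐ_n` acts as the identity on `Φ^L(A)_n`. Expanding `ℐ_m` gives dual bases, and
subtracting from `x ∈ 𝒰_{-m}` its expansion leaves an element orthogonal to `𝒰_m`, so
`𝔞 ⋆ ℐ_m = 𝔞` reduces to showing that such orthogonal elements vanish modulo `N_R^1`. They form a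
right `𝒰`-submodule, and right unitality of `ℐ_n` shows that the ideal `𝒰_{-n} 𝒰_n` of `𝒰_0` kills
those of degree `-n`. Let `x` be orthogonal of degree `-m < 0`. As `𝒰_{-m} 𝒰_m` kills `x`, the
Virasoro relation makes `L_0` act on `x` by `-c (m² - 1) / 24`; then, for `k > m`, the element
`x L_k L_{-k}` is a multiple of `x`, with a factor that is nonzero for large `k`, and therefore
`𝒰_{-n} 𝒰_n` kills `x` for all large `n`. The commutators `[L_n, a_[k-n]]` show that the zero modes
of states of positive degree kill `x` as well, so `𝒰_0` acts on `x` as it does on the vacuum. If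
`x` were nonzero, `𝒰_{-n} 𝒰_n` would kill the vacuum for large `n`, hence so would `𝒰_n`, because
`ℐ_n` writes each of its elements in terms of `𝒰_n (𝒰_{-n} 𝒰_n)`. But then `L_{-n} 𝟏 = 0`, which
forces `ω = 0` and so `m x = [x, L_0] = 0`.
-/

noncomputable section

theorem pow_smul_eq_zero_of_sub_pow {R M : Type*} [Ring R] [AddCommGroup M] [Module R M]
    {a b : R} (hab : Commute a b) {s t k : ℕ} {x : M} (h : (a ^ s * b ^ t) • x = 0)
    (hk : (a - b) ^ k • x = 0) : b ^ (s + k + t) • x = 0 := by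
  have hsub : Commute a (b - a) := hab.sub_right (Commute.refl a)
  have hb : Commute b (b - a) := (Commute.refl b).sub_right hab.symm
  have hk' : (b - a) ^ k • x = 0 := by rw [← neg_sub, neg_pow, mul_smul, hk, smul_zero]
  rw [pow_add, ← add_sub_cancel a b, hsub.add_pow, add_sub_cancel, Finset.sum_mul,
    Finset.sum_smul]
  refine Finset.sum_eq_zero fun j _ => ?_
  rw [← Nat.cast_comm, mul_assoc, mul_smul]
  refine smul_eq_zero_of_right _ ?_
  rcases le_or_gt s j with hsj | hjs
  · obtain ⟨i, rfl⟩ := Nat.exists_eq_add_of_le hsj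
    rw [(hsub.pow_pow (s + i) (s + k - (s + i))).eq, add_comm s i, pow_add a, mul_assoc, mul_assoc,
      mul_smul, mul_smul, h, smul_zero, smul_zero]
  · obtain ⟨i, hi⟩ := Nat.exists_eq_add_of_le (show k ≤ s + k - j by lia)
    rw [mul_assoc, ← (hb.pow_pow t _).eq, hi, add_comm k i, pow_add (b - a), ← mul_assoc,
      ← mul_assoc, mul_smul, hk', smul_zero]

theorem mul_choose_succ (l : ℂ) (i : ℕ) :
    ((i : ℂ) + 1) * Ring.choose l (i + 1) = (l - i) * Ring.choose l i := by
  have h := Ring.choose_smul_choose l (n := i + 1) (k := i) (Nat.le_succ i)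
  rw [Nat.choose_succ_self_right, Nat.add_sub_cancel_left, Ring.choose_one_right,
    nsmul_eq_mul] at h
  rw [mul_comm (l - i), ← h, Nat.cast_succ]

/-- A formal distribution `∑ f m n p z₁^(-m-1) z₂^(-n-1) z₃^(-p-1)` in three variables, given by
its coefficients. -/
abbrev FormalDistribution (W : Type*) : Type _ := ℤ → ℤ → ℤ → W

namespace FormalDistribution

variable {W : Type*} [AddCommGroup W] [Module ℂ W]

section Shifts

/-- Multiplication by `z₁`. -/
def mulZ₁ : Module.End ℂ (FormalDistribution W) where
  toFun f m n p := f (m + 1) n p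
  map_add' _ _ := rfl
  map_smul' _ _ := rfl

/-- Multiplication by `z₂`. -/
def mulZ₂ : Module.End ℂ (FormalDistribution W) where
  toFun f m n p := f m (n + 1) p
  map_add' _ _ := rfl
  map_smul' _ _ := rfl

/-- Multiplication by `z₃`. -/
def mulZ₃ : Module.End ℂ (FormalDistribution W) where
  toFun f m n p := f m n (p + 1)
  map_add' _ _ := rfl
  map_smul' _ _ := rfl

/-- Exchange of `z₁` and `z₂`. -/
def swap : Module.End ℂ (FormalDistribution W) where
  toFun f m n p := f n m p
  map_add' _ _ := rfl
  map_smul' _ _ := rfl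

/-- Multiplication by `z₁ - z₂`. -/
def mulDiff₁₂ : Module.End ℂ (FormalDistribution W) := mulZ₁ - mulZ₂

/-- Multiplication by `z₁ - z₃`. -/
def mulDiff₁₃ : Module.End ℂ (FormalDistribution W) := mulZ₁ - mulZ₃

/-- Multiplication by `z₂ - z₃`. -/
def mulDiff₂₃ : Module.End ℂ (FormalDistribution W) := mulZ₂ - mulZ₃

theorem commute_mulZ₁_mulZ₂ : Commute (mulZ₁ (W := W)) mulZ₂ := rfl

theorem commute_mulZ₁_mulZ₃ : Commute (mulZ₁ (W := W)) mulZ₃ := rfl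

theorem commute_mulZ₂_mulZ₃ : Commute (mulZ₂ (W := W)) mulZ₃ := rfl

theorem commute_mulDiff₁₃_mulDiff₂₃ : Commute (mulDiff₁₃ (W := W)) mulDiff₂₃ :=
  (commute_mulZ₁_mulZ₂.sub_right commute_mulZ₁_mulZ₃).sub_left
    (commute_mulZ₂_mulZ₃.symm.sub_right (Commute.refl _))

theorem mulDiff₁₃_sub_mulDiff₂₃ : mulDiff₁₃ (W := W) - mulDiff₂₃ = mulDiff₁₂ :=
  sub_sub_sub_cancel_right _ _ _

theorem swap_semiconj_mulDiff₁₃ : SemiconjBy (swap (W := W)) mulDiff₁₃ mulDiff₂₃ := rfl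

theorem swap_semiconj_mulDiff₂₃ : SemiconjBy (swap (W := W)) mulDiff₂₃ mulDiff₁₃ := rfl

theorem swap_mulDiff₁₂ (f : FormalDistribution W) : swap (mulDiff₁₂ f) = -mulDiff₁₂ (swap f) :=
  funext fun _ => funext fun _ => funext fun _ => (neg_sub _ _).symm

theorem swap_pow_mul_pow (s t : ℕ) (f : FormalDistribution W) :
    swap ((mulDiff₁₃ ^ s * mulDiff₂₃ ^ t : Module.End ℂ (FormalDistribution W)) f) =
      (mulDiff₁₃ ^ t * mulDiff₂₃ ^ s : Module.End ℂ (FormalDistribution W)) (swap f) := by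
  rw [(commute_mulDiff₁₃_mulDiff₂₃.pow_pow t s).eq]
  exact congrArg (fun T => T f)
    ((swap_semiconj_mulDiff₁₃.pow_right s).mul_right (swap_semiconj_mulDiff₂₃.pow_right t)).eq

theorem mulDiff₁₂_pow_apply (N : ℕ) (f : FormalDistribution W) (m n p : ℤ) :
    (mulDiff₁₂ ^ N) f m n p = ∑ j ∈ Finset.range (N + 1),
      ((-1 : ℂ) ^ j * (N.choose j : ℂ)) • f (m + N - j) (n + j) p := by
  have hneg : Commute (-mulZ₂ : Module.End ℂ (FormalDistribution W)) mulZ₁ :=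
    (commute_mulZ₁_mulZ₂ (W := W)).symm.neg_left
  have hZ₁ (k : ℕ) (g : FormalDistribution W) (m n p : ℤ) :
      (mulZ₁ ^ k) g m n p = g (m + k) n p := by
    induction k generalizing g with
    | zero => simp
    | succ k ih =>
      rw [pow_succ, Module.End.mul_apply, ih]
      exact congrArg (fun i => g i n p) (by push_cast; ring)
  have hZ₂ (k : ℕ) (g : FormalDistribution W) (m n p : ℤ) :
      ((-mulZ₂ : Module.End ℂ (FormalDistribution W)) ^ k) g m n p =
        (-1 : ℂ) ^ k • g m (n + k) p := by
    induction k generalizing g with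
    | zero => simp
    | succ k ih =>
      rw [pow_succ, Module.End.mul_apply, ih, pow_succ, mul_neg_one, neg_smul, ← smul_neg]
      exact congrArg (fun i => (-1 : ℂ) ^ k • -g m i p) (by push_cast; ring)
  rw [mulDiff₁₂, sub_eq_neg_add, hneg.add_pow, LinearMap.sum_apply, Finset.sum_apply,
    Finset.sum_apply, Finset.sum_apply]
  refine Finset.sum_congr rfl fun j hj => ?_
  rw [← Nat.cast_comm, Module.End.mul_apply, Module.End.natCast_apply, Module.End.mul_apply,
    Pi.smul_apply, Pi.smul_apply, Pi.smul_apply, hZ₂, hZ₁, mul_smul, smul_comm,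
    Nat.cast_smul_eq_nsmul, Nat.cast_sub (Finset.mem_range_succ_iff.1 hj), add_sub_assoc]

theorem mulDiff₁₃_pow_apply (N : ℕ) (f : FormalDistribution W) (m n p : ℤ) :
    (mulDiff₁₃ ^ N) f m n p = ∑ j ∈ Finset.range (N + 1),
      ((-1 : ℂ) ^ j * (N.choose j : ℂ)) • f (m + N - j) n (p + j) := by
  let swap₂₃ : Module.End ℂ (FormalDistribution W) :=
    { toFun := fun f m n p => f m p n, map_add' := fun _ _ => rfl, map_smul' := fun _ _ => rfl }
  have h : SemiconjBy swap₂₃ mulDiff₁₃ mulDiff₁₂ := rfl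
  exact (congrArg (fun T => T f m p n) (h.pow_right N).eq).trans (mulDiff₁₂_pow_apply N _ m p n)

theorem mulDiff₂₃_pow_apply (N : ℕ) (f : FormalDistribution W) (m n p : ℤ) :
    (mulDiff₂₃ ^ N) f m n p = ∑ j ∈ Finset.range (N + 1),
      ((-1 : ℂ) ^ j * (N.choose j : ℂ)) • f m (n + N - j) (p + j) :=
  (congrArg (fun T => T f n m p) (swap_semiconj_mulDiff₂₃.pow_right N).eq).trans
    (mulDiff₁₃_pow_apply N _ n m p)

end Shifts

section Expansion

variable (W) in
/-- The distributions whose coefficients, for each exponent of `z₃`, are bounded in the exponent of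
`z₂` uniformly in the exponent of `z₁`: these can be multiplied by `(z₁ - z₂)^l`, expanded in the
domain `|z₁| > |z₂|`. -/
def truncated : Submodule ℂ (FormalDistribution W) where
  carrier := {f | ∀ p, ∃ n₀ : ℤ, ∀ m n, n₀ ≤ n → f m n p = 0}
  zero_mem' _ := ⟨0, fun _ _ _ => rfl⟩
  add_mem' hf hg p := by
    obtain ⟨a, ha⟩ := hf p
    obtain ⟨b, hb⟩ := hg p
    refine ⟨max a b, fun m n h => ?_⟩
    simp only [Pi.add_apply, ha m n (le_of_max_le_left h), hb m n (le_of_max_le_right h), add_zero]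
  smul_mem' c f hf p := by
    obtain ⟨a, ha⟩ := hf p
    exact ⟨a, fun m n h => by simp only [Pi.smul_apply, ha m n h, smul_zero]⟩

theorem mulZ₁_mem_truncated {f : FormalDistribution W} (hf : f ∈ truncated W) :
    mulZ₁ f ∈ truncated W := fun p =>
  (hf p).imp fun _ h _ _ hn => h _ _ hn

theorem mulZ₂_mem_truncated {f : FormalDistribution W} (hf : f ∈ truncated W) :
    mulZ₂ f ∈ truncated W := fun p =>
  (hf p).imp fun _ h _ _ hn => h _ _ (by lia)

theorem mulZ₃_mem_truncated {f : FormalDistribution W} (hf : f ∈ truncated W) :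
    mulZ₃ f ∈ truncated W := fun p =>
  (hf (p + 1)).imp fun _ h _ _ hn => h _ _ hn

/-- The product `(z₁ - z₂)^l f`, where the power is expanded in the domain `|z₁| > |z₂|`. -/
def expand (l : ℤ) (f : FormalDistribution W) : FormalDistribution W := fun m n p =>
  ∑ᶠ i : ℕ, ((-1 : ℂ) ^ i * Ring.choose (l : ℂ) i) • f (m + l - i) (n + i) p

theorem expand_eq_sum (l : ℤ) {f : FormalDistribution W} {p n₀ : ℤ}
    (h : ∀ m n, n₀ ≤ n → f m n p = 0) (m : ℤ) {n : ℤ} {K : ℕ} (hK : n₀ ≤ n + K) :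
    expand l f m n p = ∑ i ∈ Finset.range K,
      ((-1 : ℂ) ^ i * Ring.choose (l : ℂ) i) • f (m + l - i) (n + i) p := by
  refine finsum_eq_sum_of_support_subset _ fun i hi => ?_
  rw [Finset.coe_range, Set.mem_Iio]
  by_contra! hlt
  exact hi (by simp only [h _ _ (show n₀ ≤ n + (i : ℤ) by lia), smul_zero])

@[simp]
theorem expand_zero_right (l : ℤ) : expand l (0 : FormalDistribution W) = 0 := by
  funext m n p
  simp [expand]

theorem expand_zero_left (f : FormalDistribution W) : expand 0 f = f := by
  funext m n p
  rw [expand, finsum_eq_single _ 0]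
  · simp
  · intro i hi
    obtain ⟨j, rfl⟩ := Nat.exists_eq_succ_of_ne_zero hi
    rw [Int.cast_zero, Nat.succ_eq_add_one, Ring.choose_zero_succ, mul_zero, zero_smul]

theorem expand_smul (l : ℤ) (c : ℂ) (f : FormalDistribution W) :
    expand l (c • f) = c • expand l f := by
  funext m n p
  simp only [expand, Pi.smul_apply, smul_comm _ c, smul_finsum]

theorem expand_add (l : ℤ) {f g : FormalDistribution W} (hf : f ∈ truncated W)
    (hg : g ∈ truncated W) : expand l (f + g) = expand l f + expand l g := by
  funext m n p
  obtain ⟨a, ha⟩ := hf p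
  obtain ⟨b, hb⟩ := hg p
  have ha' : ∀ m n, max a b ≤ n → f m n p = 0 := fun m n h => ha m n (le_of_max_le_left h)
  have hb' : ∀ m n, max a b ≤ n → g m n p = 0 := fun m n h => hb m n (le_of_max_le_right h)
  have hab : ∀ m n, max a b ≤ n → (f + g) m n p = 0 := fun m n h => by
    simp only [Pi.add_apply, ha' m n h, hb' m n h, add_zero]
  have hK : max a b ≤ n + ((max a b - n).toNat : ℤ) := by lia
  rw [Pi.add_apply, Pi.add_apply, Pi.add_apply, expand_eq_sum l ha' m hK, expand_eq_sum l hb' m hK,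
    expand_eq_sum l hab m hK, ← Finset.sum_add_distrib]
  exact Finset.sum_congr rfl fun i _ => smul_add _ _ _

theorem expand_sub (l : ℤ) {f g : FormalDistribution W} (hf : f ∈ truncated W)
    (hg : g ∈ truncated W) : expand l (f - g) = expand l f - expand l g := by
  have hneg : expand l (-g) = -expand l g := by simpa using expand_smul l (-1) g
  rw [sub_eq_add_neg, sub_eq_add_neg, expand_add l hf (neg_mem hg), hneg]

theorem expand_map {W' : Type*} [AddCommGroup W'] [Module ℂ W'] (l : ℤ) {f : FormalDistribution W}
    (hf : f ∈ truncated W) (T : ℤ → W →ₗ[ℂ] W') :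
    expand l (fun m n p => T p (f m n p)) = fun m n p => T p (expand l f m n p) := by
  funext m n p
  obtain ⟨a, ha⟩ := hf p
  have hK : a ≤ n + ((a - n).toNat : ℤ) := by lia
  rw [expand_eq_sum l ha m hK, expand_eq_sum l (n₀ := a) (fun m n h => by rw [ha m n h, map_zero])
    m hK, map_sum]
  simp only [map_smul]

theorem expand_add_one (l : ℤ) {f : FormalDistribution W} (hf : f ∈ truncated W) :
    expand (l + 1) f = mulDiff₁₂ (expand l f) := by
  funext m n p
  obtain ⟨a, ha⟩ := hf p
  set K := (a - n).toNat
  have hcomm (x y z : W) : x + y - z = x - z + y := add_sub_right_comm x y z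
  change expand (l + 1) f m n p = expand l f (m + 1) n p - expand l f m (n + 1) p
  rw [expand_eq_sum (l + 1) ha m (K := K + 1) (by lia), expand_eq_sum l ha (m + 1) (K := K + 1)
    (by lia), expand_eq_sum l ha m (n := n + 1) (K := K) (by lia), Finset.sum_range_succ',
    Finset.sum_range_succ' _ K, hcomm, ← Finset.sum_sub_distrib]
  congr 1
  · refine Finset.sum_congr rfl fun i _ => ?_
    rw [show m + (l + 1) - ((i + 1 : ℕ) : ℤ) = m + l - i by push_cast; ring,
      show m + 1 + l - ((i + 1 : ℕ) : ℤ) = m + l - i by push_cast; ring,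
      show n + ((i + 1 : ℕ) : ℤ) = n + 1 + i by push_cast; ring, ← sub_smul, Int.cast_add,
      Int.cast_one, Ring.choose_succ_succ]
    congr 1
    ring
  · simp only [Ring.choose_zero_right]
    rw [show m + (l + 1) = m + 1 + l by ring]

theorem expand_mulDiff₁₃ (l : ℤ) {f : FormalDistribution W} (hf : f ∈ truncated W) :
    expand l (mulDiff₁₃ f) = mulDiff₁₃ (expand l f) := by
  have hZ₁ : expand l (mulZ₁ f) = mulZ₁ (expand l f) := by
    funext m n p
    refine finsum_congr fun i => ?_
    rw [show m + 1 + l - (i : ℤ) = m + l - i + 1 by ring]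
    rfl
  rw [mulDiff₁₃, LinearMap.sub_apply, expand_sub l (mulZ₁_mem_truncated hf)
    (mulZ₃_mem_truncated hf), hZ₁]
  rfl

theorem expand_mulDiff₂₃ (l : ℤ) {f : FormalDistribution W} (hf : f ∈ truncated W) :
    expand l (mulDiff₂₃ f) = mulDiff₂₃ (expand l f) := by
  have hZ₂ : expand l (mulZ₂ f) = mulZ₂ (expand l f) := by
    funext m n p
    refine finsum_congr fun i => ?_
    rw [show n + 1 + (i : ℤ) = n + i + 1 by ring]
    rfl
  rw [mulDiff₂₃, LinearMap.sub_apply, expand_sub l (mulZ₂_mem_truncated hf)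
    (mulZ₃_mem_truncated hf), hZ₂]
  rfl

theorem expand_pow (l : ℤ) {T : Module.End ℂ (FormalDistribution W)}
    (hT : ∀ f ∈ truncated W, T f ∈ truncated W)
    (hexpand : ∀ f ∈ truncated W, expand l (T f) = T (expand l f)) (k : ℕ)
    {f : FormalDistribution W} (hf : f ∈ truncated W) :
    (T ^ k) f ∈ truncated W ∧ expand l ((T ^ k) f) = (T ^ k) (expand l f) := by
  induction k with
  | zero => exact ⟨hf, rfl⟩
  | succ k ih =>
    rw [pow_succ', Module.End.mul_apply, Module.End.mul_apply, ← ih.2]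
    exact ⟨hT _ ih.1, hexpand _ ih.1⟩

theorem pow_mul_pow_expand_eq_zero (l : ℤ) {s t : ℕ} {f : FormalDistribution W}
    (hf : f ∈ truncated W)
    (h : (mulDiff₁₃ ^ s * mulDiff₂₃ ^ t : Module.End ℂ (FormalDistribution W)) f = 0) :
    (mulDiff₁₃ ^ s * mulDiff₂₃ ^ t : Module.End ℂ (FormalDistribution W)) (expand l f) = 0 := by
  obtain ⟨hmem₂₃, h₂₃⟩ := expand_pow l (T := mulDiff₂₃)
    (fun f hf => sub_mem (mulZ₂_mem_truncated hf) (mulZ₃_mem_truncated hf))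
    (fun f hf => expand_mulDiff₂₃ l hf) t hf
  obtain ⟨-, h₁₃⟩ := expand_pow l (T := mulDiff₁₃)
    (fun f hf => sub_mem (mulZ₁_mem_truncated hf) (mulZ₃_mem_truncated hf))
    (fun f hf => expand_mulDiff₁₃ l hf) s hmem₂₃
  rw [Module.End.mul_apply, ← h₂₃, ← h₁₃, ← Module.End.mul_apply, h, expand_zero_right]

/-- The derivation `∂/∂z₁ + ∂/∂z₂`. -/
def derivAdd : Module.End ℂ (FormalDistribution W) where
  toFun f m n p := (-m : ℂ) • f (m - 1) n p + (-n : ℂ) • f m (n - 1) p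
  map_add' f g := by
    funext m n p
    simp only [Pi.add_apply, smul_add]
    exact add_add_add_comm _ _ _ _
  map_smul' c f := by
    funext m n p
    simp only [Pi.smul_apply, smul_add, smul_comm c, RingHom.id_apply]

theorem derivAdd_apply (f : FormalDistribution W) (m n p : ℤ) :
    derivAdd f m n p = (-m : ℂ) • f (m - 1) n p + (-n : ℂ) • f m (n - 1) p := rfl

theorem swap_derivAdd (f : FormalDistribution W) : swap (derivAdd f) = derivAdd (swap f) :=
  funext fun _ => funext fun _ => funext fun _ => add_comm _ _

theorem expand_derivAdd (l : ℤ) {f : FormalDistribution W} (hf : f ∈ truncated W) :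
    expand l (derivAdd f) = derivAdd (expand l f) := by
  funext m n p
  obtain ⟨a, ha⟩ := hf p
  set K := (a + 1 - n).toNat
  set g : ℕ → W := fun i => ((i : ℂ) * ((-1) ^ i * Ring.choose (l : ℂ) i)) •
    f (m + l - i) (n - 1 + i) p with hg
  have hderiv : ∀ m n, a + 1 ≤ n → derivAdd f m n p = 0 := fun m n hn => by
    rw [derivAdd_apply, ha _ n (by lia), ha m _ (by lia), smul_zero, smul_zero, add_zero]
  rw [derivAdd_apply, ← sub_eq_zero, expand_eq_sum l hderiv m (K := K) (by lia),
    expand_eq_sum l ha (m - 1) (K := K) (by lia),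
    expand_eq_sum l ha m (n := n - 1) (K := K) (by lia), Finset.smul_sum, Finset.smul_sum,
    ← Finset.sum_add_distrib, ← Finset.sum_sub_distrib]
  have htelescope (i : ℕ) : ((-1 : ℂ) ^ i * Ring.choose (l : ℂ) i) •
      derivAdd f (m + l - i) (n + i) p -
      ((-m : ℂ) • ((-1 : ℂ) ^ i * Ring.choose (l : ℂ) i) • f (m - 1 + l - i) (n + i) p +
        (-n : ℂ) • ((-1 : ℂ) ^ i * Ring.choose (l : ℂ) i) • f (m + l - i) (n - 1 + i) p) =
      g (i + 1) - g i := by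
    have hc := mul_choose_succ (l : ℂ) i
    simp only [hg, derivAdd_apply]
    rw [show m + l - ((i + 1 : ℕ) : ℤ) = m - 1 + l - i by push_cast; ring,
      show n - 1 + ((i + 1 : ℕ) : ℤ) = n + i by push_cast; ring,
      show m + l - (i : ℤ) - 1 = m - 1 + l - i by ring,
      show n + (i : ℤ) - 1 = n - 1 + i by ring,
      show (((i + 1 : ℕ) : ℂ) * ((-1) ^ (i + 1) * Ring.choose (l : ℂ) (i + 1))) =
        -((-1) ^ i * ((l - i) * Ring.choose (l : ℂ) i)) by rw [← hc]; push_cast; ring]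
    push_cast
    module
  rw [Finset.sum_congr rfl fun i _ => htelescope i, Finset.sum_range_sub]
  simp only [hg]
  rw [ha _ _ (show a ≤ n - 1 + (K : ℤ) by lia), smul_zero, Nat.cast_zero, zero_mul, zero_smul,
    sub_zero]

end Expansion

end FormalDistribution

end

noncomputable section

namespace FormalDistribution

open VertexOperator

variable {V : Type*} [AddCommGroup V] [Module ℂ V]

section Locality

/-- The distribution `[E(z₁), F(z₂)]`, for `E` and `F` given by their modes. -/
def commutator (E F : ℤ → Module.End ℂ V) : FormalDistribution (Module.End ℂ V) :=
  fun m n _ => ⁅E m, F n⁆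

/-- `E` and `F` are mutually local: `(z₁ - z₂)^N [E(z₁), F(z₂)] = 0` for some `N`. -/
def IsLocal (E F : ℤ → Module.End ℂ V) : Prop := ∃ N : ℕ, (mulDiff₁₂ ^ N) (commutator E F) = 0

theorem mulDiff₁₂_pow_commutator_eq_zero_iff {E F : ℤ → Module.End ℂ V} {N : ℕ} :
    (mulDiff₁₂ ^ N) (commutator E F) = 0 ↔ ∀ m n : ℤ, ∑ j ∈ Finset.range (N + 1),
      ((-1 : ℂ) ^ j * (N.choose j : ℂ)) • ⁅E (m + N - j), F (n + j)⁆ = 0 := by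
  refine ⟨fun h m n => ?_, fun h => funext fun m => funext fun n => funext fun p => ?_⟩
  · have hmn := congrFun₃ h m n 0
    rwa [mulDiff₁₂_pow_apply] at hmn
  · rw [mulDiff₁₂_pow_apply]
    exact h m n

theorem sum_smul_lie_apply {E F : ℤ → Module.End ℂ V} {N : ℕ}
    (h : (mulDiff₁₂ ^ N) (commutator E F) = 0) (m n : ℤ) (v : V) :
    ∑ j ∈ Finset.range (N + 1),
      ((-1 : ℂ) ^ j * (N.choose j : ℂ)) • ⁅E (m + N - j), F (n + j)⁆ v = 0 := by
  simpa only [LinearMap.sum_apply, LinearMap.smul_apply, LinearMap.zero_apply] using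
    congrArg (fun T : Module.End ℂ V => T v) (mulDiff₁₂_pow_commutator_eq_zero_iff.1 h m n)

theorem IsLocal.sub {E E' F : ℤ → Module.End ℂ V} (h : IsLocal E F) (h' : IsLocal E' F) :
    IsLocal (E - E') F := by
  obtain ⟨N, hN⟩ := h
  obtain ⟨N', hN'⟩ := h'
  refine ⟨N + N', ?_⟩
  have hsub : commutator (E - E') F = commutator E F - commutator E' F :=
    funext fun m => funext fun n => funext fun p => by
      simp only [commutator, Ring.lie_def, Pi.sub_apply]
      noncomm_ring
  rw [hsub, map_sub, pow_add, Module.End.mul_apply, Module.End.mul_apply, hN', map_zero, sub_zero,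
    ← Module.End.mul_apply, (Commute.pow_pow_self mulDiff₁₂ N N').eq, Module.End.mul_apply, hN,
    map_zero]

end Locality

section NthProduct

variable (A B C : VertexOperator ℂ V)

/-- The distribution `(z₁ - z₂)^l f - (-z₂ + z₁)^l g`, where the two powers are expanded in the
domains `|z₁| > |z₂|` and `|z₂| > |z₁|`, and the variables `z₁` and `z₂` of `g` are exchanged. -/
def expandSub {W : Type*} [AddCommGroup W] [Module ℂ W] (l : ℤ) (f g : FormalDistribution W) :
    FormalDistribution W :=
  expand l f - (-1 : ℂ) ^ l • swap (expand l g)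

theorem mulDiff₁₂_pow_expandSub {W : Type*} [AddCommGroup W] [Module ℂ W] (l : ℤ) (k : ℕ)
    {f g : FormalDistribution W} (hf : f ∈ truncated W) (hg : g ∈ truncated W) :
    (mulDiff₁₂ ^ k) (expandSub l f g) = expandSub (l + k) f g := by
  induction k with
  | zero => simp
  | succ k ih =>
    rw [pow_succ', Module.End.mul_apply, ih, Nat.cast_succ, ← add_assoc, expandSub, expandSub,
      expand_add_one _ hf, expand_add_one _ hg, swap_mulDiff₁₂, zpow_add_one₀ (by norm_num),
      mul_neg_one, neg_smul_neg, map_sub, map_smul]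

/-- The distribution `A(z₁) B(z₂) w(z₃)`. -/
def comp (w : ℤ → V) : FormalDistribution V := fun m n p => ncoeff A m (ncoeff B n (w p))

variable {A B} in
theorem comp_mem_truncated (w : ℤ → V) : comp A B w ∈ truncated V := fun p =>
  ⟨-((HahnModule.of ℂ).symm (B (w p))).order, fun m n hn => by
    rw [comp, ncoeff_eq_zero_of_lt_order B _ _ (by lia), map_zero]⟩

theorem comp_add (v w : ℤ → V) : comp A B (v + w) = comp A B v + comp A B w := by
  funext m n p
  simp only [comp, Pi.add_apply, map_add]

theorem comp_smul (c : ℂ) (w : ℤ → V) : comp A B (c • w) = c • comp A B w := by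
  funext m n p
  simp only [comp, Pi.smul_apply, map_smul]

/-- The coefficient of `z₁^(-m-1) z₂^(-n-1)` in
`(z₁ - z₂)^l A(z₁) B(z₂) - (-z₂ + z₁)^l B(z₂) A(z₁)`, the left hand side of the Borcherds identity.
For `m = 0` these are the modes of the `l`-th product of `A` and `B`. -/
def nthProduct (l m n : ℤ) : Module.End ℂ V where
  toFun v := expandSub l (comp A B fun _ => v) (comp B A fun _ => v) m n 0
  map_add' v w := by
    have hadd (A B : VertexOperator ℂ V) : (comp A B fun _ => v + w) =
        (comp A B fun _ => v) + comp A B fun _ => w := comp_add A B _ _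
    simp only [expandSub, hadd, expand_add l (comp_mem_truncated _) (comp_mem_truncated _), map_add,
      smul_add, Pi.add_apply, add_sub_add_comm, Pi.sub_apply]
  map_smul' c v := by
    have hsmul (A B : VertexOperator ℂ V) : (comp A B fun _ => c • v) = c • comp A B fun _ => v :=
      comp_smul A B c _
    simp only [expandSub, hsmul, expand_smul, map_smul, smul_comm _ c, Pi.sub_apply, Pi.smul_apply,
      smul_sub, RingHom.id_apply]

theorem nthProduct_apply (l m n : ℤ) (w : ℤ → V) (p : ℤ) :
    nthProduct A B l m n (w p) = expandSub l (comp A B w) (comp B A w) m n p := rfl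

theorem nthProduct_zero (m n : ℤ) : nthProduct A B 0 m n = ⁅ncoeff A m, ncoeff B n⁆ := by
  ext v
  rw [nthProduct_apply A B 0 m n (fun _ => v) 0, expandSub, expand_zero_left, expand_zero_left,
    zpow_zero, one_smul]
  rfl

theorem nthProduct_add_one (l m n : ℤ) :
    nthProduct A B (l + 1) m n = nthProduct A B l (m + 1) n - nthProduct A B l m (n + 1) := by
  ext v
  have h := mulDiff₁₂_pow_expandSub l 1 (comp_mem_truncated (A := A) (B := B) fun _ => v)
    (comp_mem_truncated (A := B) (B := A) fun _ => v)
  exact (congrFun₃ h m n 0).symm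

variable {A B C}

theorem expandSub_natCast (N : ℕ) {f g : FormalDistribution V} (hf : f ∈ truncated V)
    (hg : g ∈ truncated V) : expandSub N f g = (mulDiff₁₂ ^ N) (f - swap g) := by
  rw [← zero_add (N : ℤ), ← mulDiff₁₂_pow_expandSub 0 N hf hg, expandSub, expand_zero_left,
    expand_zero_left, zpow_zero, one_smul]

theorem nthProduct_eq_zero_of_le {N : ℕ} (h : (mulDiff₁₂ ^ N) (commutator A.ncoeff B.ncoeff) = 0)
    {l : ℤ} (hl : N ≤ l) (m n : ℤ) : nthProduct A B l m n = 0 := by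
  obtain ⟨k, rfl⟩ := Int.le.dest hl
  ext v
  have hzero : (mulDiff₁₂ ^ N) ((comp A B fun _ => v) - swap (comp B A fun _ => v)) = 0 := by
    funext m n p
    rw [mulDiff₁₂_pow_apply]
    exact sum_smul_lie_apply h m n v
  rw [nthProduct_apply A B _ m n (fun _ => v) 0, ← mulDiff₁₂_pow_expandSub N k
    (comp_mem_truncated _) (comp_mem_truncated _), expandSub_natCast N (comp_mem_truncated _)
    (comp_mem_truncated _), hzero, map_zero]
  rfl

variable (A B C) in
/-- The distribution `[A(z₁) B(z₂), C(z₃)] v`. -/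
def compCommutator (v : V) : FormalDistribution V :=
  comp A B (fun p => ncoeff C p v) - fun m n p => ncoeff C p (comp A B (fun _ => v) m n p)

theorem map_comp_mem_truncated (v : V) :
    (fun m n p => ncoeff C p (comp A B (fun _ => v) m n p)) ∈ truncated V := fun p =>
  (comp_mem_truncated (A := A) (B := B) (fun _ => v) p).imp fun _ h m n hn => by
    simp only [h m n hn, map_zero]

theorem compCommutator_mem_truncated (v : V) : compCommutator A B C v ∈ truncated V :=
  sub_mem (comp_mem_truncated _) (map_comp_mem_truncated v)

theorem pow_mul_pow_compCommutator_eq_zero {s t : ℕ}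
    (hA : (mulDiff₁₂ ^ s) (commutator A.ncoeff C.ncoeff) = 0)
    (hB : (mulDiff₁₂ ^ t) (commutator B.ncoeff C.ncoeff) = 0) (v : V) :
    (mulDiff₁₃ ^ s * mulDiff₂₃ ^ t : Module.End ℂ (FormalDistribution V))
      (compCommutator A B C v) = 0 := by
  have hleibniz : compCommutator A B C v = (fun m n p => ncoeff A m (⁅ncoeff B n, ncoeff C p⁆ v)) +
      fun m n p => ⁅ncoeff A m, ncoeff C p⁆ (ncoeff B n v) := by
    funext m n p
    simp only [compCommutator, comp, Ring.lie_def, Pi.sub_apply, Pi.add_apply, LinearMap.sub_apply,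
      Module.End.mul_apply, map_sub, sub_add_sub_cancel]
  have h₂₃ : (mulDiff₂₃ ^ t) (fun m n p => ncoeff A m (⁅ncoeff B n, ncoeff C p⁆ v)) = 0 := by
    funext m n p
    simp only [mulDiff₂₃_pow_apply, ← (ncoeff A m).map_smul, ← map_sum]
    rw [sum_smul_lie_apply hB n p v, map_zero]
    rfl
  have h₁₃ : (mulDiff₁₃ ^ s) (fun m n p => ⁅ncoeff A m, ncoeff C p⁆ (ncoeff B n v)) = 0 := by
    funext m n p
    rw [mulDiff₁₃_pow_apply]
    exact sum_smul_lie_apply hA m p (ncoeff B n v)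
  rw [hleibniz, map_add, Module.End.mul_apply, h₂₃, map_zero, zero_add,
    (commute_mulDiff₁₃_mulDiff₂₃.pow_pow s t).eq, Module.End.mul_apply, h₁₃, map_zero]

theorem expandSub_compCommutator_apply (l m n p : ℤ) (v : V) :
    expandSub l (compCommutator A B C v) (compCommutator B A C v) m n p =
      ⁅nthProduct A B l m n, ncoeff C p⁆ v := by
  have hexpand (A B : VertexOperator ℂ V) : expand l (compCommutator A B C v) =
      expand l (comp A B fun p => ncoeff C p v) -
        fun m n p => ncoeff C p (expand l (comp A B fun _ => v) m n p) := by
    rw [compCommutator, expand_sub l (comp_mem_truncated _) (map_comp_mem_truncated v),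
      expand_map l (comp_mem_truncated _) C.ncoeff]
  rw [expandSub, hexpand, hexpand, Ring.lie_def, LinearMap.sub_apply, Module.End.mul_apply,
    Module.End.mul_apply, nthProduct_apply A B l m n (fun p => ncoeff C p v) p,
    nthProduct_apply A B l m n (fun _ => v) p, expandSub, expandSub]
  simp only [swap, LinearMap.coe_mk, AddHom.coe_mk, Pi.sub_apply, Pi.smul_apply, map_sub, map_smul,
    smul_sub]
  abel

/-- Dong's lemma. -/
theorem IsLocal.nthProduct (hAB : IsLocal A.ncoeff B.ncoeff) (hAC : IsLocal A.ncoeff C.ncoeff)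
    (hBC : IsLocal B.ncoeff C.ncoeff) (l m : ℤ) :
    IsLocal (FormalDistribution.nthProduct A B l m) C.ncoeff := by
  obtain ⟨N, hN⟩ := hAB
  obtain ⟨s, hs⟩ := hAC
  obtain ⟨t, ht⟩ := hBC
  set k := (N - l).toNat
  set f : V → FormalDistribution V := fun v =>
    expandSub l (compCommutator A B C v) (compCommutator B A C v) with hf
  have hst (v : V) :
      (mulDiff₁₃ ^ s * mulDiff₂₃ ^ t : Module.End ℂ (FormalDistribution V)) (f v) = 0 := by
    simp only [hf, expandSub]
    rw [map_sub, map_smul, ← swap_pow_mul_pow,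
      pow_mul_pow_expand_eq_zero l (compCommutator_mem_truncated v)
        (pow_mul_pow_compCommutator_eq_zero hs ht v),
      pow_mul_pow_expand_eq_zero l (compCommutator_mem_truncated v)
        (pow_mul_pow_compCommutator_eq_zero ht hs v), map_zero, smul_zero, sub_zero]
  have hsub (v : V) : (mulDiff₁₃ - mulDiff₂₃ : Module.End ℂ (FormalDistribution V)) ^ k • f v =
      0 := by
    rw [mulDiff₁₃_sub_mulDiff₂₃, Module.End.smul_def, mulDiff₁₂_pow_expandSub l k
      (compCommutator_mem_truncated v) (compCommutator_mem_truncated v)]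
    funext m n p
    rw [expandSub_compCommutator_apply, nthProduct_eq_zero_of_le hN (by lia), Ring.lie_def,
      zero_mul, mul_zero, sub_zero]
    rfl
  refine ⟨s + k + t, mulDiff₁₂_pow_commutator_eq_zero_iff.2 fun n p => LinearMap.ext fun v => ?_⟩
  have h := congrFun₃ (pow_smul_eq_zero_of_sub_pow commute_mulDiff₁₃_mulDiff₂₃ (hst v) (hsub v))
    m n p
  rw [Module.End.smul_def, mulDiff₂₃_pow_apply] at h
  simp only [hf, expandSub_compCommutator_apply] at h
  simpa only [LinearMap.sum_apply, LinearMap.smul_apply, LinearMap.zero_apply] using! h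

end NthProduct

end FormalDistribution

end

noncomputable section

namespace VertexOperatorAlgebra

open FormalDistribution

section BorcherdsIdentity

variable {V : Type u} [AddCommGroup V] [Module ℂ V] [VertexOperatorAlgebra V]

theorem mode_add (a b : V) (n : ℤ) : mode (a + b) n = mode a n + mode b n := by
  rw [mode, map_add, map_add, Pi.add_apply, mode, mode]

theorem mode_smul (c : ℂ) (a : V) (n : ℤ) : mode (c • a) n = c • mode a n := by
  rw [mode, map_smul, map_smul, Pi.smul_apply, mode]

theorem mode_zero (n : ℤ) : mode (0 : V) n = 0 := by
  rw [mode, map_zero, map_zero, Pi.zero_apply]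

theorem exists_mode_eq_zero (a b : V) : ∃ n₀ : ℤ, ∀ n, n₀ ≤ n → mode a n b = 0 :=
  ⟨-((HahnModule.of ℂ).symm (Y a b)).order, fun n hn =>
    VertexOperator.ncoeff_eq_zero_of_lt_order (Y a) n b (by lia)⟩

theorem mode_Lneg (a : V) (n : ℤ) : mode (Lneg a) n = (-n : ℂ) • mode a (n - 1) :=
  translation a n

theorem mode_vac_nonneg (a : V) {n : ℤ} (hn : 0 ≤ n) : mode a n (vac : V) = 0 :=
  mode_nonneg_vac a n hn

theorem Lneg_vac : Lneg (vac : V) = 0 := mode_vac_nonneg _ le_rfl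

theorem isLocal_mode (a b : V) : IsLocal (mode a) (mode b) :=
  (weak_commutativity a b).imp fun _ h => mulDiff₁₂_pow_commutator_eq_zero_iff.2 h

/-- Goddard's uniqueness theorem. -/
theorem eq_zero_of_isLocal_of_vac {E : ℤ → Module.End ℂ V} (hE : ∀ v : V, IsLocal E (mode v))
    (hvac : ∀ n, E n vac = 0) : E = 0 := by
  funext n
  ext v
  obtain ⟨N, hN⟩ := hE v
  have hsum := sum_smul_lie_apply hN (n - N) (-1) vac
  rw [Finset.sum_eq_single_of_mem 0 (Finset.mem_range.2 N.succ_pos) fun j _ hj => ?_] at hsum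
  · have hv : mode v (-1) vac = v := mode_neg_one_vac v
    simpa [Ring.lie_def, hvac, hv] using hsum
  · have hj' : 0 ≤ -1 + (j : ℤ) := by lia
    rw [Ring.lie_def, LinearMap.sub_apply, Module.End.mul_apply, Module.End.mul_apply, hvac,
      mode_vac_nonneg v hj', map_zero, map_zero, sub_zero, smul_zero]

theorem nthProduct_eq_mode_of_vac {a b c : V} {l : ℤ}
    (h : ∀ n, nthProduct (Y a) (Y b) l 0 n vac = mode c n vac) (n : ℤ) :
    nthProduct (Y a) (Y b) l 0 n = mode c n :=
  sub_eq_zero.1 <| congrFun (eq_zero_of_isLocal_of_vac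
    (E := nthProduct (Y a) (Y b) l 0 - mode c)
    (fun v => .sub (.nthProduct (isLocal_mode a b) (isLocal_mode a v) (isLocal_mode b v) l 0)
      (isLocal_mode c v))
    fun n => sub_eq_zero.2 (h n)) n

theorem Lneg_mode_vac (b : V) (n : ℤ) : Lneg (mode b n vac) = (-n : ℂ) • mode b (n - 1) vac := by
  rw [← LinearMap.smul_apply, ← mode_Lneg]
  rcases le_or_gt 0 n with hn | hn
  · rw [mode_vac_nonneg _ hn, mode_vac_nonneg _ hn, map_zero]
  obtain ⟨k, rfl⟩ : ∃ k : ℕ, n = -(k + 1) := ⟨(-n - 1).toNat, by lia⟩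
  clear hn
  have hsucc (b : V) (k : ℕ) : mode (Lneg b) (-(k + 1)) vac =
      ((k : ℂ) + 1) • mode b (-((k + 1 : ℕ) + 1)) vac := by
    rw [mode_Lneg, LinearMap.smul_apply]
    congr 2
    push_cast
    ring
  induction k generalizing b with
  | zero => exact (congrArg Lneg (mode_neg_one_vac b)).trans (mode_neg_one_vac (Lneg b)).symm
  | succ k ih =>
    refine smul_right_injective V (Nat.cast_add_one_ne_zero (R := ℂ) k) ?_
    simp only
    rw [← map_smul, ← hsucc, ← hsucc, ih]

theorem Lneg_commutator (b : V) (n : ℤ) :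
    ⁅(Lneg : Module.End ℂ V), mode b n⁆ = (-n : ℂ) • mode b (n - 1) := by
  have h (n : ℤ) : nthProduct (Y omega) (Y b) 0 0 n = ⁅(Lneg : Module.End ℂ V), mode b n⁆ :=
    nthProduct_zero _ _ _ _
  rw [← mode_Lneg, ← h]
  refine nthProduct_eq_mode_of_vac (fun n => ?_) n
  rw [h, mode_Lneg, LinearMap.smul_apply, ← Lneg_mode_vac, Ring.lie_def, LinearMap.sub_apply,
    Module.End.mul_apply, Module.End.mul_apply, Lneg_vac, map_zero, sub_zero]

theorem Lneg_comp_vac (a b : V) :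
    (fun m n p => Lneg (comp (Y a) (Y b) (fun _ => (vac : V)) m n p)) =
      derivAdd (comp (Y a) (Y b) fun _ => vac) := by
  have h (c v : V) (n : ℤ) : Lneg (mode c n v) = (-n : ℂ) • mode c (n - 1) v +
      mode c n (Lneg v) := by
    rw [← LinearMap.smul_apply, ← Lneg_commutator, Ring.lie_def, LinearMap.sub_apply,
      Module.End.mul_apply, Module.End.mul_apply, sub_add_cancel]
  funext m n p
  change Lneg (mode a m (mode b n vac)) = (-m : ℂ) • mode a (m - 1) (mode b n vac) +
    (-n : ℂ) • mode a m (mode b (n - 1) vac)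
  rw [h, h, Lneg_vac, map_zero, add_zero, map_smul]

theorem Lneg_nthProduct_vac (a b : V) (l n : ℤ) : Lneg (nthProduct (Y a) (Y b) l 0 n vac) =
    (-n : ℂ) • nthProduct (Y a) (Y b) l 0 (n - 1) vac := by
  have h (a b : V) : (fun m n p => Lneg (expand l (comp (Y a) (Y b) fun _ => (vac : V)) m n p)) =
      derivAdd (expand l (comp (Y a) (Y b) fun _ => vac)) := by
    rw [← expand_map l (comp_mem_truncated _) fun _ => Lneg, Lneg_comp_vac,
      expand_derivAdd l (comp_mem_truncated _)]
  have hderiv : (fun m n p => Lneg (expandSub l (comp (Y a) (Y b) fun _ => (vac : V))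
      (comp (Y b) (Y a) fun _ => vac) m n p)) =
      derivAdd (expandSub l (comp (Y a) (Y b) fun _ => vac) (comp (Y b) (Y a) fun _ => vac)) := by
    rw [expandSub, map_sub, map_smul, ← swap_derivAdd, ← h, ← h]
    funext m n p
    simp only [Pi.sub_apply, Pi.smul_apply, map_sub, map_smul]
    rfl
  refine (congrFun₃ hderiv 0 n 0).trans ?_
  rw [derivAdd_apply, Int.cast_zero, neg_zero, zero_smul, zero_add]
  rfl

theorem nthProduct_vac (a b : V) (l n : ℤ) :
    nthProduct (Y a) (Y b) l 0 n vac = mode (mode a l b) n vac := by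
  have hcomp (a b : V) (m : ℤ) {n : ℤ} (hn : 0 ≤ n) (p : ℤ) :
      comp (Y a) (Y b) (fun _ => vac) m n p = 0 := by
    rw [comp, ← mode, ← mode, mode_vac_nonneg b hn, map_zero]
  have hexpand (n : ℤ) : nthProduct (Y a) (Y b) l 0 n vac =
      expand l (comp (Y a) (Y b) fun _ => vac) 0 n 0 := by
    have hswap : swap (expand l (comp (Y b) (Y a) fun _ => vac)) 0 n 0 = 0 :=
      expand_eq_sum l (fun m n hn => hcomp b a m hn 0) n (K := 0) le_rfl
    refine (congrArg (fun y => expand l _ 0 n 0 - (-1 : ℂ) ^ l • y) hswap).trans ?_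
    rw [smul_zero, sub_zero]
  rcases le_or_gt 0 n with hn | hn
  · rw [hexpand, expand_eq_sum l (fun m n hn => hcomp a b m hn 0) 0 (K := 0) (by simpa using hn),
      Finset.sum_range_zero, mode_vac_nonneg _ hn]
  obtain ⟨k, rfl⟩ : ∃ k : ℕ, n = -(k + 1) := ⟨(-n - 1).toNat, by lia⟩
  clear hn
  induction k with
  | zero =>
    have hb : mode (mode a l b) (-1) vac = mode a l b := mode_neg_one_vac _
    have hb' : mode b (-1) vac = b := mode_neg_one_vac _
    rw [hexpand, expand_eq_sum l (fun m n hn => hcomp a b m hn 0) 0 (K := 1) (by simp),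
      Finset.sum_range_one, comp, ← mode, ← mode]
    simp [hb, hb']
  | succ k ih =>
    refine smul_right_injective V (Nat.cast_add_one_ne_zero (R := ℂ) k) ?_
    have h₁ := Lneg_nthProduct_vac a b l (-(k + 1))
    have h₂ := Lneg_mode_vac (mode a l b) (-(k + 1))
    have hscalar : -((-(k + 1) : ℤ) : ℂ) = k + 1 := by push_cast; ring
    have hn : (-((k + 1 : ℕ) + 1) : ℤ) = -(k + 1) - 1 := by push_cast; ring
    rw [ih, h₂, hscalar] at h₁
    rw [hn]
    exact h₁.symm

theorem nthProduct_eq_mode (a b : V) (l n : ℤ) :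
    nthProduct (Y a) (Y b) l 0 n = mode (mode a l b) n :=
  nthProduct_eq_mode_of_vac (nthProduct_vac a b l) n

/-- The right hand side `∑_i (m choose i) (a_(l+i) b)_(m+n-i)` of the Borcherds identity. -/
def borcherdsSum (a b : V) (l m n : ℤ) : Module.End ℂ V :=
  ∑ᶠ i : ℕ, Ring.choose (m : ℂ) i • mode (mode a (l + i) b) (m + n - i)

theorem borcherdsSum_eq_sum {a b : V} {l N : ℤ} (hN : ∀ n, N ≤ n → mode a n b = 0) (m n : ℤ)
    {K : ℕ} (hK : N ≤ l + K) : borcherdsSum a b l m n =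
      ∑ i ∈ Finset.range K, Ring.choose (m : ℂ) i • mode (mode a (l + i) b) (m + n - i) := by
  refine finsum_eq_sum_of_support_subset _ fun i hi => ?_
  rw [Finset.coe_range, Set.mem_Iio]
  by_contra! hlt
  exact hi (by simp only [hN _ (show N ≤ l + (i : ℤ) by lia), mode_zero, smul_zero])

theorem borcherdsSum_add_one (a b : V) (l m n : ℤ) :
    borcherdsSum a b l (m + 1) n = borcherdsSum a b l m (n + 1) + borcherdsSum a b (l + 1) m n := by
  obtain ⟨N, hN⟩ := exists_mode_eq_zero a b
  set K := (N - l).toNat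
  have hcomm (x y z : Module.End ℂ V) : x + y + z = x + z + y := add_right_comm x y z
  rw [borcherdsSum_eq_sum hN _ _ (K := K + 1) (by lia),
    borcherdsSum_eq_sum hN _ _ (K := K + 1) (by lia),
    borcherdsSum_eq_sum hN _ _ (K := K) (by lia), Finset.sum_range_succ',
    Finset.sum_range_succ' _ K, hcomm, ← Finset.sum_add_distrib]
  congr 1
  · refine Finset.sum_congr rfl fun i _ => ?_
    rw [show l + ((i + 1 : ℕ) : ℤ) = l + 1 + i by push_cast; ring,
      show m + (n + 1) - ((i + 1 : ℕ) : ℤ) = m + n - i by push_cast; ring,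
      show m + 1 + n - ((i + 1 : ℕ) : ℤ) = m + n - i by push_cast; ring, ← add_smul,
      Int.cast_add, Int.cast_one, Ring.choose_succ_succ, add_comm]
  · simp only [Ring.choose_zero_right]
    rw [show m + (n + 1) = m + 1 + n by ring]

theorem borcherdsSum_zero (a b : V) (l n : ℤ) : borcherdsSum a b l 0 n = mode (mode a l b) n := by
  rw [borcherdsSum, finsum_eq_single _ 0]
  · simp
  · intro i hi
    obtain ⟨j, rfl⟩ := Nat.exists_eq_succ_of_ne_zero hi
    rw [Int.cast_zero, Nat.succ_eq_add_one, Ring.choose_zero_succ, zero_smul]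

theorem eq_zero_of_borcherds_recursion {X : Type*} [AddCommGroup X] {D : ℤ → ℤ → ℤ → X} {N : ℤ}
    (hrec : ∀ l m n, D l (m + 1) n = D l m (n + 1) + D (l + 1) m n)
    (hzero : ∀ l n, D l 0 n = 0) (hN : ∀ l m n, N ≤ l → D l m n = 0) (l m n : ℤ) :
    D l m n = 0 := by
  have hstep (l : ℤ) (h : ∀ m n, D (l + 1) m n = 0) (m : ℤ) : ∀ n, D l m n = 0 := by
    have hshift (m n : ℤ) : D l (m + 1) n = D l m (n + 1) := by rw [hrec, h, add_zero]
    induction m using Int.induction_on with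
    | zero => exact hzero l
    | succ m ih => exact fun n => (hshift m n).trans (ih _)
    | pred m ih =>
      intro n
      have := hshift (-m - 1) (n - 1)
      rw [sub_add_cancel, sub_add_cancel, ih] at this
      exact this.symm
  rcases le_total N l with hl | hl
  · exact hN l m n hl
  · induction l, hl using Int.leInductionDown generalizing m n with
    | base => exact hN N m n le_rfl
    | pred l _ ih => exact hstep (l - 1) (by rwa [sub_add_cancel]) m n

theorem borcherds_identity (a b : V) (l m n : ℤ) :
    nthProduct (Y a) (Y b) l m n = borcherdsSum a b l m n := by
  obtain ⟨N₁, hN₁⟩ := isLocal_mode a b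
  obtain ⟨N₂, hN₂⟩ := exists_mode_eq_zero a b
  refine sub_eq_zero.1 (eq_zero_of_borcherds_recursion (N := max N₁ N₂)
    (D := fun l m n => nthProduct (Y a) (Y b) l m n - borcherdsSum a b l m n) (fun l m n => ?_)
    (fun l n => ?_) (fun l m n hl => ?_) l m n)
  · rw [borcherdsSum_add_one, nthProduct_add_one]
    abel
  · rw [nthProduct_eq_mode, borcherdsSum_zero, sub_self]
  · rw [nthProduct_eq_zero_of_le hN₁ (le_of_max_le_left hl),
      borcherdsSum_eq_sum hN₂ m n (K := 0) (by simpa using le_of_max_le_right hl),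
      Finset.sum_range_zero, sub_self]

end BorcherdsIdentity

end VertexOperatorAlgebra

end

noncomputable section

theorem eigenspace_inf_iSup_le {K M ι : Type*} [Field K] [AddCommGroup M] [Module K M]
    {f : Module.End K M} {p : ι → Submodule K M} {c : ι → K}
    (hp : ∀ i, p i ≤ f.eigenspace (c i)) (μ : K) :
    f.eigenspace μ ⊓ ⨆ i, p i ≤ ⨆ (i) (_ : c i = μ), p i := by
  rintro v ⟨hv, hv'⟩
  have hsplit : ⨆ i, p i ≤ (⨆ (i) (_ : c i = μ), p i) ⊔ ⨆ (i) (_ : c i ≠ μ), p i :=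
    iSup_le fun i => (em (c i = μ)).elim (fun h => le_sup_of_le_left (le_iSup₂_of_le i h le_rfl))
      fun h => le_sup_of_le_right (le_iSup₂_of_le i h le_rfl)
  obtain ⟨x, hx, y, hy, rfl⟩ := Submodule.mem_sup.1 (hsplit hv')
  have hxμ : x ∈ f.eigenspace μ := (iSup₂_le fun i h => h ▸ hp i : _ ≤ f.eigenspace μ) hx
  have hyμ : y ∈ f.eigenspace μ := (add_mem_cancel_left hxμ).1 hv
  have hle : ⨆ (i) (_ : c i ≠ μ), p i ≤ ⨆ (ν) (_ : ν ≠ μ), f.eigenspace ν :=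
    iSup₂_le fun i h => le_iSup₂_of_le (c i) h (hp i)
  rwa [(Submodule.mem_bot K).1 ((f.eigenspaces_iSupIndep μ).le_bot ⟨hyμ, hle hy⟩), add_zero]

namespace VertexOperatorAlgebra

open FormalDistribution

section EnvelopingAlgebra

variable {V : Type u} [AddCommGroup V] [Module ℂ V] [VertexOperatorAlgebra V]

theorem lieMode_smul (c : ℂ) (a : V) (i : ℤ) : lieMode (c • a) i = c • lieMode a i := by
  rw [lieMode, ← Finsupp.smul_single, Submodule.Quotient.mk_smul, lieMode]

theorem lieMode_zero (i : ℤ) : lieMode (0 : V) i = 0 := by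
  rw [lieMode, Finsupp.single_zero, Submodule.Quotient.mk_zero]

theorem lieMode_Lneg (a : V) (i : ℤ) : lieMode (Lneg a) i = (-i : ℂ) • lieMode a (i - 1) := by
  have h : (Submodule.Quotient.mk (nabla V (Finsupp.single i a)) : FinLie V) = 0 :=
    (Submodule.Quotient.mk_eq_zero _).2 ⟨_, rfl⟩
  rw [nabla, Finsupp.lsum_single, LinearMap.add_apply, LinearMap.comp_apply, LinearMap.smul_apply,
    Finsupp.lsingle_apply, Finsupp.lsingle_apply, Submodule.Quotient.mk_add,
    Submodule.Quotient.mk_smul] at h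
  rw [neg_smul]
  exact eq_neg_of_add_eq_zero_left h

theorem finsum_choose_natCast {X : Type*} [AddCommGroup X] [Module ℂ X] (m : ℕ) (f : ℕ → X) :
    ∑ᶠ i : ℕ, Ring.choose ((m : ℤ) : ℂ) i • f i =
      ∑ i ∈ Finset.range (m + 1), (m.choose i : ℂ) • f i := by
  simp only [Int.cast_natCast, Ring.choose_natCast]
  refine finsum_eq_sum_of_support_subset _ fun i hi => ?_
  rw [Finset.coe_range, Set.mem_Iio]
  by_contra! hlt
  exact hi (by simp only [Nat.choose_eq_zero_of_lt hlt, Nat.cast_zero, zero_smul])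

theorem envι_lie_lieMode (a b : V) (i j : ℤ) :
    ⁅envι V (lieMode a i), envι V (lieMode b j)⁆ =
      envι V (∑ᶠ k : ℕ, Ring.choose (i : ℂ) k • lieMode (mode a k b) (i + j - k)) := by
  have h := RingQuot.mkAlgHom_rel ℂ (EnvRel.bracket a b i j)
  rwa [map_sub, map_mul, map_mul] at h

theorem envι_lie_lieMode_natCast (a b : V) (i : ℕ) (j : ℤ) :
    ⁅envι V (lieMode a i), envι V (lieMode b j)⁆ = ∑ k ∈ Finset.range (i + 1),
      (i.choose k : ℂ) • envι V (lieMode (mode a k b) (i + j - k)) := by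
  rw [envι_lie_lieMode, finsum_choose_natCast, map_sum]
  exact Finset.sum_congr rfl fun k _ => map_smul _ _ _

theorem Lzero_lie_lieMode {k : ℕ} {a : V} (ha : a ∈ piece k) (i : ℤ) :
    ⁅envι V (lieMode omega 1), envι V (lieMode a i)⁆ =
      ((k - i - 1 : ℤ) : ℂ) • envι V (lieMode a i) := by
  have h₀ : mode omega (0 : ℕ) a = Lneg a := rfl
  have h₁ : mode omega (1 : ℕ) a = (k : ℂ) • a := L_zero k a ha
  refine (envι_lie_lieMode_natCast omega a 1 i).trans ?_
  rw [Finset.sum_range_succ, Finset.sum_range_one, h₀, h₁, lieMode_Lneg, lieMode_smul, map_smul,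
    map_smul]
  simp only [Nat.choose_self, Nat.choose_zero_right, Nat.cast_one, Nat.cast_zero, sub_zero,
    one_smul, ← add_smul, add_sub_cancel_left]
  congr 1
  push_cast
  ring

theorem Lzero_lie_of_mem {d : ℤ} {x : Env V} (hx : x ∈ envPiece V d) :
    ⁅envι V (lieMode omega 1), x⁆ = (d : ℂ) • x := by
  induction hx using Submodule.span_induction with
  | mem x hx =>
    induction hx with
    | one => simp [Ring.lie_def]
    | mul k a i d x ha _ ih =>
      have h := Lzero_lie_lieMode ha i
      rw [Ring.lie_def] at h ih ⊢
      set y := envι V (lieMode a i)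
      set L := envι V (lieMode (omega : V) 1)
      have hleibniz : L * (y * x) - y * x * L = (L * y - y * L) * x + y * (L * x - x * L) := by
        noncomm_ring
      rw [hleibniz, h, ih, smul_mul_assoc, mul_smul_comm, ← add_smul, ← Int.cast_add]
  | zero => simp [Ring.lie_def]
  | add x y _ _ hx hy =>
    rw [smul_add, ← hx, ← hy, Ring.lie_def, Ring.lie_def, Ring.lie_def]
    noncomm_ring
  | smul c x _ hx =>
    rw [smul_comm, ← hx, Ring.lie_def, Ring.lie_def, mul_smul_comm, smul_mul_assoc, smul_sub]

theorem envNLPiece_le (n p : ℤ) : envNLPiece V n p ≤ envPiece V p :=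
  iSup₂_le fun j _ => by simpa only [sub_add_cancel] using envPiece_mul_le (V := V) (p - j) j

theorem envNL_le_iSup (n : ℤ) : envNL V n ≤ ⨆ p : ℤ, envNLPiece V n p := by
  rw [envNL, ← iSup_envPiece, Submodule.iSup_mul]
  refine iSup_le fun i => ?_
  simp only [Submodule.mul_iSup]
  refine iSup₂_le fun j hj => le_iSup_of_le (i + j) (le_iSup₂_of_le j hj ?_)
  rw [add_sub_cancel_right]

theorem envPiece_inf_envNL_le (n d : ℤ) : envPiece V d ⊓ envNL V n ≤ envNLPiece V n d := by
  set f : Module.End ℂ (Env V) := LinearMap.mulLeft ℂ (envι V (lieMode omega 1)) -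
    LinearMap.mulRight ℂ (envι V (lieMode omega 1))
  have heig (p : ℤ) : envPiece V p ≤ f.eigenspace (p : ℂ) := fun x hx =>
    Module.End.mem_eigenspace_iff.2 (Lzero_lie_of_mem hx)
  refine (inf_le_inf (heig d) (envNL_le_iSup n)).trans
    ((eigenspace_inf_iSup_le (fun p => (envNLPiece_le n p).trans (heig p)) (d : ℂ)).trans
      (iSup₂_le fun p hp => ?_))
  rw [Int.cast_inj.1 hp]

end EnvelopingAlgebra

section EnvAction

variable {V : Type u} [AddCommGroup V] [Module ℂ V] [VertexOperatorAlgebra V]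

theorem mode_lie_mode (a b : V) (m n : ℤ) : ⁅mode a m, mode b n⁆ =
    ∑ᶠ i : ℕ, Ring.choose (m : ℂ) i • mode (mode a i b) (m + n - i) := by
  have h : nthProduct (Y a) (Y b) 0 m n = ⁅mode a m, mode b n⁆ := nthProduct_zero _ _ _ _
  rw [← h, borcherds_identity, borcherdsSum]
  simp only [zero_add]

variable (V) in
/-- The linear map `𝔏(V)^f → End V` given by `a_[i] ↦ a_(i)`. -/
def actLie : FinLie V →ₗ[ℂ] Module.End ℂ V :=
  Submodule.liftQ _ (Finsupp.lsum ℂ fun i : ℤ =>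
    { toFun := fun a => mode a i
      map_add' := fun a b => mode_add a b i
      map_smul' := fun c a => mode_smul c a i }) (by
    rw [LinearMap.range_le_ker_iff]
    refine Finsupp.lhom_ext fun i a => ?_
    rw [LinearMap.comp_apply, nabla, Finsupp.lsum_single, LinearMap.add_apply, map_add,
      LinearMap.comp_apply, LinearMap.smul_apply, map_smul, Finsupp.lsingle_apply,
      Finsupp.lsingle_apply, Finsupp.lsum_single, Finsupp.lsum_single]
    change mode (Lneg a) i + (i : ℂ) • mode a (i - 1) = 0
    rw [mode_Lneg, ← add_smul, neg_add_cancel, zero_smul])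

theorem actLie_lieMode (a : V) (i : ℤ) : actLie V (lieMode a i) = mode a i := by
  rw [actLie, lieMode, Submodule.liftQ_apply, Finsupp.lsum_single]
  rfl

theorem support_choose_smul_lieMode_finite (a b : V) (i j : ℤ) :
    (Function.support fun k : ℕ =>
      Ring.choose (i : ℂ) k • lieMode (mode a k b) (i + j - k)).Finite := by
  obtain ⟨N, hN⟩ := exists_mode_eq_zero a b
  refine (Finset.range N.toNat).finite_toSet.subset fun k hk => ?_
  rw [Finset.coe_range, Set.mem_Iio]
  by_contra! hlt
  exact hk (by simp only [hN k (by lia), lieMode_zero, smul_zero])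

theorem lift_actLie_eq_of_envRel {x y : TensorAlgebra ℂ (FinLie V)} (h : EnvRel V x y) :
    TensorAlgebra.lift ℂ (actLie V) x = TensorAlgebra.lift ℂ (actLie V) y := by
  obtain ⟨a, b, i, j⟩ := h
  rw [map_sub, map_mul, map_mul, TensorAlgebra.lift_ι_apply, TensorAlgebra.lift_ι_apply,
    TensorAlgebra.lift_ι_apply, actLie_lieMode, actLie_lieMode]
  refine (mode_lie_mode a b i j).trans (Eq.trans (finsum_congr fun k => ?_)
    ((actLie V).toAddMonoidHom.map_finsum (support_choose_smul_lieMode_finite a b i j)).symm)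
  rw [LinearMap.toAddMonoidHom_coe, map_smul, actLie_lieMode]

variable (V) in
/-- The action of `U` on `V`, in which `a_[i]` acts by `a_(i)`. -/
def actEnv : Env V →ₐ[ℂ] Module.End ℂ V :=
  RingQuot.liftAlgHom ℂ ⟨TensorAlgebra.lift ℂ (actLie V), fun _ _ => lift_actLie_eq_of_envRel⟩

theorem actEnv_lieMode (a : V) (i : ℤ) : actEnv V (envι V (lieMode a i)) = mode a i := by
  change RingQuot.liftAlgHom ℂ _ (RingQuot.mkAlgHom ℂ (EnvRel V) (TensorAlgebra.ι ℂ _)) = _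
  rw [RingQuot.liftAlgHom_mkAlgHom_apply, TensorAlgebra.lift_ι_apply, actLie_lieMode]

variable (V) in
/-- The homogeneous piece `V_d` for an arbitrary integer `d`, as an eigenspace of `L_0`. -/
def pieceInt (d : ℤ) : Submodule ℂ V := Module.End.eigenspace (mode (omega : V) 1) (d : ℂ)

theorem mem_pieceInt {d : ℤ} {v : V} : v ∈ pieceInt V d ↔ mode omega 1 v = (d : ℂ) • v :=
  Module.End.mem_eigenspace_iff

theorem piece_le_pieceInt (k : ℕ) : piece (V := V) k ≤ pieceInt V k := fun v hv => by
  rw [mem_pieceInt, Int.cast_natCast]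
  exact L_zero k v hv

theorem iSup_piece : ⨆ i, piece (V := V) i = ⊤ := isInternal.submodule_iSup_eq_top

theorem pieceInt_le_iSup (d : ℤ) :
    pieceInt V d ≤ ⨆ (i : ℕ) (_ : ((i : ℤ) : ℂ) = d), piece (V := V) i := by
  have h := eigenspace_inf_iSup_le (piece_le_pieceInt (V := V)) (d : ℂ)
  rwa [iSup_piece, inf_top_eq] at h

theorem pieceInt_natCast (k : ℕ) : pieceInt V k = piece k := by
  refine le_antisymm ((pieceInt_le_iSup k).trans (iSup₂_le fun i hi => ?_)) (piece_le_pieceInt k)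
  rw [Int.natCast_inj.1 (Int.cast_inj.1 hi)]

theorem pieceInt_of_neg {d : ℤ} (hd : d < 0) : pieceInt V d = ⊥ :=
  eq_bot_iff.2 ((pieceInt_le_iSup d).trans
    (iSup₂_le fun i hi => absurd (Int.cast_inj.1 hi) (by lia)))

theorem vac_mem_pieceInt : (vac : V) ∈ pieceInt V 0 := piece_le_pieceInt 0 vac_mem

theorem vac_ne_zero : (vac : V) ≠ 0 := fun h => by
  have hall (a : V) : a = 0 := by rw [← mode_neg_one_vac a, h, map_zero]
  have : Subsingleton (piece (V := V) 0) := ⟨fun a b => Subtype.ext ((hall _).trans (hall _).symm)⟩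
  exact zero_ne_one ((Module.finrank_zero_of_subsingleton (R := ℂ)).symm.trans
    (finrank_piece_zero (V := V)))

theorem exists_eq_smul_vac {v : V} (hv : v ∈ pieceInt V 0) : ∃ μ : ℂ, v = μ • vac := by
  have hv' : v ∈ piece (V := V) 0 := pieceInt_natCast (V := V) 0 ▸ hv
  have hne : (⟨vac, vac_mem⟩ : piece (V := V) 0) ≠ 0 := fun h =>
    vac_ne_zero (congrArg Subtype.val h)
  obtain ⟨μ, hμ⟩ := (finrank_eq_one_iff_of_nonzero' _ hne).1 finrank_piece_zero ⟨v, hv'⟩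
  exact ⟨μ, (congrArg Subtype.val hμ).symm⟩

theorem actEnv_mem_pieceInt {d : ℤ} {x : Env V} (hx : x ∈ envPiece V d) {j : ℤ} {v : V}
    (hv : v ∈ pieceInt V j) : actEnv V x v ∈ pieceInt V (d + j) := by
  have h := congrArg (fun y => actEnv V y v) (Lzero_lie_of_mem hx)
  simp only [Ring.lie_def, map_sub, map_mul, map_smul, actEnv_lieMode, LinearMap.sub_apply,
    LinearMap.smul_apply, Module.End.mul_apply, mem_pieceInt.1 hv, sub_eq_iff_eq_add] at h
  rw [mem_pieceInt, h, ← add_smul, Int.cast_add]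

theorem mode_mem_pieceInt {k : ℕ} {a : V} (ha : a ∈ piece k) (n : ℤ) {j : ℤ} {v : V}
    (hv : v ∈ pieceInt V j) : mode a n v ∈ pieceInt V (k - n - 1 + j) := by
  rw [← actEnv_lieMode]
  exact actEnv_mem_pieceInt (envι_lieMode_mem ha n) hv

theorem actEnv_eq_zero_of_mem_envNL {n j : ℤ} (h : j < n) {x : Env V} (hx : x ∈ envNL V n) {v : V}
    (hv : v ∈ pieceInt V j) : actEnv V x v = 0 := by
  let S : Submodule ℂ (Env V) := LinearMap.ker ((LinearMap.applyₗ v).comp (actEnv V).toLinearMap)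
  have hneg : ⨆ (i : ℤ) (_ : i ≤ -n), envPiece V i ≤ S := iSup₂_le fun i hi y hy => by
    have := actEnv_mem_pieceInt hy hv
    rwa [pieceInt_of_neg (by lia), Submodule.mem_bot] at this
  suffices h : envNL V n ≤ S from h hx
  rw [envNL, Submodule.mul_le]
  intro y _ z hz
  have hz' : actEnv V z v = 0 := hneg hz
  change actEnv V (y * z) v = 0
  rw [map_mul, Module.End.mul_apply, hz', map_zero]

theorem exists_forall_mem_envNL_actEnv_eq_zero (v : V) :
    ∃ n : ℤ, ∀ x ∈ envNL V n, actEnv V x v = 0 := by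
  have hv : v ∈ ⨆ i, piece (V := V) i := iSup_piece (V := V) ▸ Submodule.mem_top
  induction hv using Submodule.iSup_induction' with
  | mem k v hv =>
    exact ⟨k + 1, fun x hx =>
      actEnv_eq_zero_of_mem_envNL (lt_add_one _) hx (piece_le_pieceInt k hv)⟩
  | zero => exact ⟨0, fun x _ => map_zero _⟩
  | add v w _ _ hv hw =>
    obtain ⟨m, hm⟩ := hv
    obtain ⟨n, hn⟩ := hw
    refine ⟨max m n, fun x hx => ?_⟩
    rw [map_add, hm x (envNL_anti (le_max_left _ _) hx), hn x (envNL_anti (le_max_right _ _) hx),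
      add_zero]

end EnvAction

section Virasoro

variable {V : Type u} [AddCommGroup V] [Module ℂ V] [VertexOperatorAlgebra V]

theorem virasoro_apply (p q : ℤ) (v : V) :
    mode omega (p + 1) (mode omega (q + 1) v) - mode omega (q + 1) (mode omega (p + 1) v) =
      ((p : ℂ) - q) • mode omega (p + q + 1) v +
        (if p + q = 0 then centralCharge V / 12 * ((p : ℂ) ^ 3 - p) else 0) • v :=
  congrArg (fun T : Module.End ℂ V => T v) (virasoro p q)

theorem mode_omega_omega {p : ℤ} (hp : -1 ≤ p) : mode omega (p + 1) (omega : V) =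
    ((p : ℂ) + 2) • mode omega (p - 1) vac +
      (if p = 2 then centralCharge V / 2 else 0) • (vac : V) := by
  have h := virasoro_apply p (-2) (vac : V)
  have hω : mode (omega : V) (-2 + 1) vac = omega := mode_neg_one_vac omega
  rw [hω, mode_vac_nonneg _ (by lia : 0 ≤ p + 1), map_zero, sub_zero,
    show p + -2 + 1 = p - 1 by ring] at h
  rw [h]
  congr 2
  · push_cast
    ring
  · by_cases h2 : p = 2
    · subst h2
      norm_num
      ring
    · rw [if_neg h2, if_neg (by lia)]

theorem mode_omega_one_omega : mode omega 1 (omega : V) = (2 : ℂ) • omega :=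
  L_zero 2 omega omega_mem

theorem mode_omega_three_omega : mode omega 3 (omega : V) = (centralCharge V / 2) • vac := by
  simpa [mode_vac_nonneg] using mode_omega_omega (V := V) (p := 2) (by lia)

theorem mode_omega_omega_eq_zero {i : ℤ} (h2 : 2 ≤ i) (h3 : i ≠ 3) :
    mode omega i (omega : V) = 0 := by
  have h := mode_omega_omega (V := V) (p := i - 1) (by lia)
  rwa [sub_add_cancel, mode_vac_nonneg _ (by lia), if_neg (by lia), smul_zero, zero_smul,
    add_zero] at h

theorem omega_eq_zero_of_mode_vac_eq_zero {n : ℕ} (hn : 3 ≤ n)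
    (h : mode omega (1 - n) (vac : V) = 0) : (omega : V) = 0 := by
  have hcomm := virasoro_apply ((n : ℤ) - 2) (-n) (vac : V)
  have hω : mode (omega : V) (-1) vac = omega := mode_neg_one_vac omega
  rw [show -(n : ℤ) + 1 = 1 - n by ring, h, map_zero, mode_vac_nonneg _ (by lia), map_zero,
    sub_zero, show (n : ℤ) - 2 + -n + 1 = -1 by ring, hω, if_neg (by lia), zero_smul,
    add_zero] at hcomm
  refine (smul_eq_zero.1 hcomm.symm).resolve_left ?_
  rw [← Int.cast_sub, ← ne_eq, Int.cast_ne_zero]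
  lia

end Virasoro

end VertexOperatorAlgebra

end

noncomputable section

namespace VertexOperatorAlgebra

open FormalDistribution UniformSpace

section Completion

variable {V : Type u} [AddCommGroup V] [Module ℂ V] [VertexOperatorAlgebra V]

theorem closureImage_induction {M : Submodule ℂ (Env V)} {P : EnvCompl V → Prop}
    (hP : IsClosed {z | P z}) (h : ∀ x ∈ M, P x) {z : EnvCompl V} (hz : z ∈ closureImage V M) :
    P z :=
  closure_minimal (by rintro _ ⟨x, hx, rfl⟩; exact h x hx) hP hz

theorem isOpen_envNL (n : ℤ) : IsOpen (envNL V n : Set (Env V)) :=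
  ((envNL_basis V).openAddSubgroup n).isOpen'

theorem isClosed_envNL (n : ℤ) : IsClosed (envNL V n : Set (Env V)) :=
  ((envNL_basis V).openAddSubgroup n).isClosed

theorem isOpen_closureImage_envNL (n : ℤ) :
    IsOpen (closureImage V (envNL V n) : Set (EnvCompl V)) := by
  refine AddSubgroup.isOpen_of_mem_nhds _ (g := 0) ?_
  have := (Completion.isDenseInducing_coe (α := Env V)).closure_image_mem_nhds
    ((isOpen_envNL n).mem_nhds (zero_mem (envNL V n)))
  rwa [Completion.coe_zero] at this

theorem mem_envNL_of_coe_mem_closureImage {n : ℤ} {x : Env V}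
    (hx : (x : EnvCompl V) ∈ closureImage V (envNL V n)) : x ∈ envNL V n := by
  have : x ∈ closure (envNL V n : Set (Env V)) := by
    rw [(Completion.isDenseInducing_coe (α := Env V)).isInducing.closure_eq_preimage_closure_image]
    exact hx
  rwa [(isClosed_envNL n).closure_eq] at this

theorem closureImage_inf_envNL_le (M : Submodule ℂ (Env V)) (n : ℤ) :
    closureImage V M ⊓ closureImage V (envNL V n) ≤ closureImage V (M ⊓ envNL V n) := by
  rintro z ⟨hM, hn⟩
  refine closure_mono ?_ ((isOpen_closureImage_envNL n).inter_closure ⟨hn, hM⟩)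
  rintro _ ⟨hx, x, hxM, rfl⟩
  exact ⟨x, ⟨hxM, mem_envNL_of_coe_mem_closureImage hx⟩, rfl⟩

theorem exists_sub_mem_closureImage_envNL {M : Submodule ℂ (Env V)} {z : EnvCompl V}
    (hz : z ∈ closureImage V M) (n : ℤ) :
    ∃ x ∈ M, z - (x : EnvCompl V) ∈ closureImage V (envNL V n) := by
  have hnhds : (fun y => z - y) ⁻¹' (closureImage V (envNL V n) : Set (EnvCompl V)) ∈ nhds z :=
    ((isOpen_closureImage_envNL n).preimage (continuous_const.sub continuous_id)).mem_nhds
      (by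
        rw [Set.mem_preimage, Pi.sub_apply, id, sub_self]
        exact zero_mem (closureImage V (envNL V n)))
  obtain ⟨_, hx, x, hxM, rfl⟩ := mem_closure_iff_nhds.1 hz _ hnhds
  exact ⟨x, hxM, hx⟩

theorem exists_sub_mem_hatNL {d : ℤ} (n : ℤ) {z : EnvCompl V} (hz : z ∈ hatPiece V d) :
    ∃ x ∈ envPiece V d, z - (x : EnvCompl V) ∈ hatNL V n d := by
  obtain ⟨x, hx, hzx⟩ := exists_sub_mem_closureImage_envNL hz n
  exact ⟨x, hx, closureImage_mono (envPiece_inf_envNL_le n d)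
    (closureImage_inf_envNL_le _ n
      ⟨(hatPiece V d).sub_mem hz (coe_mem_closureImage hx), hzx⟩)⟩

end Completion

section ComplAction

variable {V : Type u} [AddCommGroup V] [Module ℂ V] [VertexOperatorAlgebra V]

theorem actEnv_jacobiTerm (a b v : V) (l m n : ℤ) (k : ℕ) :
    actEnv V (jacobiTerm a b l m n k) v =
      ((-1 : ℂ) ^ k * Ring.choose (l : ℂ) k) • mode a (m + l - k) (mode b (n + k) v) -
      (-1 : ℂ) ^ l • (((-1 : ℂ) ^ k * Ring.choose (l : ℂ) k) •
        mode b (n + l - k) (mode a (m + k) v)) -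
      Ring.choose (m : ℂ) k • mode (mode a (l + k) b) (m + n - k) v := by
  rw [jacobiTerm]
  simp only [map_sub, map_smul, map_mul, actEnv_lieMode, LinearMap.sub_apply,
    LinearMap.smul_apply, Module.End.mul_apply, smul_sub, smul_smul]
  rw [mul_comm ((-1 : ℂ) ^ l)]

theorem exists_actEnv_jacobiTerm_eq_zero_and_sum_eq_zero (a b v : V) (l m n : ℤ) :
    ∃ K, (∀ k ≥ K, actEnv V (jacobiTerm a b l m n k) v = 0) ∧
      ∑ k ∈ Finset.range K, actEnv V (jacobiTerm a b l m n k) v = 0 := by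
  obtain ⟨na, hna⟩ := exists_mode_eq_zero a v
  obtain ⟨nb, hnb⟩ := exists_mode_eq_zero b v
  obtain ⟨N, hN⟩ := exists_mode_eq_zero a b
  obtain ⟨K, hKa, hKb, hKN⟩ : ∃ K : ℕ, na ≤ m + K ∧ nb ≤ n + K ∧ N ≤ l + K :=
    ⟨max (na - m).toNat (max (nb - n).toNat (N - l).toNat), by lia, by lia, by lia⟩
  simp only [actEnv_jacobiTerm]
  refine ⟨K, fun k hk => ?_, ?_⟩
  · rw [hna _ (by lia : na ≤ m + k), hnb _ (by lia : nb ≤ n + k), hN _ (by lia : N ≤ l + k),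
      mode_zero]
    simp
  · rw [Finset.sum_sub_distrib, Finset.sum_sub_distrib, ← Finset.smul_sum, sub_eq_zero]
    have hb (m n : ℤ) (h : nb ≤ n) : comp (Y a) (Y b) (fun _ => v) m n 0 = 0 :=
      (congrArg (mode a m) (hnb n h)).trans (map_zero _)
    have ha (m n : ℤ) (h : na ≤ n) : comp (Y b) (Y a) (fun _ => v) m n 0 = 0 :=
      (congrArg (mode b m) (hna n h)).trans (map_zero _)
    have h := LinearMap.congr_fun (borcherds_identity a b l m n) v
    rw [borcherdsSum_eq_sum hN m n hKN,
      nthProduct_apply (Y a) (Y b) l m n (fun _ => v) 0, expandSub, Pi.sub_apply, Pi.sub_apply,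
      Pi.sub_apply, expand_eq_sum l hb m hKb, LinearMap.sum_apply] at h
    refine Eq.trans ?_ h
    congr 2
    exact (expand_eq_sum l ha n hKa).symm

/-- The action of the completion of `U` on `V` is obtained by extending, for each `v : V`, the map
`x ↦ x v` from `U` to its completion. -/
def actAt (v : V) : Env V →+ V := (LinearMap.applyₗ v ∘ₗ (actEnv V).toLinearMap).toAddMonoidHom

local instance : UniformSpace V := ⊥

local instance : DiscreteUniformity V := ⟨rfl⟩

theorem continuous_actAt (v : V) : Continuous (actAt v) := by
  refine continuous_of_continuousAt_zero _ ?_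
  obtain ⟨n, hn⟩ := exists_forall_mem_envNL_actEnv_eq_zero v
  refine Filter.Tendsto.congr' (f₁ := fun _ => actAt v 0) ?_ tendsto_const_nhds
  filter_upwards [(isOpen_envNL n).mem_nhds (zero_mem (envNL V n))] with x hx
  rw [map_zero]
  exact (hn x hx).symm

/-- The action of the completion of `U` on a fixed vector. -/
def actComplAt (v : V) : EnvCompl V →+ V := (actAt v).extension (continuous_actAt v)

theorem continuous_actComplAt (v : V) : Continuous (actComplAt v) :=
  AddMonoidHom.continuous_extension _ _

theorem actComplAt_coe (v : V) (x : Env V) : actComplAt v (x : EnvCompl V) = actEnv V x v :=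
  AddMonoidHom.extension_coe _ _ _

theorem actComplAt_add (v w : V) (z : EnvCompl V) :
    actComplAt (v + w) z = actComplAt v z + actComplAt w z := by
  induction z using Completion.induction_on with
  | hp =>
    exact isClosed_eq (continuous_actComplAt (v + w))
      ((continuous_actComplAt v).add (continuous_actComplAt w))
  | ih x => simp only [actComplAt_coe, map_add]

theorem actComplAt_mul (v : V) (y z : EnvCompl V) :
    actComplAt v (y * z) = actComplAt (actComplAt v z) y := by
  induction z using Completion.induction_on with
  | hp =>
    exact isClosed_eq ((continuous_actComplAt v).comp (continuous_const.mul continuous_id))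
      ((continuous_of_discreteTopology (f := fun w : V => actComplAt w y)).comp
        (continuous_actComplAt v))
  | ih x =>
    induction y using Completion.induction_on with
    | hp =>
      exact isClosed_eq ((continuous_actComplAt v).comp (continuous_id.mul continuous_const))
        (continuous_actComplAt _)
    | ih y =>
      rw [← Completion.coe_mul, actComplAt_coe, actComplAt_coe, actComplAt_coe, map_mul,
        Module.End.mul_apply]

variable (V) in
/-- The action of the completion of `U` on `V`. -/
def actCompl : EnvCompl V →+* AddMonoid.End V where
  toFun z := AddMonoidHom.mk' (fun v => actComplAt v z) fun v w => actComplAt_add v w z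
  map_one' := by
    ext v
    change actComplAt v 1 = v
    rw [← Completion.coe_one, actComplAt_coe, map_one, Module.End.one_apply]
  map_mul' y z := by
    ext v
    exact actComplAt_mul v y z
  map_zero' := by
    ext v
    exact map_zero (actComplAt v)
  map_add' y z := by
    ext v
    exact map_add (actComplAt v) y z

theorem actCompl_coe (x : Env V) (v : V) : actCompl V (x : EnvCompl V) v = actEnv V x v :=
  actComplAt_coe v x

theorem actCompl_jacobi {i j : ℕ} {a b : V} (ha : a ∈ piece i) (hb : b ∈ piece j) (l m n : ℤ) :
    actCompl V (jacobi a b l m n) = 0 := by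
  ext v
  obtain ⟨K, hK, hsum⟩ := exists_actEnv_jacobiTerm_eq_zero_and_sum_eq_zero a b v l m n
  have h₁ := (summable_jacobiTerm ha hb l m n).hasSum.map (actComplAt v) (continuous_actComplAt v)
  have h₂ : HasSum (fun k => actEnv V (jacobiTerm a b l m n k) v) 0 :=
    hsum ▸ hasSum_sum_of_ne_finset_zero fun k hk => hK k (by simpa using hk)
  simp only [Function.comp_def, actComplAt_coe] at h₁
  exact h₁.unique h₂

theorem actCompl_vacuum :
    actCompl V ((envι V (lieMode vac (-1)) - 1 : Env V) : EnvCompl V) = 0 := by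
  ext v
  have hvac : mode (vac : V) (-1) v = v := congr($(vac_mode (V := V) (-1)) v)
  rw [actCompl_coe, map_sub, actEnv_lieMode, map_one, LinearMap.sub_apply, hvac,
    Module.End.one_apply, sub_self]
  rfl

theorem actCompl_eq_zero_of_isRelation {q : ℤ} {r : EnvCompl V} (hr : IsRelation V q r) :
    actCompl V r = 0 := by
  cases hr with
  | jacobi i j a b l m n ha hb => exact actCompl_jacobi ha hb l m n
  | vacuum => exact actCompl_vacuum

theorem actCompl_eq_zero_of_mem_relClosurePiece {p : ℤ} {z : EnvCompl V}
    (hz : z ∈ relClosurePiece V p) : actCompl V z = 0 := by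
  ext v
  refine closure_minimal (fun x hx => ?_)
    (isClosed_eq (continuous_actComplAt v) continuous_const) hz
  suffices actCompl V x = 0 from congr($this v)
  refine (AddSubgroup.closure_le (actCompl V).toAddMonoidHom.ker).2 ?_ hx
  rintro _ ⟨s, q, t, x, r, y, -, -, hr, -, rfl⟩
  change actCompl V (x * r * y) = 0
  rw [map_mul, map_mul, actCompl_eq_zero_of_isRelation hr, mul_zero, zero_mul]

variable (V) in
/-- The action of `𝒰` on `V`. -/
def act : UnivEnv V →+* AddMonoid.End V :=
  Ideal.Quotient.lift (relIdeal V) ((actCompl V).comp (Hat V).subtype) fun _ hx =>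
    (iSup_le fun _ _ hz => actCompl_eq_zero_of_mem_relClosurePiece hz :
      ⨆ p, relClosurePiece V p ≤ (actCompl V).toAddMonoidHom.ker) hx

theorem act_envToUnivEnv (x : Env V) (v : V) : act V (envToUnivEnv V x) v = actEnv V x v :=
  actComplAt_coe v x

theorem act_mem_of_mem_imageInUnivEnv {M : Submodule ℂ (Env V)} {S : Set V} {v : V}
    (h : ∀ x ∈ M, actEnv V x v ∈ S) {z : UnivEnv V}
    (hz : z ∈ imageInUnivEnv V (closureImage V M)) : act V z v ∈ S := by
  obtain ⟨y, hy, rfl⟩ := hz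
  exact closureImage_induction ((isClosed_discrete S).preimage (continuous_actComplAt v))
    (fun x hx => by simpa only [Set.mem_preimage, actComplAt_coe] using h x hx) hy

end ComplAction

section UnivEnvModes

variable {V : Type u} [AddCommGroup V] [Module ℂ V] [VertexOperatorAlgebra V]

theorem envToUnivEnv_mem {M : Submodule ℂ (Env V)} {x : Env V} (hx : x ∈ M) :
    envToUnivEnv V x ∈ imageInUnivEnv V (closureImage V M) :=
  ⟨⟨x, coe_mem_Hat V x⟩, coe_mem_closureImage hx, rfl⟩

variable (V) in
/-- The inclusion of the scalars into `𝒰`. -/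
def scalar : ℂ →+* UnivEnv V := (envToUnivEnv V).comp (algebraMap ℂ (Env V))

theorem scalar_commute (c : ℂ) (x : UnivEnv V) : Commute (scalar V c) x := by
  obtain ⟨x, rfl⟩ := Ideal.Quotient.mk_surjective x
  have hcomm (z : EnvCompl V) : Commute ((algebraMap ℂ (Env V) c : Env V) : EnvCompl V) z := by
    induction z using Completion.induction_on with
    | hp =>
      exact isClosed_eq (continuous_const.mul continuous_id) (continuous_id.mul continuous_const)
    | ih x =>
      have : Commute (algebraMap ℂ (Env V) c) x := Algebra.commutes c x
      exact this.map (Completion.coeRingHom : Env V →+* EnvCompl V)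
  exact congrArg (Ideal.Quotient.mk (relIdeal V)) (Subtype.ext (hcomm x))

instance : Algebra ℂ (UnivEnv V) := (scalar V).toAlgebra' scalar_commute

theorem algebraMap_mem (c : ℂ) : algebraMap ℂ (UnivEnv V) c ∈ (univGrading V).piece 0 :=
  envToUnivEnv_mem (by
    rw [Algebra.algebraMap_eq_smul_one]
    exact Submodule.smul_mem _ _ one_mem_envPiece)

variable (V) in
/-- The map `U → 𝒰` as a homomorphism of `ℂ`-algebras. -/
def envToUnivEnvAlgHom : Env V →ₐ[ℂ] UnivEnv V where
  __ := envToUnivEnv V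
  commutes' _ := rfl

theorem envToUnivEnv_smul (c : ℂ) (x : Env V) :
    envToUnivEnv V (c • x) = c • envToUnivEnv V x :=
  map_smul (envToUnivEnvAlgHom V) c x

theorem smul_mem_NL {n d : ℤ} (c : ℂ) {x : UnivEnv V} (hx : x ∈ (univGrading V).NL n d) :
    c • x ∈ (univGrading V).NL n d := by
  have := (univGrading V).mul_NL (algebraMap_mem c) hx
  rwa [zero_add, ← Algebra.smul_def] at this

theorem smul_mem_NL_iff {n d : ℤ} {c : ℂ} (hc : c ≠ 0) {x : UnivEnv V} :
    c • x ∈ (univGrading V).NL n d ↔ x ∈ (univGrading V).NL n d := by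
  refine ⟨fun h => ?_, smul_mem_NL c⟩
  rw [← inv_smul_smul₀ hc x]
  exact smul_mem_NL c⁻¹ h

theorem act_mul_apply (y z : UnivEnv V) (v : V) : act V (y * z) v = act V y (act V z v) := by
  rw [map_mul]
  rfl

theorem act_algebraMap (c : ℂ) (v : V) : act V (algebraMap ℂ (UnivEnv V) c) v = c • v :=
  (act_envToUnivEnv _ v).trans (by rw [AlgHom.commutes, Module.algebraMap_end_apply])

/-- The image of `a_[i]` in `𝒰`. -/
def uMode (a : V) (i : ℤ) : UnivEnv V := envToUnivEnv V (envι V (lieMode a i))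

theorem uMode_mem {k : ℕ} {a : V} (ha : a ∈ piece k) {i d : ℤ} (h : k - i - 1 = d) :
    uMode a i ∈ (univGrading V).piece d :=
  h ▸ envToUnivEnv_mem (envι_lieMode_mem ha i)

theorem uMode_smul (c : ℂ) (a : V) (i : ℤ) : uMode (c • a) i = c • uMode a i := by
  rw [uMode, lieMode_smul, map_smul, envToUnivEnv_smul, uMode]

theorem uMode_zero (i : ℤ) : uMode (0 : V) i = 0 := by
  rw [uMode, lieMode_zero, map_zero, map_zero]

theorem uMode_Lneg (a : V) (i : ℤ) : uMode (Lneg a) i = (-i : ℂ) • uMode a (i - 1) := by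
  rw [uMode, lieMode_Lneg, map_smul, envToUnivEnv_smul, uMode]

theorem uMode_lie_uMode (a b : V) (i : ℕ) (j : ℤ) :
    ⁅uMode a i, uMode b j⁆ =
      ∑ k ∈ Finset.range (i + 1), (i.choose k : ℂ) • uMode (mode a k b) (i + j - k) := by
  rw [Ring.lie_def, uMode, uMode, ← map_mul (envToUnivEnv V), ← map_mul (envToUnivEnv V),
    ← map_sub (envToUnivEnv V), ← Ring.lie_def, envι_lie_lieMode_natCast, map_sum]
  exact Finset.sum_congr rfl fun k _ => envToUnivEnv_smul _ _

theorem uMode_lie_uMode_eq_sum_range {a b : V} {N : ℕ} (hN : ∀ k ≥ N, mode a (k : ℤ) b = 0) (i : ℕ)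
    (j : ℤ) : ⁅uMode a i, uMode b j⁆ =
      ∑ k ∈ Finset.range N, (i.choose k : ℂ) • uMode (mode a k b) (i + j - k) := by
  rw [uMode_lie_uMode]
  refine Finset.sum_congr_of_eq_on_inter (fun k _ hk => ?_) (fun k _ hk => ?_) fun _ _ _ => rfl
  · rw [hN k (by simpa using hk), uMode_zero, smul_zero]
  · rw [Nat.choose_eq_zero_of_lt (by simpa using hk), Nat.cast_zero, zero_smul]

theorem uMode_vac : uMode (vac : V) (-1) = 1 := by
  have h : envToUnivEnv V (envι V (lieMode vac (-1)) - 1) = 0 := by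
    refine Ideal.Quotient.eq_zero_iff_mem.2 (AddSubgroup.mem_iSup_of_mem 0
      (subset_closure (AddSubgroup.subset_closure
        ⟨0, 0, 0, 1, _, 1, rfl, one_mem_hatPiece, IsRelation.vacuum, one_mem_hatPiece, ?_⟩)))
    rw [one_mul, mul_one]
    rfl
  rwa [map_sub, map_one, sub_eq_zero] at h

theorem act_uMode (a : V) (i : ℤ) (v : V) : act V (uMode a i) v = mode a i v := by
  rw [uMode, act_envToUnivEnv, actEnv_lieMode]

variable (V) in
/-- The image of the Virasoro mode `L_n = ω_[n+1]` in `𝒰`. -/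
def uL (n : ℤ) : UnivEnv V := uMode omega (n + 1)

theorem uL_mem (n : ℤ) : uL V n ∈ (univGrading V).piece (-n) :=
  uMode_mem omega_mem (by push_cast; ring)

theorem uL_zero_lie {d : ℤ} {x : UnivEnv V} (hx : x ∈ (univGrading V).piece d) :
    ⁅uL V 0, x⁆ = (d : ℂ) • x := by
  obtain ⟨x, hx, rfl⟩ := hx
  set L : EnvCompl V := ((envι V (lieMode omega (0 + 1)) : Env V) : EnvCompl V)
  set s : EnvCompl V := ((algebraMap ℂ (Env V) d : Env V) : EnvCompl V)
  have hlie : L * x - x * L = s * x := by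
    refine closureImage_induction (P := fun z => L * z - z * L = s * z)
      (isClosed_eq ((continuous_const.mul continuous_id).sub (continuous_id.mul continuous_const))
        (continuous_const.mul continuous_id)) (fun y hy => ?_) hx
    have h := congrArg (Completion.coeRingHom : Env V →+* EnvCompl V) (Lzero_lie_of_mem hy)
    rwa [Ring.lie_def, Algebra.smul_def, map_sub, map_mul, map_mul, map_mul] at h
  exact congrArg (Ideal.Quotient.mk (relIdeal V)) (Subtype.ext hlie)

theorem piece_le_NL {n p : ℤ} (h : n ≤ -p) : (univGrading V).piece p ≤ (univGrading V).NL n p := by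
  refine AddSubgroup.map_mono (AddSubgroup.comap_mono (closureImage_mono fun x hx => ?_))
  refine Submodule.mem_iSup_of_mem p (Submodule.mem_iSup_of_mem (by lia) ?_)
  simpa only [one_mul, sub_self] using Submodule.mul_mem_mul (one_mem_envPiece (V := V)) hx

theorem piece_le_NL_of_nonpos {n p : ℤ} (h : n ≤ 0) :
    (univGrading V).piece p ≤ (univGrading V).NL n p := by
  refine AddSubgroup.map_mono (AddSubgroup.comap_mono (closureImage_mono fun x hx => ?_))
  refine Submodule.mem_iSup_of_mem 0 (Submodule.mem_iSup_of_mem (by lia) ?_)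
  simpa only [mul_one, sub_zero] using Submodule.mul_mem_mul hx (one_mem_envPiece (V := V))

theorem exists_sub_mem_NL {d : ℤ} (n : ℤ) {z : UnivEnv V} (hz : z ∈ (univGrading V).piece d) :
    ∃ x ∈ envPiece V d, z - envToUnivEnv V x ∈ (univGrading V).NL n d := by
  obtain ⟨z, hz, rfl⟩ := hz
  obtain ⟨x, hx, hzx⟩ := exists_sub_mem_hatNL n hz
  exact ⟨x, hx, z - ⟨x, coe_mem_Hat V x⟩, hzx, rfl⟩

end UnivEnvModes

end VertexOperatorAlgebra

end

noncomputable section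

theorem BalTensor.induction {S X M : Type u} [AddCommGroup X] [AddCommGroup M]
    {ρ : S → X →+ X} {lam : S → M →+ M} {C : BalTensor ρ lam → Prop}
    (tmul : ∀ x m, C (BalTensor.tmul ρ lam x m)) (zero : C 0)
    (add : ∀ s t, C s → C t → C (s + t)) (t : BalTensor ρ lam) : C t := by
  obtain ⟨t, rfl⟩ := QuotientAddGroup.mk_surjective t
  induction t using TensorProduct.induction_on with
  | zero => exact zero
  | tmul x m => exact tmul x m
  | add s t hs ht => exact add _ _ hs ht

namespace SeminormedGrading

variable {R : Type u} [Ring R] (G : SeminormedGrading R)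
  {W W' : Type u} [AddCommGroup W] [Module G.Zhu W] [AddCommGroup W'] [Module G.Zhu W']

/-- The map `Φ^L(W) → Φ^L(W')` induced by a linear map `W → W'`. -/
def mapVerma (f : W →ₗ[G.Zhu] W') (q : ℤ) : G.VermaL W q →+ G.VermaL W' q :=
  BalTensor.lift ((BalTensor.tmul _ _).compl₂ f.toAddMonoidHom) fun s x w => by
    simp only [AddMonoidHom.compl₂_apply]
    rw [BalTensor.tmul_balanced]
    congr 1
    exact (f.map_smul (G.toZhu s) w).symm

theorem mapVerma_tmul (f : W →ₗ[G.Zhu] W') (q : ℤ) (x : G.LQ q) (w : W) :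
    G.mapVerma f q (BalTensor.tmul _ _ x w) = BalTensor.tmul _ _ x (f w) := rfl

theorem mapVerma_comp {W'' : Type u} [AddCommGroup W''] [Module G.Zhu W''] (g : W' →ₗ[G.Zhu] W'')
    (f : W →ₗ[G.Zhu] W') (q : ℤ) (z : G.VermaL W q) :
    G.mapVerma (g.comp f) q z = G.mapVerma g q (G.mapVerma f q z) := by
  have : G.mapVerma (g.comp f) q = (G.mapVerma g q).comp (G.mapVerma f q) := by ext x w; rfl
  exact congr($this z)

theorem mapVerma_id (q : ℤ) (z : G.VermaL W q) : G.mapVerma LinearMap.id q z = z := by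
  have : G.mapVerma (W := W) LinearMap.id q = AddMonoidHom.id _ := by ext x w; rfl
  exact congr($this z)

theorem contract_tmul_tmul (m : ℤ) (a : G.Zhu) (y : G.RQ (-m)) (x : G.LQ m) (w : W) :
    G.contract m (BalTensor.tmul _ _ a y) (BalTensor.tmul _ _ x w : G.VermaL W m) =
      (a * G.pairing m y x) • w := rfl

theorem contract_mapVerma (f : W →ₗ[G.Zhu] W') (m : ℤ) (t : G.VermaR (-m)) (z : G.VermaL W m) :
    G.contract m t (G.mapVerma f m z) = f (G.contract m t z) := by
  have : (G.contract m).compl₂ (G.mapVerma f m) =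
      (G.contract m).compr₂ f.toAddMonoidHom := by
    ext a y x w
    exact (f.map_smul _ w).symm
  exact congr($this t z)

theorem star_tmul {n m : ℤ} (x : G.LQ n) (t : G.VermaR (-m)) (z : G.VermaL W m) :
    G.star (BalTensor.tmul _ _ x t : G.MTA n (-m)) z = BalTensor.tmul _ _ x (G.contract m t z) :=
  rfl

theorem star_mapVerma (f : W →ₗ[G.Zhu] W') {n m : ℤ} (a : G.MTA n (-m)) (z : G.VermaL W m) :
    G.star a (G.mapVerma f m z) = G.mapVerma f n (G.star a z) := by
  induction a using BalTensor.induction with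
  | tmul x t => rw [star_tmul, star_tmul, contract_mapVerma, mapVerma_tmul]
  | zero => simp only [map_zero, AddMonoidHom.zero_apply]
  | add a b ha hb => simp only [map_add, AddMonoidHom.add_apply, ha, hb]

/-- The linear map `t ↦ t ⊛ z` from `Φ^R(A)_{-m}` given by a fixed `z ∈ Φ^L(W)_m`. -/
def contractRight (m : ℤ) (z : G.VermaL W m) : G.VermaR (-m) →ₗ[G.Zhu] W where
  toFun t := G.contract m t z
  map_add' t t' := by rw [map_add]; rfl
  map_smul' a t := G.contract_smul m a t z

theorem star_eq_mapVerma {n m : ℤ} (a : G.MTA n (-m)) (z : G.VermaL W m) :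
    G.star a z = G.mapVerma (G.contractRight m z) n a := by
  have : (G.star (W := W) (n := n) (m := m)).flip z = G.mapVerma (G.contractRight m z) n := by
    ext x t; rfl
  exact congr($this a)

theorem contract_contract {m k : ℤ} (s : G.VermaR (-k)) (y : G.MTA k (-m)) (z : G.VermaL W m) :
    G.contract m (G.contract k s y) z = G.contract k s (G.star y z) := by
  rw [star_eq_mapVerma, contract_mapVerma]
  rfl

theorem star_lact {p n m : ℤ} (u : G.piece p) (a : G.MTA n (-m)) (z : G.VermaL W m) :
    G.star (G.lact u n a) z = G.lact u n (G.star a z) := by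
  induction a using BalTensor.induction with
  | tmul x t => rfl
  | zero => simp only [map_zero, AddMonoidHom.zero_apply]
  | add a b ha hb => simp only [map_add, AddMonoidHom.add_apply, ha, hb]

/-- The right action of `u` on `Φ^R(A)`, as an `A`-linear map. -/
def ractLin {p : ℤ} (u : G.piece p) (q : ℤ) : G.VermaR q →ₗ[G.Zhu] G.VermaR (q + p) where
  toFun := G.ractVermaR u q
  map_add' := map_add _
  map_smul' a t := G.ractVermaR_smul u q a t

theorem ract_eq_mapVerma {p : ℤ} (u : G.piece p) (n q : ℤ) :
    G.ract u n q = G.mapVerma (G.ractLin u q) n := by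
  ext x t; rfl

theorem star_ract {p n m q : ℤ} (u : G.piece p) (a : G.MTA n (-m)) (b : G.MTA m q) :
    G.star a (G.ract u m q b) = G.ract u n q (G.star a b) := by
  rw [ract_eq_mapVerma, ract_eq_mapVerma, star_mapVerma]

theorem lact_one_injective {p : ℤ} (hp : p = 0) (u : G.piece p) (hu : (u : R) = 1) (q : ℤ) :
    Function.Injective (G.lact (W := W) u q) := by
  suffices ∀ k (hk : q = k) (F : G.VermaL W q →+ G.VermaL W k),
      (∀ x w, F (BalTensor.tmul _ _ (QuotientAddGroup.mk x) w) =
        BalTensor.tmul _ _ (QuotientAddGroup.mk ⟨x, hk ▸ x.2⟩) w) → Function.Injective F by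
    refine this (p + q) (by rw [hp, zero_add]) _ fun x w => congrArg
      (fun y => BalTensor.tmul _ _ (QuotientAddGroup.mk y : G.LQ (p + q)) w) (Subtype.ext ?_)
    exact (congrArg (· * (x : R)) hu).trans (one_mul _)
  rintro k rfl F hF
  have : F = AddMonoidHom.id _ := by
    ext x w
    induction x using QuotientAddGroup.induction_on with | H x => exact hF x w
  exact this ▸ Function.injective_id

theorem ract_one_injective {p : ℤ} (hp : p = 0) (u : G.piece p) (hu : (u : R) = 1) (n q : ℤ) :
    Function.Injective (G.ract u n q) := by
  suffices ∀ k (hk : q = k) (F : G.VermaR q →ₗ[G.Zhu] G.VermaR k),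
      (∀ a x, F (BalTensor.tmul _ _ a (QuotientAddGroup.mk x)) =
        BalTensor.tmul _ _ a (QuotientAddGroup.mk ⟨x, hk ▸ x.2⟩)) →
      Function.Injective (G.mapVerma F n) by
    rw [ract_eq_mapVerma]
    refine this (q + p) (by rw [hp, add_zero]) _ fun a x => congrArg
      (fun y => BalTensor.tmul _ _ a (QuotientAddGroup.mk y : G.RQ (q + p))) (Subtype.ext ?_)
    exact (congrArg ((x : R) * ·) hu).trans (mul_one _)
  rintro k rfl F hF
  have : F.toAddMonoidHom = AddMonoidHom.id _ := by
    ext a x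
    induction x using QuotientAddGroup.induction_on with | H x => exact hF a x
  obtain rfl : F = LinearMap.id := LinearMap.ext fun t => congr($this t)
  exact fun z z' h => by rwa [mapVerma_id, mapVerma_id] at h

theorem tmul_eq_mapVerma_toSpanSingleton {m : ℤ} (x : G.LQ m) (w : W) :
    (BalTensor.tmul _ _ x w : G.VermaL W m) =
      G.mapVerma (LinearMap.toSpanSingleton G.Zhu W w) m (BalTensor.tmul _ _ x (1 : G.Zhu)) := by
  rw [mapVerma_tmul, LinearMap.toSpanSingleton_apply, one_smul]

theorem star_eq_of_zhu {n m : ℤ} {a b : G.MTA n (-m)}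
    (h : ∀ z : G.VermaL G.Zhu m, G.star a z = G.star b z) (z : G.VermaL W m) :
    G.star a z = G.star b z := by
  induction z using BalTensor.induction with
  | tmul x w => rw [tmul_eq_mapVerma_toSpanSingleton, star_mapVerma, star_mapVerma, h]
  | zero => rw [map_zero, map_zero]
  | add s t hs ht => rw [map_add, map_add, hs, ht]

theorem star_eq_self_of_zhu {m : ℤ} {e : G.MTA m (-m)}
    (h : ∀ z : G.VermaL G.Zhu m, G.star e z = z) (z : G.VermaL W m) : G.star e z = z := by
  induction z using BalTensor.induction with
  | tmul x w => rw [tmul_eq_mapVerma_toSpanSingleton, star_mapVerma, h]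
  | zero => rw [map_zero]
  | add s t hs ht => rw [map_add, hs, ht]

/-- The idea is that `A` is a retract of `Φ^R(A)_0`. -/
theorem star_zhu_eq_self_of_zero {m k : ℤ} (hk : k = 0) {e : G.MTA m (-m)}
    (h : ∀ z : G.MTA m (-k), G.star e z = z) (z : G.VermaL G.Zhu m) : G.star e z = z := by
  subst hk
  have h1 : (1 : R) ∈ G.piece (-0) := by rw [neg_zero]; exact G.one_mem
  let f : G.VermaR (-0) →ₗ[G.Zhu] G.Zhu := G.contractRight 0
    (BalTensor.tmul _ _ (QuotientAddGroup.mk ⟨1, G.one_mem⟩) (1 : G.Zhu))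
  let g : G.Zhu →ₗ[G.Zhu] G.VermaR (-0) :=
    LinearMap.toSpanSingleton G.Zhu _ (BalTensor.tmul _ _ (1 : G.Zhu) (QuotientAddGroup.mk ⟨1, h1⟩))
  have hfg : f.comp g = LinearMap.id := by
    refine LinearMap.ext fun a => ?_
    change G.contract (W := G.Zhu) 0
      (a • (BalTensor.tmul _ _ (1 : G.Zhu) (QuotientAddGroup.mk ⟨1, h1⟩) : G.VermaR (-0)))
      (BalTensor.tmul _ _ (QuotientAddGroup.mk ⟨1, G.one_mem⟩) (1 : G.Zhu)) = a
    rw [contract_smul, contract_tmul_tmul]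
    have : G.pairing 0 (QuotientAddGroup.mk ⟨1, h1⟩) (QuotientAddGroup.mk ⟨1, G.one_mem⟩) = 1 := by
      change G.toZhu (G.mulHom _ ⟨1, h1⟩ ⟨1, G.one_mem⟩) = 1
      rw [← map_one G.toZhu]
      exact congrArg G.toZhu (Subtype.ext (one_mul (1 : R)))
    rw [this, mul_one, smul_eq_mul, smul_eq_mul, mul_one, mul_one]
  have hz : z = G.mapVerma f m (G.mapVerma g m z) := by
    rw [← mapVerma_comp, hfg, mapVerma_id]
  rw [hz, star_mapVerma, h]

/-- The right action of `A` on `(R / N_L^1 R)_q`. -/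
def zhuRmulLQ (q : ℤ) : G.Zhu →+ G.LQ q →+ G.LQ q :=
  QuotientAddGroup.lift G.zhuIdeal.toAddSubgroup
    (AddMonoidHom.mk' (G.rmulLQ q) fun r s => by
      ext x; exact congrArg QuotientAddGroup.mk (Subtype.ext (mul_add (x : R) r s)))
    fun r hr => by
      ext x
      have := G.mul_NL (p := q) x.2 hr
      rw [add_zero] at this
      exact (QuotientAddGroup.eq_zero_iff _).2 this

/-- The left action of `A` on `(R / N_R^1 R)_q`. -/
def zhuLmulRQ (q : ℤ) : G.Zhu →+ G.RQ q →+ G.RQ q :=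
  QuotientAddGroup.lift G.zhuIdeal.toAddSubgroup
    (AddMonoidHom.mk' (G.lmulRQ q) fun r s => by
      ext x; exact congrArg QuotientAddGroup.mk (Subtype.ext (add_mul (r : R) s x)))
    fun r hr => by
      ext x
      have := G.NL_mul (q := q) (y := (x : R)) hr x.2
      rw [zero_add] at this
      exact (QuotientAddGroup.eq_zero_iff _).2 this

/-- The canonical isomorphism `Φ^L(A)_q → (R / N_L^1 R)_q`, of which only one direction is
needed. -/
def toLQ (q : ℤ) : G.VermaL G.Zhu q →+ G.LQ q :=
  BalTensor.lift (G.zhuRmulLQ q).flip fun s x a => by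
    obtain ⟨r, rfl⟩ := Ideal.Quotient.mk_surjective a
    induction x using QuotientAddGroup.induction_on with
    | H x => exact congrArg QuotientAddGroup.mk (Subtype.ext (mul_assoc (x : R) s r))

theorem toLQ_tmul (q : ℤ) (x : G.LQ q) (s : G.zeroRing) :
    G.toLQ q (BalTensor.tmul _ _ x (G.toZhu s)) = G.rmulLQ q s x := rfl

theorem toLQ_tmul_one (q : ℤ) (x : G.LQ q) : G.toLQ q (BalTensor.tmul _ _ x (1 : G.Zhu)) = x := by
  induction x using QuotientAddGroup.induction_on with
  | H x => exact congrArg QuotientAddGroup.mk (Subtype.ext (mul_one (x : R)))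

/-- The canonical isomorphism `Φ^R(A)_q → (R / N_R^1 R)_q`, of which only one direction is
needed. -/
def toRQ (q : ℤ) : G.VermaR q →+ G.RQ q :=
  BalTensor.lift (G.zhuLmulRQ q) fun s a y => by
    obtain ⟨r, rfl⟩ := Ideal.Quotient.mk_surjective a
    induction y using QuotientAddGroup.induction_on with
    | H y => exact congrArg QuotientAddGroup.mk (Subtype.ext (mul_assoc (r : R) s y))

theorem toRQ_tmul (q : ℤ) (s : G.zeroRing) (y : G.RQ q) :
    G.toRQ q (BalTensor.tmul _ _ (G.toZhu s) y) = G.lmulRQ q s y := rfl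

theorem exists_tmul_one (q : ℤ) (t : G.VermaR q) :
    ∃ x : G.RQ q, t = BalTensor.tmul _ _ (1 : G.Zhu) x := by
  induction t using BalTensor.induction with
  | tmul a y =>
    obtain ⟨s, rfl⟩ := Ideal.Quotient.mk_surjective a
    refine ⟨G.lmulRQ q s y, ?_⟩
    rw [← BalTensor.tmul_balanced]
    exact congrArg (BalTensor.tmul _ _ · y) (one_mul (G.toZhu s)).symm
  | zero => exact ⟨0, (map_zero _).symm⟩
  | add s t hs ht =>
    obtain ⟨x, rfl⟩ := hs
    obtain ⟨y, rfl⟩ := ht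
    exact ⟨x + y, (map_add _ x y).symm⟩

theorem neg_mul_mem {m : ℤ} {y x : R} (hy : y ∈ G.piece (-m)) (hx : x ∈ G.piece m) :
    y * x ∈ G.piece 0 := by
  have := G.mul_mem hy hx
  rwa [neg_add_cancel] at this

theorem pairing_mk {m : ℤ} (y : G.piece (-m)) (x : G.piece m) :
    G.pairing m (QuotientAddGroup.mk y) (QuotientAddGroup.mk x) =
      G.toZhu ⟨y * x, G.neg_mul_mem y.2 x.2⟩ := rfl

theorem toZhu_eq_zero {s : G.zeroRing} : G.toZhu s = 0 ↔ (s : R) ∈ G.NL 1 0 :=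
  Ideal.Quotient.eq_zero_iff_mem

/-- The elements of `R_{-m}` that are orthogonal to `R_m` under the pairing `⊛` with values
in `A`. -/
def orthogonal (m : ℤ) : AddSubgroup R where
  carrier := {x | x ∈ G.piece (-m) ∧ ∀ p ∈ G.piece m, x * p ∈ G.NL 1 0}
  zero_mem' := ⟨zero_mem _, fun p _ => (zero_mul p).symm ▸ zero_mem _⟩
  add_mem' hx hy := ⟨add_mem hx.1 hy.1, fun p hp => by
    rw [add_mul]; exact add_mem (hx.2 p hp) (hy.2 p hp)⟩
  neg_mem' hx := ⟨neg_mem hx.1, fun p hp => by rw [neg_mul]; exact neg_mem (hx.2 p hp)⟩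

/-- The ideal `R_{-n} R_n` of `R_0` annihilates the class of `x` in `R_{-m} / N_R^1 R_{-m}`. -/
def IsAnnihilated (n m : ℤ) (x : R) : Prop :=
  ∀ y ∈ G.piece (-n), ∀ p ∈ G.piece n, y * p * x ∈ G.NR 1 (-m)

variable {G}

theorem orthogonal_mul {m n d : ℤ} {x u : R} (hx : x ∈ G.orthogonal m) (hu : u ∈ G.piece d)
    (h : -m + d = -n) : x * u ∈ G.orthogonal n := by
  refine ⟨h ▸ G.mul_mem hx.1 hu, fun p hp => ?_⟩
  have hup := G.mul_mem hu hp
  rw [show d + n = m by lia] at hup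
  rw [mul_assoc]
  exact hx.2 _ hup

theorem zero_mul_NR {n q : ℤ} {s x : R} (hs : s ∈ G.piece 0) (hx : x ∈ G.NR n q) :
    s * x ∈ G.NR n q := by
  have := G.mul_NL hs hx
  rwa [zero_add] at this

theorem NR_mul {n p q d : ℤ} {x u : R} (hx : x ∈ G.NR n p) (hu : u ∈ G.piece d)
    (h : p + d = q) : x * u ∈ G.NR n q := by
  subst h
  have := G.NL_mul hx hu
  rwa [sub_sub] at this

theorem NL_zero_mul {n q : ℤ} {s x : R} (hs : s ∈ G.NL n 0) (hx : x ∈ G.piece q) :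
    s * x ∈ G.NR n q := by
  have := G.NL_mul hs hx
  rwa [zero_add] at this

theorem isAnnihilated_of_mem_orthogonal {m : ℤ} {e : G.MTA m (-m)}
    (he : ∀ a : G.MTA m (-m), G.star a e = a) {x : R} (hx : x ∈ G.orthogonal m) :
    G.IsAnnihilated m m x := by
  intro y hy p hp
  obtain ⟨hx, hx'⟩ := hx
  lift x to G.piece (-m) using hx
  lift y to G.piece (-m) using hy
  lift p to G.piece m using hp
  set t : G.VermaR (-m) := BalTensor.tmul _ _ (1 : G.Zhu) (QuotientAddGroup.mk x) with ht
  have contract_t (z : G.VermaL (G.VermaR (-m)) m) : G.contract m t z = 0 := by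
    induction z using BalTensor.induction with
    | tmul q w =>
      induction q using QuotientAddGroup.induction_on with
      | H q =>
        rw [ht, contract_tmul_tmul, pairing_mk, G.toZhu_eq_zero.2 (hx' q q.2), mul_zero, zero_smul]
    | zero => exact map_zero _
    | add a b ha hb => rw [map_add, ha, hb, add_zero]
  have tmul_t : (BalTensor.tmul _ _ (QuotientAddGroup.mk p) t : G.MTA m (-m)) = 0 := by
    rw [← he (BalTensor.tmul _ _ (QuotientAddGroup.mk p) t), star_tmul, contract_t, map_zero]
  have smul_t : G.toZhu ⟨y * p, G.neg_mul_mem y.2 p.2⟩ • t = 0 := by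
    have := G.contract_tmul_tmul m 1 (QuotientAddGroup.mk y) (QuotientAddGroup.mk p) t
    rwa [tmul_t, map_zero, one_mul, pairing_mk, eq_comm] at this
  have := congrArg (G.toRQ (-m)) smul_t
  rw [ht, smul_tmul, mul_one, toRQ_tmul, map_zero] at this
  exact (QuotientAddGroup.eq_zero_iff
    (G.mulHom (zero_add (-m)) ⟨y * p, G.neg_mul_mem y.2 p.2⟩ x)).1 this

theorem contract_eq_self {m : ℤ} {e : G.MTA m (-m)}
    (he : ∀ z : G.VermaL G.Zhu m, G.star e z = z)
    (h : G.orthogonal m ≤ G.NR 1 (-m))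
    (t : G.VermaR (-m)) : G.contract m t e = t := by
  rw [← sub_eq_zero]
  have hzero (z : G.VermaL G.Zhu m) : G.contract m (G.contract m t e - t) z = 0 := by
    rw [map_sub, AddMonoidHom.sub_apply, contract_contract, he, sub_self]
  obtain ⟨x, hx⟩ := G.exists_tmul_one (-m) (G.contract m t e - t)
  rw [hx] at hzero ⊢
  induction x using QuotientAddGroup.induction_on with
  | H x =>
    refine (congrArg _ ((QuotientAddGroup.eq_zero_iff x).2 (h ⟨x.2, fun p hp => ?_⟩))).trans
      (map_zero (BalTensor.tmul _ _ (1 : G.Zhu)))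
    have := hzero (BalTensor.tmul _ _ (QuotientAddGroup.mk ⟨p, hp⟩) 1)
    rwa [contract_tmul_tmul, one_mul, smul_eq_mul, mul_one, G.pairing_mk x ⟨p, hp⟩,
      toZhu_eq_zero] at this

theorem mem_of_forall_mul_mem {n : ℤ} {e : G.MTA n (-n)}
    (he : ∀ z : G.VermaL G.Zhu n, G.star e z = z) {S : AddSubgroup R} (hS : G.NL 1 n ≤ S)
    {p : R} (hp : p ∈ G.piece n)
    (h : ∀ x ∈ G.piece n, ∀ y ∈ G.piece (-n), x * (y * p) ∈ S) : p ∈ S := by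
  lift p to G.piece n using hp
  let π : G.LQ n →+ R ⧸ S :=
    QuotientAddGroup.map _ S (G.piece n).subtype fun z (hz : (z : R) ∈ G.NL 1 n) => hS hz
  suffices ∀ a : G.MTA n (-n),
      π (G.toLQ n (G.star a (BalTensor.tmul _ _ (QuotientAddGroup.mk p) (1 : G.Zhu)))) = 0 by
    have := this e
    rw [he, toLQ_tmul_one] at this
    exact (QuotientAddGroup.eq_zero_iff (p : R)).1 this
  intro a
  induction a using BalTensor.induction with
  | tmul x t =>
    obtain ⟨y, rfl⟩ := G.exists_tmul_one (-n) t
    induction x using QuotientAddGroup.induction_on with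
    | H x =>
      induction y using QuotientAddGroup.induction_on with
      | H y =>
        rw [star_tmul, contract_tmul_tmul, one_mul, smul_eq_mul, mul_one, pairing_mk, toLQ_tmul]
        exact (QuotientAddGroup.eq_zero_iff (x * (y * p) : R)).2 (h x x.2 y y.2)
  | zero => simp only [map_zero, AddMonoidHom.zero_apply]
  | add a b ha hb => simp only [map_add, AddMonoidHom.add_apply, ha, hb, add_zero]

end SeminormedGrading

end

noncomputable section

namespace VertexOperatorAlgebra

variable {V : Type u} [AddCommGroup V] [Module ℂ V] [VertexOperatorAlgebra V]

section Length

variable (V) in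
/-- Products of `ℓ` homogeneous elements `a_[i]` whose degrees add up to `d`. -/
inductive IsMonomialOfLength : ℕ → ℤ → Env V → Prop
  | one : IsMonomialOfLength 0 0 1
  | mul {ℓ k : ℕ} {a : V} {d : ℤ} {x : Env V} (ha : a ∈ piece k) (i : ℤ)
      (hx : IsMonomialOfLength ℓ d x) :
      IsMonomialOfLength (ℓ + 1) (k - i - 1 + d) (envι V (lieMode a i) * x)

theorem IsMonomial.exists_length {d : ℤ} {x : Env V} (hx : IsMonomial V d x) :
    ∃ ℓ, IsMonomialOfLength V ℓ d x := by
  induction hx with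
  | one => exact ⟨0, .one⟩
  | mul k a i d x ha _ ih =>
    obtain ⟨ℓ, h⟩ := ih
    exact ⟨ℓ + 1, .mul ha i h⟩

theorem IsMonomialOfLength.mem_envPiece {ℓ : ℕ} {d : ℤ} {x : Env V}
    (hx : IsMonomialOfLength V ℓ d x) : x ∈ envPiece V d := by
  induction hx with
  | one => exact one_mem_envPiece
  | mul ha i _ ih => exact mul_mem_envPiece (envι_lieMode_mem ha i) ih

variable (V) in
/-- The span of the monomials of length `ℓ` and degree `d`. -/
def lengthPiece (ℓ : ℕ) (d : ℤ) : Submodule ℂ (Env V) :=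
  Submodule.span ℂ {x | IsMonomialOfLength V ℓ d x}

theorem envι_mul_mem_lengthPiece {ℓ : ℕ} {d e : ℤ} {y : FinLie V} (hy : y ∈ finLiePiece V e)
    {x : Env V} (hx : x ∈ lengthPiece V ℓ d) : envι V y * x ∈ lengthPiece V (ℓ + 1) (e + d) := by
  induction hy using Submodule.span_induction with
  | mem y hy =>
    obtain ⟨k, a, i, ha, rfl, rfl⟩ := hy
    induction hx using Submodule.span_induction with
    | mem x hx => exact Submodule.subset_span (.mul ha i hx)
    | zero => rw [mul_zero]; exact zero_mem _
    | add x y _ _ hx hy => rw [mul_add]; exact add_mem hx hy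
    | smul c x _ hx => rw [mul_smul_comm]; exact Submodule.smul_mem _ _ hx
  | zero => rw [map_zero, zero_mul]; exact zero_mem _
  | add y z _ _ hy hz => rw [map_add, add_mul]; exact add_mem hy hz
  | smul c y _ hy => rw [map_smul, smul_mul_assoc]; exact Submodule.smul_mem _ _ hy

theorem lieMode_mem_finLiePiece {k : ℤ} {a : V} (ha : a ∈ pieceInt V k) {i d : ℤ}
    (h : k - i - 1 = d) : lieMode a i ∈ finLiePiece V d := by
  rcases lt_or_ge k 0 with hk | hk
  · rw [pieceInt_of_neg hk, Submodule.mem_bot] at ha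
    rw [ha, lieMode_zero]
    exact zero_mem _
  · lift k to ℕ using hk
    exact Submodule.subset_span ⟨k, a, i, by rwa [← pieceInt_natCast], h, rfl⟩

theorem envι_lie_mem_lengthPiece {k : ℕ} {a : V} (ha : a ∈ piece k) (i : ℤ) {ℓ : ℕ} {d : ℤ}
    {x : Env V} (hx : IsMonomialOfLength V ℓ d x) :
    ⁅envι V (lieMode a i), x⁆ ∈ lengthPiece V ℓ (k - i - 1 + d) := by
  induction hx with
  | one =>
    rw [Ring.lie_def, mul_one, one_mul, sub_self]
    exact zero_mem _
  | @mul ℓ k' b d x hb j hx ih =>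
    have leibniz : ⁅envι V (lieMode a i), envι V (lieMode b j) * x⁆ =
        ⁅envι V (lieMode a i), envι V (lieMode b j)⁆ * x +
          envι V (lieMode b j) * ⁅envι V (lieMode a i), x⁆ := by
      simp only [Ring.lie_def]
      noncomm_ring
    have bracket_mem : ∑ᶠ s : ℕ, Ring.choose (i : ℂ) s • lieMode (mode a s b) (i + j - s) ∈
        finLiePiece V ((k - i - 1) + (k' - j - 1)) := by
      rw [finsum_eq_sum _ (support_choose_smul_lieMode_finite a b i j)]
      refine Submodule.sum_mem _ fun s _ => Submodule.smul_mem _ _ (lieMode_mem_finLiePiece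
        (mode_mem_pieceInt ha s (piece_le_pieceInt k' hb)) ?_)
      ring
    have h₁ := envι_mul_mem_lengthPiece bracket_mem (Submodule.subset_span hx)
    have h₂ := envι_mul_mem_lengthPiece
      (lieMode_mem_finLiePiece (piece_le_pieceInt k' hb) (i := j) rfl) ih
    rw [add_assoc] at h₁
    rw [add_left_comm] at h₂
    rw [leibniz, envι_lie_lieMode]
    exact add_mem h₁ h₂

theorem envToUnivEnv_mem_of_isMonomialOfLength {A : Subalgebra ℂ (UnivEnv V)}
    (hNL : ∀ r ∈ (univGrading V).NL 1 0, r ∈ A)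
    (hA : ∀ (k : ℕ), ∀ a ∈ piece (V := V) (k + 1), uMode a k ∈ A) {ℓ : ℕ} :
    ∀ {y : Env V}, IsMonomialOfLength V ℓ 0 y → envToUnivEnv V y ∈ A := by
  induction ℓ with
  | zero =>
    rintro _ ⟨⟩
    rw [map_one]
    exact one_mem A
  | succ ℓ ih =>
    intro y hy
    generalize hd : (0 : ℤ) = d at hy
    obtain _ | @⟨_, k, a, d, y, ha, i, hy⟩ := hy
    have hyd : envToUnivEnv V y ∈ (univGrading V).piece d := envToUnivEnv_mem hy.mem_envPiece
    have hai : uMode a i ∈ (univGrading V).piece (-d) := uMode_mem ha (by lia)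
    rw [map_mul]
    change uMode a i * envToUnivEnv V y ∈ A
    rcases lt_trichotomy d 0 with hneg | rfl | hpos
    · have := (univGrading V).mul_NL hai (piece_le_NL (n := 1) (by lia) hyd)
      rw [neg_add_cancel] at this
      exact hNL _ this
    · refine mul_mem ?_ (ih hy)
      rcases k with _ | k
      · obtain ⟨μ, rfl⟩ := exists_eq_smul_vac (piece_le_pieceInt 0 ha)
        rw [show i = -1 by push_cast at hd; lia, uMode_smul, uMode_vac]
        exact A.smul_mem (one_mem A) μ
      · obtain rfl : i = k := by push_cast at hd; lia
        exact hA k a ha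
    · have hlie : ⁅envι V (lieMode a i), y⁆ ∈ lengthPiece V ℓ 0 :=
        hd ▸ envι_lie_mem_lengthPiece ha i hy
      have hspan : lengthPiece V ℓ 0 ≤ Subalgebra.toSubmodule (A.comap (envToUnivEnvAlgHom V)) :=
        Submodule.span_le.2 fun _ hz => ih hz
      have hswap := (univGrading V).mul_NL hyd (piece_le_NL (n := 1) (by lia) hai)
      rw [add_neg_cancel] at hswap
      have := add_mem (show envToUnivEnv V ⁅envι V (lieMode a i), y⁆ ∈ A from hspan hlie)
        (hNL _ hswap)
      rwa [Ring.lie_def, map_sub, map_mul, map_mul, ← uMode, sub_add_cancel] at this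

theorem mem_subalgebra_of_mem_piece_zero {A : Subalgebra ℂ (UnivEnv V)}
    (hNL : ∀ r ∈ (univGrading V).NL 1 0, r ∈ A)
    (hA : ∀ (k : ℕ), ∀ a ∈ piece (V := V) (k + 1), uMode a k ∈ A) {r : UnivEnv V}
    (hr : r ∈ (univGrading V).piece 0) : r ∈ A := by
  obtain ⟨y, hy, hry⟩ := exists_sub_mem_NL 1 hr
  have hspan : envPiece V 0 ≤ Subalgebra.toSubmodule (A.comap (envToUnivEnvAlgHom V)) :=
    Submodule.span_le.2 fun z hz =>
      have ⟨_, hz⟩ := IsMonomial.exists_length hz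
      envToUnivEnv_mem_of_isMonomialOfLength hNL hA hz
  exact sub_add_cancel r (envToUnivEnv V y) ▸ add_mem (hNL _ hry) (hspan hy)

end Length

section Virasoro

theorem cast_choose_three {K : Type*} [Field K] [CharZero K] (n : ℕ) :
    ((n + 1).choose 3 : K) = ((n : K) ^ 3 - n) / 6 := by
  induction n with
  | zero => simp [Nat.choose_eq_zero_of_lt]
  | succ n ih =>
    rw [Nat.choose_succ_succ, Nat.cast_add, ih, Nat.cast_choose_two]
    push_cast
    ring

theorem uL_lie_uL_neg (n : ℕ) : ⁅uL V n, uL V (-n)⁆ = (2 * n : ℂ) • uL V 0 +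
    algebraMap ℂ (UnivEnv V) (((n : ℂ) ^ 3 - n) / 12 * centralCharge V) := by
  have lie_eq_sum : ⁅uL V n, uL V (-n)⁆ = ∑ k ∈ Finset.range 4,
      ((n + 1).choose k : ℂ) • uMode (mode (omega : V) k omega) (2 - k) := by
    refine (uMode_lie_uMode_eq_sum_range (fun k hk =>
      mode_omega_omega_eq_zero (by lia) (by lia)) (n + 1) (-n + 1)).trans
      (Finset.sum_congr rfl fun k _ => ?_)
    rw [show ((n + 1 : ℕ) + (-n + 1) - k : ℤ) = 2 - k by push_cast; ring]
  have mode_zero : uMode (mode (omega : V) 0 omega) 2 = (-2 : ℂ) • uL V 0 := by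
    exact_mod_cast uMode_Lneg (omega : V) 2
  have mode_one : uMode (mode (omega : V) 1 omega) 1 = (2 : ℂ) • uL V 0 := by
    rw [mode_omega_one_omega, uMode_smul]
    rfl
  have mode_two : uMode (mode (omega : V) 2 omega) 0 = 0 := by
    rw [mode_omega_omega_eq_zero le_rfl (by decide), uMode_zero]
  have mode_three : uMode (mode (omega : V) 3 omega) (-1) =
      algebraMap ℂ (UnivEnv V) (centralCharge V / 2) := by
    rw [mode_omega_three_omega, uMode_smul, uMode_vac, Algebra.algebraMap_eq_smul_one]
  simp only [lie_eq_sum, Finset.sum_range_succ, Finset.sum_range_zero]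
  norm_num [mode_zero, mode_one, mode_two, mode_three, cast_choose_three,
    Algebra.algebraMap_eq_smul_one]
  module

end Virasoro

end VertexOperatorAlgebra

end

noncomputable section

theorem mem_of_forall_sum_choose_nsmul_mem {E : Type*} [AddCommGroup E] {S : AddSubgroup E}
    {N M : ℕ} {w : ℕ → E} (h : ∀ n ≥ N, ∑ i ∈ Finset.range M, n.choose i • w i ∈ S) :
    ∀ i < M, w i ∈ S := by
  induction M generalizing w with
  | zero => exact fun i hi => (Nat.not_lt_zero i hi).elim
  | succ M ih =>
    have succ_mem : ∀ i < M, w (i + 1) ∈ S := ih fun n hn => by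
      have hdiff := sub_mem (h (n + 1) (by lia)) (h n hn)
      rw [← Finset.sum_sub_distrib, Finset.sum_range_succ'] at hdiff
      simpa only [Nat.choose_succ_succ', add_smul, add_sub_cancel_right, Nat.choose_zero_right,
        sub_self, add_zero] using hdiff
    have zero_mem : w 0 ∈ S := by
      have hN := h N le_rfl
      rw [Finset.sum_range_succ', Nat.choose_zero_right, one_smul] at hN
      exact (add_mem_cancel_left (sum_mem fun i hi =>
        nsmul_mem (succ_mem i (Finset.mem_range.1 hi)) _)).1 hN
    rintro (_ | i) hi
    exacts [zero_mem, succ_mem i (by lia)]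

theorem exists_forall_add_mul_sq_sub_sq_ne_zero {K : Type*} [Field K] [CharZero K] {b : K}
    (hb : b ≠ 0) (c d : K) : ∃ N : ℕ, ∀ k ≥ N, b + c * ((k : K) ^ 2 - d) ≠ 0 := by
  by_contra! h
  obtain ⟨k, -, hk⟩ := h 0
  obtain ⟨l, hl, hl'⟩ := h (k + 1)
  have hsq : (l : K) ^ 2 - (k : K) ^ 2 ≠ 0 := by
    rw [sub_ne_zero]
    exact_mod_cast (Nat.pow_lt_pow_left (show k < l by lia) two_ne_zero).ne'
  have hc : c = 0 := by
    refine (mul_eq_zero.1 ?_).resolve_right hsq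
    linear_combination hl' - hk
  rw [hc, zero_mul, add_zero] at hk
  exact hb hk

namespace VertexOperatorAlgebra

open SeminormedGrading

section Annihilated

variable {V : Type u} [AddCommGroup V] [Module ℂ V] [VertexOperatorAlgebra V]

theorem uL_lie_mul_mem_NR {n : ℕ} {m : ℤ} {x p : UnivEnv V} (hn : 1 ≤ n)
    (hx : x ∈ (univGrading V).piece (-m)) (hann : (univGrading V).IsAnnihilated n m x)
    (hp : p ∈ (univGrading V).piece n) : ⁅uL V n, p⁆ * x ∈ (univGrading V).NR 1 (-m) := by
  have hswap := (univGrading V).mul_NL hp (piece_le_NL (n := 1) (by lia) (uL_mem n))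
  rw [add_neg_cancel] at hswap
  rw [Ring.lie_def, sub_mul]
  exact sub_mem (hann _ (uL_mem n) p hp) (NL_zero_mul hswap hx)

theorem uL_zero_mul_add_smul_mem_NR {m : ℕ} {x : UnivEnv V} (hm : 1 ≤ m)
    (hx : x ∈ (univGrading V).piece (-m)) (hann : (univGrading V).IsAnnihilated m m x) :
    uL V 0 * x + (((m : ℂ) ^ 2 - 1) / 24 * centralCharge V) • x ∈ (univGrading V).NR 1 (-m) := by
  have hp : uL V (-m) ∈ (univGrading V).piece m := by simpa using uL_mem (V := V) (-m)
  have hlie := uL_lie_mul_mem_NR hm hx hann hp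
  have hm0 : (m : ℂ) ≠ 0 := by exact_mod_cast (by lia : m ≠ 0)
  refine (smul_mem_NL_iff (mul_ne_zero two_ne_zero hm0)).1 (?_ : _ ∈ (univGrading V).NR 1 (-m))
  convert hlie using 1
  rw [uL_lie_uL_neg, add_mul, smul_mul_assoc, ← Algebra.smul_def]
  module

theorem mul_uL_mul_uL_neg_sub_smul_mem_NR {m k : ℕ} {x : UnivEnv V} (hm : 1 ≤ m) (hmk : m < k)
    (hx : x ∈ (univGrading V).piece (-m)) (hann : (univGrading V).IsAnnihilated m m x) :
    x * uL V k * uL V (-k) -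
      (k * (2 * m + centralCharge V / 12 * ((k : ℂ) ^ 2 - (m : ℂ) ^ 2))) • x ∈
      (univGrading V).NR 1 (-m) := by
  have hdeg : x * uL V (-k) ∈ (univGrading V).piece (-m + k) := by
    simpa using (univGrading V).mul_mem hx (uL_mem (-k))
  have hswap : x * uL V (-k) * uL V k ∈ (univGrading V).NR 1 (-m) :=
    NR_mul (piece_le_NL_of_nonpos (by lia) hdeg) (uL_mem k) (by ring)
  have hzero := smul_mem_NL (2 * k : ℂ) (uL_zero_mul_add_smul_mem_NR hm hx hann)
  have hlie : x * uL V 0 = uL V 0 * x + (m : ℂ) • x := by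
    have h := uL_zero_lie hx
    rw [Ring.lie_def, sub_eq_iff_eq_add] at h
    rw [h]
    push_cast
    module
  have hcomm : x * uL V k * uL V (-k) = x * uL V (-k) * uL V k + x * ⁅uL V k, uL V (-k)⁆ := by
    rw [Ring.lie_def]
    noncomm_ring
  convert add_mem hswap hzero using 1
  rw [hcomm, uL_lie_uL_neg, mul_add, mul_smul_comm, hlie, ← Algebra.commutes, ← Algebra.smul_def]
  module

theorem isAnnihilated_of_mul_mul_sub_smul_mem_NR {n d m : ℤ} {x u w : UnivEnv V} {c : ℂ}
    (hc : c ≠ 0) (hann : (univGrading V).IsAnnihilated n d (x * u))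
    (hw : w ∈ (univGrading V).piece (d - m))
    (hred : x * u * w - c • x ∈ (univGrading V).NR 1 (-m)) :
    (univGrading V).IsAnnihilated n m x := by
  intro y hy p hp
  have h₁ := NR_mul (hann y hy p hp) hw (q := -m) (by ring)
  have h₂ := zero_mul_NR (neg_mul_mem _ hy hp) hred
  refine (smul_mem_NL_iff hc).1 (?_ : _ ∈ (univGrading V).NR 1 (-m))
  convert sub_mem h₁ h₂ using 1
  rw [mul_sub, mul_smul_comm, sub_sub_eq_add_sub]
  noncomm_ring

theorem exists_forall_isAnnihilated {m : ℕ} {x : UnivEnv V} (hm : 1 ≤ m)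
    (horth : ∀ n : ℕ, ∀ z ∈ (univGrading V).orthogonal n, (univGrading V).IsAnnihilated n n z)
    (hx : x ∈ (univGrading V).orthogonal m) :
    ∃ N : ℕ, ∀ n ≥ N, (univGrading V).IsAnnihilated n m x := by
  obtain ⟨N, hN⟩ := exists_forall_add_mul_sq_sub_sq_ne_zero
    (mul_ne_zero two_ne_zero (Nat.cast_ne_zero.2 (by lia : m ≠ 0)))
    (centralCharge V / 12) ((m : ℂ) ^ 2)
  refine ⟨m + max N (m + 1), fun n hn => ?_⟩
  obtain ⟨k, rfl⟩ := Nat.exists_eq_add_of_le (show m ≤ n by lia)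
  have hk : (k : ℂ) ≠ 0 := Nat.cast_ne_zero.2 (by lia)
  refine isAnnihilated_of_mul_mul_sub_smul_mem_NR (mul_ne_zero hk (hN k (by lia)))
    (horth (m + k) _ (orthogonal_mul hx (uL_mem k) (by push_cast; ring))) ?_
    (mul_uL_mul_uL_neg_sub_smul_mem_NR hm (by lia) hx.1 (horth m x hx))
  simpa using uL_mem (V := V) (-k)

theorem uMode_mul_mem_NR {m : ℤ} {N : ℕ} {x : UnivEnv V} (hx : x ∈ (univGrading V).piece (-m))
    (hann : ∀ n : ℕ, n ≥ N → (univGrading V).IsAnnihilated n m x) {k : ℕ} {a : V}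
    (ha : a ∈ piece (k + 1)) : uMode a k * x ∈ (univGrading V).NR 1 (-m) := by
  obtain ⟨M, hM⟩ := exists_mode_eq_zero (omega : V) a
  let S : AddSubgroup (UnivEnv V) := ((univGrading V).NR 1 (-m)).comap (AddMonoidHom.mulRight x)
  have hsum : ∀ n ≥ N + 2, ∑ j ∈ Finset.range (M.toNat + 1),
      n.choose j • uMode (mode (omega : V) j a) (k + 1 - j) ∈ S := by
    intro n hn
    obtain ⟨n, rfl⟩ := Nat.exists_eq_add_of_le' (show 1 ≤ n by lia)
    have hlie : ⁅uL V n, uMode a (k - n)⁆ ∈ S := uL_lie_mul_mem_NR (by lia) hx (hann n (by lia))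
      (uMode_mem ha (by push_cast; ring))
    have hmode (j : ℕ) (hj : j ≥ M.toNat + 1) : mode (omega : V) j a = 0 := hM j (by lia)
    convert hlie using 1
    refine Eq.trans ?_ (uMode_lie_uMode_eq_sum_range hmode (n + 1) (k - n)).symm
    refine Finset.sum_congr rfl fun j _ => ?_
    rw [Nat.cast_smul_eq_nsmul]
    congr 2
    push_cast
    ring
  have hzero : uMode (Lneg a) (k + 1) * x ∈ (univGrading V).NR 1 (-m) := by
    have h := mem_of_forall_sum_choose_nsmul_mem hsum 0 (by lia)
    rw [Nat.cast_zero, sub_zero] at h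
    exact h
  rw [uMode_Lneg, add_sub_cancel_right, smul_mul_assoc] at hzero
  exact (smul_mem_NL_iff (neg_ne_zero.2 (by exact_mod_cast k.succ_ne_zero))).1 hzero

end Annihilated

section VacuumScalars

variable {V : Type u} [AddCommGroup V] [Module ℂ V] [VertexOperatorAlgebra V]

theorem act_apply_smul (z : UnivEnv V) (c : ℂ) (v : V) : act V z (c • v) = c • act V z v := by
  rw [← act_algebraMap, ← act_mul_apply, ← Algebra.commutes, act_mul_apply, act_algebraMap]

theorem envNLPiece_le_envNL (n p : ℤ) : envNLPiece V n p ≤ envNL V n :=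
  iSup₂_le fun j hj => mul_le_mul' le_top (le_iSup₂_of_le j hj le_rfl)

theorem act_vac_eq_zero_of_mem_NL {p : ℤ} {z : UnivEnv V} (hz : z ∈ (univGrading V).NL 1 p) :
    act V z vac = 0 :=
  act_mem_of_mem_imageInUnivEnv (S := {0}) (fun _ hy => actEnv_eq_zero_of_mem_envNL zero_lt_one
    (envNLPiece_le_envNL 1 p hy) vac_mem_pieceInt) hz

/-- The elements of `𝒰_0` that act on the vacuum by a scalar `μ` and on the class of `x` in
`𝒰_{-m} / N_R^1 𝒰_{-m}` by the same scalar. -/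
def vacuumScalars (m : ℤ) (x : UnivEnv V) : Subalgebra ℂ (UnivEnv V) where
  carrier := {r | r ∈ (univGrading V).piece 0 ∧ ∃ μ : ℂ,
    act V r vac = μ • vac ∧ r * x - μ • x ∈ (univGrading V).NR 1 (-m)}
  algebraMap_mem' c := by
    refine ⟨algebraMap_mem c, c, ?_, ?_⟩
    · exact act_algebraMap c vac
    · rw [← Algebra.smul_def, sub_self]
      exact zero_mem _
  add_mem' := by
    rintro r s ⟨hr, μ, hrvac, hrx⟩ ⟨hs, ν, hsvac, hsx⟩
    refine ⟨add_mem hr hs, μ + ν, ?_, ?_⟩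
    · rw [add_smul, ← hrvac, ← hsvac, map_add]
      rfl
    · rw [add_mul, add_smul, add_sub_add_comm]
      exact add_mem hrx hsx
  mul_mem' := by
    rintro r s ⟨hr, μ, hrvac, hrx⟩ ⟨hs, ν, hsvac, hsx⟩
    refine ⟨by simpa using (univGrading V).mul_mem hr hs, ν * μ, ?_, ?_⟩
    · rw [act_mul_apply, hsvac, act_apply_smul, hrvac, smul_smul]
    · have h := add_mem (zero_mul_NR hr hsx) (smul_mem_NL ν hrx)
      rwa [mul_sub, mul_smul_comm, smul_sub, sub_add_sub_cancel, ← mul_assoc, smul_smul] at h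

theorem NL_one_le_vacuumScalars {m : ℤ} {x r : UnivEnv V}
    (hx : x ∈ (univGrading V).piece (-m)) (hr : r ∈ (univGrading V).NL 1 0) :
    r ∈ vacuumScalars m x := by
  refine ⟨(univGrading V).NL_le _ _ hr, 0, ?_, ?_⟩
  · rw [act_vac_eq_zero_of_mem_NL hr, zero_smul]
  · rw [zero_smul, sub_zero]
    exact NL_zero_mul hr hx

theorem mem_vacuumScalars_of_mem_piece_zero {m : ℤ} {N : ℕ} {x r : UnivEnv V}
    (hx : x ∈ (univGrading V).piece (-m))
    (hann : ∀ n : ℕ, n ≥ N → (univGrading V).IsAnnihilated n m x)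
    (hr : r ∈ (univGrading V).piece 0) : r ∈ vacuumScalars m x := by
  refine mem_subalgebra_of_mem_piece_zero (fun r => NL_one_le_vacuumScalars hx) (fun k a ha => ?_)
    hr
  refine ⟨uMode_mem ha (by lia), 0, ?_, ?_⟩
  · rw [act_uMode, zero_smul, mode_vac_nonneg a (by lia)]
  · rw [zero_smul, sub_zero]
    exact uMode_mul_mem_NR hx hann ha

theorem act_vac_eq_zero_of_mul_mem_NR {m : ℤ} {x r : UnivEnv V}
    (hxNR : x ∉ (univGrading V).NR 1 (-m)) (hr : r ∈ vacuumScalars m x)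
    (hrx : r * x ∈ (univGrading V).NR 1 (-m)) : act V r vac = 0 := by
  obtain ⟨-, μ, hvac, hμ⟩ := hr
  obtain rfl | hμ0 := eq_or_ne μ 0
  · rw [hvac, zero_smul]
  · have h := sub_mem hrx hμ
    rw [sub_sub_cancel] at h
    exact (hxNR ((smul_mem_NL_iff hμ0).1 h)).elim

end VacuumScalars

section Orthogonal

variable {V : Type u} [AddCommGroup V] [Module ℂ V] [VertexOperatorAlgebra V]

theorem act_vac_eq_zero_of_mem_piece {m : ℤ} {n : ℕ} {x p : UnivEnv V}
    (hxNR : x ∉ (univGrading V).NR 1 (-m))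
    (hscal : ∀ r ∈ (univGrading V).piece 0, r ∈ vacuumScalars m x)
    (hann : (univGrading V).IsAnnihilated n m x) {e : ModeTransition V n (-n)}
    (he : ∀ z : Verma V (ZhuAlgebra V) n, (univGrading V).star e z = z)
    (hp : p ∈ (univGrading V).piece n) : act V p vac = 0 := by
  let evalVac : UnivEnv V →+ V := (AddMonoidHom.eval (vac : V)).comp (act V).toAddMonoidHom
  refine mem_of_forall_mul_mem (S := evalVac.ker) he (fun z => act_vac_eq_zero_of_mem_NL) hp
    fun u _ y hy => ?_
  change act V (u * (y * p)) vac = 0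
  rw [act_mul_apply, act_vac_eq_zero_of_mul_mem_NR hxNR
    (hscal _ (neg_mul_mem _ hy hp)) (hann y hy p hp), map_zero]

theorem omega_ne_zero_of_notMem_NR {m : ℕ} {x : UnivEnv V} (hm : 1 ≤ m)
    (hx : x ∈ (univGrading V).piece (-m)) (hxNR : x ∉ (univGrading V).NR 1 (-m)) :
    (omega : V) ≠ 0 := by
  intro hω
  have h := uL_zero_lie hx
  rw [uL, hω, uMode_zero, Ring.lie_def, zero_mul, mul_zero, sub_zero] at h
  refine hxNR ?_
  rw [(smul_eq_zero.1 h.symm).resolve_left (by exact_mod_cast (by lia : -(m : ℤ) ≠ 0))]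
  exact zero_mem _

theorem orthogonal_le_NR {e : ∀ n : ℕ, ModeTransition V n (-n)}
    (right : ∀ (n : ℕ) (a : ModeTransition V n (-n)), (univGrading V).star a (e n) = a)
    (left : ∀ (n : ℕ) (z : Verma V (ZhuAlgebra V) n), (univGrading V).star (e n) z = z) (m : ℕ) :
    (univGrading V).orthogonal m ≤ (univGrading V).NR 1 (-m) := by
  intro x hx
  obtain rfl | hm := m.eq_zero_or_pos
  · have h := hx.2 1 (univGrading V).one_mem
    rwa [mul_one] at h
  by_contra hxNR
  obtain ⟨N, hN⟩ := exists_forall_isAnnihilated hm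
    (fun n z hz => isAnnihilated_of_mem_orthogonal (right n) hz) hx
  have hL : act V (uL V (-(max N 3 : ℕ))) vac = 0 :=
    act_vac_eq_zero_of_mem_piece hxNR
      (fun r hr => mem_vacuumScalars_of_mem_piece_zero hx.1 hN hr)
      (hN _ (le_max_left N 3)) (left _) (by simpa using uL_mem (V := V) (-(max N 3 : ℕ)))
  rw [uL, act_uMode, neg_add_eq_sub] at hL
  exact omega_ne_zero_of_notMem_NR hm hx.1 hxNR
    (omega_eq_zero_of_mode_vac_eq_zero (le_max_right N 3) hL)

end Orthogonal

end VertexOperatorAlgebra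

end

noncomputable section

namespace SeminormedGrading

variable {R : Type u} [Ring R] {G : SeminormedGrading R}

theorem star_eq_self_of_contract {m : ℤ} {e : G.MTA m (-m)} (h : ∀ t, G.contract m t e = t)
    {n : ℤ} (a : G.MTA n (-m)) : G.star a e = a := by
  induction a using BalTensor.induction with
  | tmul x t => rw [star_tmul, h]
  | zero => rw [map_zero, AddMonoidHom.zero_apply]
  | add a b ha hb => rw [map_add, AddMonoidHom.add_apply, ha, hb]

end SeminormedGrading

namespace VertexOperatorAlgebra

variable {V : Type u} [AddCommGroup V] [Module ℂ V] [VertexOperatorAlgebra V]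

theorem star_lieSmul {d n m q : ℤ} (x : finLiePiece V d) (a : ModeTransition V n (-m))
    (b : ModeTransition V m q) : star (lieSmul x a) b = lieSmul x (star a b) :=
  (univGrading V).star_lact (ofLie x) a b

theorem star_smulLie {d n m q : ℤ} (a : ModeTransition V n (-m)) (b : ModeTransition V m q)
    (x : finLiePiece V d) : star a (smulLie b x) = smulLie (star a b) x :=
  (univGrading V).star_ract (ofLie x) a b

theorem lieMode_vac_mem_finLiePiece : lieMode (vac : V) (-1) ∈ finLiePiece V (0 : ℕ) :=
  lieMode_mem_finLiePiece vac_mem_pieceInt rfl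

theorem lieSmul_vac_injective (n q : ℤ) : Function.Injective
    (lieSmul (n := n) (q := q) ⟨lieMode (vac : V) (-1), lieMode_vac_mem_finLiePiece⟩) :=
  (univGrading V).lact_one_injective Int.natCast_zero _ uMode_vac n

theorem smulLie_vac_injective (n q : ℤ) : Function.Injective
    fun a : ModeTransition V n q => smulLie a ⟨lieMode vac (-1), lieMode_vac_mem_finLiePiece⟩ :=
  (univGrading V).ract_one_injective Int.natCast_zero _ uMode_vac n q

theorem starEnd_eq_one_iff {M : Type u} [AddCommGroup M] [Module (ZhuAlgebra V) M] {d : ℤ}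
    {e : ModeTransition V d (-d)} :
    starEnd M d e = 1 ↔ ∀ z : Verma V M d, (univGrading V).star e z = z :=
  DFunLike.ext_iff

theorem starEnd_zhu_injective {d : ℤ} {e : ModeTransition V d (-d)}
    (he : ∀ a : ModeTransition V d (-d), star a e = a) :
    Function.Injective (starEnd (V := V) (ZhuAlgebra V) d) := fun a b hab => by
  rw [← he a, ← he b]
  exact (univGrading V).star_eq_of_zhu (DFunLike.congr_fun hab) e

theorem star_eq_self_of_starEnd_eq_one {I : ∀ d : ℕ, ModeTransition V d (-d)}
    (hI : ∀ d : ℕ, IsUnity (I d)) (h : ∀ d : ℕ, starEnd (ZhuAlgebra V) d (I d) = 1) {n : ℤ}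
    {m : ℕ} (a : ModeTransition V n (-m)) : star a (I m) = a := by
  simp only [starEnd_eq_one_iff] at h
  exact SeminormedGrading.star_eq_self_of_contract (SeminormedGrading.contract_eq_self (h m)
    (orthogonal_le_NR (fun d a => (hI d a).2) h m)) a

end VertexOperatorAlgebra

end

open VertexOperatorAlgebra

theorem mainTheorem10 (V : Type u) [AddCommGroup V] [Module ℂ V] [VertexOperatorAlgebra V]
    (I : ∀ d : ℕ, VertexOperatorAlgebra.ModeTransition V d (-d))
    (hI : ∀ d : ℕ, VertexOperatorAlgebra.IsUnity (I d)) :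
    List.TFAE [
      ∀ (d n m : ℕ) (x : VertexOperatorAlgebra.finLiePiece V d)
        (a : VertexOperatorAlgebra.ModeTransition V n (-m)),
        VertexOperatorAlgebra.star (VertexOperatorAlgebra.lieSmul x (I n)) a =
            VertexOperatorAlgebra.lieSmul x a ∧
          VertexOperatorAlgebra.star a (VertexOperatorAlgebra.smulLie (I m) x) =
            VertexOperatorAlgebra.smulLie a x,
      ∀ (n m : ℕ) (a : VertexOperatorAlgebra.ModeTransition V n (-m)),
        VertexOperatorAlgebra.star (I n) a = a ∧ VertexOperatorAlgebra.star a (I m) = a,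
      ∀ d : ℕ, VertexOperatorAlgebra.starEnd (VertexOperatorAlgebra.ZhuAlgebra V) d (I d) = 1,
      ∀ d : ℕ, VertexOperatorAlgebra.starEnd (VertexOperatorAlgebra.ZhuAlgebra V) d (I d) = 1 ∧
        Function.Injective
          (VertexOperatorAlgebra.starEnd (V := V) (VertexOperatorAlgebra.ZhuAlgebra V) d),
      ∀ (d : ℕ) (M : Type u) [AddCommGroup M] [Module (VertexOperatorAlgebra.ZhuAlgebra V) M],
        VertexOperatorAlgebra.starEnd M d (I d) = 1] := by
  tfae_have 2 → 1 := fun h d n m x a =>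
    ⟨(star_lieSmul x _ a).trans (congrArg _ (h n m a).1),
      (star_smulLie a _ x).trans (congrArg (smulLie · x) (h n m a).2)⟩
  tfae_have 1 → 2 := fun h n m a =>
    ⟨lieSmul_vac_injective _ _ ((star_lieSmul _ _ a).symm.trans (h 0 n m _ a).1),
      smulLie_vac_injective _ _ ((star_smulLie a _ _).symm.trans (h 0 n m _ a).2)⟩
  tfae_have 2 → 3 := fun h d => starEnd_eq_one_iff.2 fun z =>
    (univGrading V).star_zhu_eq_self_of_zero Int.natCast_zero (fun z => (h d 0 z).1) z
  tfae_have 3 → 5 := fun h d M _ _ => starEnd_eq_one_iff.2 fun z =>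
    (univGrading V).star_eq_self_of_zhu (starEnd_eq_one_iff.1 (h d)) z
  tfae_have 5 → 3 := fun h d => h d _
  tfae_have 3 → 4 := fun h d =>
    ⟨h d, starEnd_zhu_injective fun a => (hI d a).2⟩
  tfae_have 4 → 3 := fun h d => (h d).1
  tfae_have 3 → 2 := fun h n m a =>
    ⟨(univGrading V).star_eq_self_of_zhu (starEnd_eq_one_iff.1 (h n)) a,
      star_eq_self_of_starEnd_eq_one hI h a⟩
  tfae_finish
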